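/- All graphs are finite and simple. Let $G$ be a graph and let $f:V(G)\to\mathbb N$ satisfy $f(v)\ge d_G(v)$ for every $v$. The expanded-clique graph of $(G,f)$ is obtained by replacing every vertex $v_i$ of $G$ by a clique $V_i$ with $f(v_i)$ vertices (the cliques $V_i$ are disjoint), and by adding, for every edge $v_iv_j$ of $G$, one edge $v_{i,j}v_{j,i}$ with $v_{i,j}\in V_i$ and $v_{j,i}\in V_j$, where $v_{i,j}\ne v_{i,k}$ for $j\ne k$. A graph $H$ is an expanded-clique graph if it is isomorphic to the expanded-clique graph of some such pair $(G,f)$; then $G$ is a root of $H$. Let the following algorithm be implemented on a unit-cost random access machine whose only arithmetic operations are "$+1$", comparison and parity test. The input is a graph $H$ with vertices $1,\dots,n$, given by its adjacency lists in arbitrary order. Initially all vertices are unmarked and have no outsider recorded. 1. Sort the adjacency lists by distributing the vertices in ascending order to the lists of their neighbours. 2. For every unmarked vertex $u$ of degree at least $3$: determine the only possible outsider $o$ of $u$ (a neighbour $o$ of $u$ without neighbours in $N(u)$). If no outsider of $u$ is recorded, do this by adjacency tests among the first three neighbours of $u$ and, if the first two are adjacent, between the first neighbour and every other one, where an adjacency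 test searches both lists in parallel until the shorter one ends. Then go simultaneously through the sorted lists of the neighbours of $u$ other than $o$ to check that $K=N[u]\setminus\{o\}$ is a clique and that every vertex of $K$ has at most one neighbour outside $K$; the outsiders found are recorded at both ends. Answer NO if the check fails, if it contradicts a recorded outsider, or if a vertex of $K\setminus\{u\}$ is already marked. Otherwise mark all vertices of $K$; $K$ becomes an expanded clique. 3. For every vertex $u$ of degree at most $2$ that is still unmarked: traverse the chain (maximal sequence of consecutive vertices of degree at most $2$) of $u$ in both directions. If it closes up to a cycle $C_q$, answer NO if $q=4$ or $q\geq 5$ is odd; the cycle is one expanded clique if $q=3$. If it is not closed, both of its ends are attached to vertices of degree at least $3$, and it has an odd number of vertices, answer NO. In the other cases mark its vertices and divide them consecutively into expanded cliques with two vertices, starting at an end attached to a vertex of degree at least $3$ if there is one; one vertex may remain at the end and forms an expanded clique. 4. Let $G$ have one vertex for every expanded clique, let $f$ be the sizes of the expanded cliques, and let every edge of $H$ between different expanded cliques give an edge of $G$. Answer NO if two edges of $H$ join the same two expanded cliques. Otherwise answer YES and output $(G,f)$. **Theorem.** There is a constant $C$ such that for every graph $H$ with $n\ge 1$ vertices and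 $m$ edges, and every order of its adjacency lists, this algorithm terminates after at most $C(n+m)$ steps. If $H$ is an expanded-clique graph, it answers YES and outputs a pair $(G,f)$ such that $H$ is (isomorphic to) the expanded-clique graph of $(G,f)$; otherwise it answers NO. In particular, expanded-clique graphs are recognized in linear time. -/

import Mathlib

namespace ExpandedClique

/-! ## Expanded-clique graphs -/

/-- The expanded-clique graph of `(G, f)`. The expanded clique of a vertex `i` of `G` consists of
one vertex `⟨i, inl j⟩` (the vertex `v_{i,j}`) for every neighbour `j` of `i`, and of
`f i - d(i)` further (simplicial) vertices `⟨i, inr k⟩`. The vertices of one expanded clique are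
pairwise adjacent, and `v_{i,j}` is adjacent to `v_{j,i}` for every edge `ij` of `G`. -/
def expandedCliqueGraph {W : Type*} (G : SimpleGraph W) (f : W → ℕ) :
    SimpleGraph (Σ i : W, G.neighborSet i ⊕ Fin (f i - (G.neighborSet i).ncard)) where
  Adj a b := (a.1 = b.1 ∧ a ≠ b) ∨
    ∃ h : G.Adj a.1 b.1, a.2 = Sum.inl ⟨b.1, h⟩ ∧ b.2 = Sum.inl ⟨a.1, h.symm⟩
  symm := ⟨by
    rintro a b (⟨h, h'⟩ | ⟨h, h1, h2⟩)
    · exact Or.inl ⟨h.symm, h'.symm⟩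
    · exact Or.inr ⟨h.symm, h2, h1⟩⟩
  loopless := ⟨by
    rintro a (⟨-, h⟩ | ⟨h, -⟩)
    · exact h rfl
    · exact G.loopless.irrefl _ h⟩

/-- `H` is the expanded-clique graph of `(G, f)`, where `f i ≥ d(i)` for every vertex `i` of `G`;
that is, `G` is a root of `H` under the `f`-expanded-clique operation. -/
def IsExpandedCliqueOf {V W : Type*} (H : SimpleGraph V) (G : SimpleGraph W) (f : W → ℕ) : Prop :=
  (∀ i, (G.neighborSet i).ncard ≤ f i) ∧ Nonempty (H ≃g expandedCliqueGraph G f)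

/-- `H` is an expanded-clique graph: it has a (finite, simple) root. -/
def IsExpandedClique {V : Type*} (H : SimpleGraph V) : Prop :=
  ∃ (p : ℕ) (G : SimpleGraph (Fin p)) (f : Fin p → ℕ), IsExpandedCliqueOf H G f

/-! ## A random access machine with unit costs

Programs are built from assignments, tests and loops. They work on finitely many registers and
finitely many arrays that hold natural numbers. The only arithmetic is `+ 1`, so that in `t` steps
no number exceeds the largest input number by more than `t`. -/

/-- Names of the registers. -/
inductive Reg
  | n | answer | cliques | edges | placed
  | u | v | w | z | x | i | j | k | o | w1 | w2 | w3
  | ia | ib | found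
  | q | good | closed | hub | start | before | prev | cur | next
  deriving DecidableEq

/-- Names of the arrays. -/
inductive Arr
  | off | input | adj | deg | current | outsider | clique | size | order | stamp
  | edgeFst | edgeSnd
  deriving DecidableEq

/-- Arithmetic expressions: literals, registers, array cells `a[e]`, and `e + 1`. -/
inductive Exp
  | lit (c : ℕ)
  | reg (r : Reg)
  | cell (a : Arr) (e : Exp)
  | succ (e : Exp)

/-- Tests. -/
inductive Test
  | eq (e₁ e₂ : Exp)
  | lt (e₁ e₂ : Exp)
  | even (e : Exp)
  | not (b : Test)
  | and (b₁ b₂ : Test)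
  | or (b₁ b₂ : Test)

/-- Commands. `ret` ends the whole program at once. -/
inductive Cmd
  | skip
  | ret
  | set (r : Reg) (e : Exp)
  | store (a : Arr) (e₁ e₂ : Exp)
  | seq (c₁ c₂ : Cmd)
  | ite (b : Test) (c₁ c₂ : Cmd)
  | loop (b : Test) (c : Cmd)

/-- Memory contents. -/
structure State where
  reg : Reg → ℕ
  arr : Arr → ℕ → ℕ

def Exp.eval (s : State) : Exp → ℕ
  | .lit c => c
  | .reg r => s.reg r
  | .cell a e => s.arr a (e.eval s)
  | .succ e => e.eval s + 1

/-- Number of steps to evaluate an expression: one per operation. -/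
def Exp.cost : Exp → ℕ
  | .lit _ => 1
  | .reg _ => 1
  | .cell _ e => e.cost + 1
  | .succ e => e.cost + 1

def Test.eval (s : State) : Test → Prop
  | .eq e₁ e₂ => e₁.eval s = e₂.eval s
  | .lt e₁ e₂ => e₁.eval s < e₂.eval s
  | .even e => Even (e.eval s)
  | .not b => ¬ b.eval s
  | .and b₁ b₂ => b₁.eval s ∧ b₂.eval s
  | .or b₁ b₂ => b₁.eval s ∨ b₂.eval s

/-- Number of steps to evaluate a test: one per operation (no operand is skipped). -/
def Test.cost : Test → ℕ
  | .eq e₁ e₂ => e₁.cost + e₂.cost + 1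
  | .lt e₁ e₂ => e₁.cost + e₂.cost + 1
  | .even e => e.cost + 1
  | .not b => b.cost + 1
  | .and b₁ b₂ => b₁.cost + b₂.cost + 1
  | .or b₁ b₂ => b₁.cost + b₂.cost + 1

def State.setReg (s : State) (r : Reg) (y : ℕ) : State :=
  { s with reg := Function.update s.reg r y }

def State.setCell (s : State) (a : Arr) (p y : ℕ) : State :=
  { s with arr := Function.update s.arr a (Function.update (s.arr a) p y) }

/-- How a command ends: normally, or because `ret` has been executed. -/
inductive Outcome
  | normal
  | returned

/-- `Exec c s s' r t`: started in memory `s`, the command `c` terminates after exactly `t` steps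
with memory `s'`, in the way `r`. The rules are deterministic. -/
inductive Exec : Cmd → State → State → Outcome → ℕ → Prop
  | skip (s) : Exec .skip s s .normal 1
  | ret (s) : Exec .ret s s .returned 1
  | set (s r e) : Exec (.set r e) s (s.setReg r (e.eval s)) .normal (e.cost + 1)
  | store (s a e₁ e₂) : Exec (.store a e₁ e₂) s (s.setCell a (e₁.eval s) (e₂.eval s)) .normal
      (e₁.cost + e₂.cost + 1)
  | seq_normal {c₁ c₂ s s₁ s₂ r t₁ t₂} : Exec c₁ s s₁ .normal t₁ → Exec c₂ s₁ s₂ r t₂ →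
      Exec (.seq c₁ c₂) s s₂ r (t₁ + t₂)
  | seq_returned {c₁ c₂ s s₁ t₁} : Exec c₁ s s₁ .returned t₁ →
      Exec (.seq c₁ c₂) s s₁ .returned t₁
  | ite_true {b c₁ c₂ s s₁ r t} : b.eval s → Exec c₁ s s₁ r t →
      Exec (.ite b c₁ c₂) s s₁ r (b.cost + t + 1)
  | ite_false {b c₁ c₂ s s₁ r t} : ¬ b.eval s → Exec c₂ s s₁ r t →
      Exec (.ite b c₁ c₂) s s₁ r (b.cost + t + 1)
  | loop_done {b c s} : ¬ b.eval s → Exec (.loop b c) s s .normal (b.cost + 1)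
  | loop_normal {b c s s₁ s₂ r t₁ t₂} : b.eval s → Exec c s s₁ .normal t₁ →
      Exec (.loop b c) s₁ s₂ r t₂ → Exec (.loop b c) s s₂ r (b.cost + 1 + t₁ + t₂)
  | loop_returned {b c s s₁ t₁} : b.eval s → Exec c s s₁ .returned t₁ →
      Exec (.loop b c) s s₁ .returned (b.cost + 1 + t₁)

/-! ## Input and output

The vertices of a graph of order `n` carry the numbers `1, …, n`; the number `0` stands for null. -/

/-- Adjacency lists of `H`: every list enumerates the neighbours of a vertex, in any order. -/
structure AdjLists {n : ℕ} (H : SimpleGraph (Fin n)) where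
  list : Fin n → List (Fin n)
  nodup : ∀ v, (list v).Nodup
  mem_iff : ∀ v w, w ∈ list v ↔ H.Adj v w

/-- The initial memory. Register `n` holds the order of the graph. The adjacency lists are stored
one after the other in the array `input`; the list of the vertex with number `v` occupies the cells
from `off[v]` to `off[v + 1] - 1` (so `off[m]` is the total length of the lists of the vertices `1, …, m - 1`).
Everything else is `0`. -/
def inputState {n : ℕ} {H : SimpleGraph (Fin n)} (L : AdjLists H) : State where
  reg
    | .n => n
    | _ => 0
  arr
    | .off => fun m => ((List.ofFn L.list).take (m - 1)).flatten.length
    | .input => fun i => ((List.ofFn L.list).flatten.map fun w => (w : ℕ) + 1).getD i 0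
    | _ => fun _ => 0

/-- The graph in the final memory. Its vertices are numbered from `1` to the content of the
register `cliques`, and its edges are the pairs `edgeFst[k], edgeSnd[k]`, where `k` is less than
the content of the register `edges`. -/
def outputGraph (s : State) : SimpleGraph (Fin (s.reg .cliques)) :=
  SimpleGraph.fromRel fun i j =>
    ∃ k < s.reg .edges, s.arr .edgeFst k = (i : ℕ) + 1 ∧ s.arr .edgeSnd k = (j : ℕ) + 1

/-- The function on the vertices of `outputGraph s` in the final memory. -/
def outputFun (s : State) : Fin (s.reg .cliques) → ℕ := fun i => s.arr .size ((i : ℕ) + 1)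

/-! ## The recognition algorithm -/

instance : Coe Reg Exp := ⟨Exp.reg⟩

infixr:30 " ;; " => Cmd.seq

/-- `if b then c`. -/
def Cmd.when (b : Test) (c : Cmd) : Cmd := .ite b c .skip

/-- `for r = lo, …, hi - 1 do c`. -/
def forRange (r : Reg) (lo hi : Exp) (c : Cmd) : Cmd :=
  .set r lo ;; .loop (.lt r hi) (c ;; .set r (.succ r))

/-- `for r ∈ V(H) do c`. -/
def forVertices (r : Reg) (c : Cmd) : Cmd := forRange r (.lit 1) (.succ Reg.n) c

/-- `for r ∈ a.Adj do c`, where `pos` runs through the cells of the sorted adjacency list of `a`. -/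
def forNeighbors (pos r a : Reg) (c : Cmd) : Cmd :=
  forRange pos (.cell .off a) (.cell .off (.succ a)) (.set r (.cell .adj pos) ;; c)

/-- Sort the adjacency lists (from `input` into `adj`, each list in its own cells), and compute the
degrees: every vertex in ascending order is appended to the lists of its neighbours. -/
def sortLists : Cmd :=
  forVertices .u (.store .current Reg.u (.cell .off Reg.u)) ;;
  forVertices .u
    (forRange .i (.cell .off Reg.u) (.cell .off (.succ Reg.u))
      (.set .w (.cell .input Reg.i) ;;
       .store .adj (.cell .current Reg.w) Reg.u ;;
       .store .current Reg.w (.succ (.cell .current Reg.w)) ;;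
       .store .deg Reg.w (.succ (.cell .deg Reg.w))))

/-- Initial values of the fields of the vertices. The array `clique` will hold the number of the
expanded clique of a vertex, and the value `0` says that the vertex is unmarked. -/
def initFields : Cmd :=
  forVertices .u
    (.store .clique Reg.u (.lit 0) ;;
     .store .outsider Reg.u (.lit 0) ;;
     .store .current Reg.u (.cell .off Reg.u))

/-- Open a new expanded clique. -/
def newClique : Cmd := .set .cliques (.succ Reg.cliques)

/-- Mark `r` as a vertex of the expanded clique that was opened last. The array `order` lists the
marked vertices in the order in which they were marked. -/
def mark (r : Reg) : Cmd :=
  .store .clique r Reg.cliques ;;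
  .store .size Reg.cliques (.succ (.cell .size Reg.cliques)) ;;
  .store .order Reg.placed r ;;
  .set .placed (.succ Reg.placed)

/-- Set `found` to `1` if `ab ∈ E(H)` and to `0` otherwise: both adjacency lists are searched in
parallel until the shorter one ends. -/
def testAdj (a b : Reg) : Cmd :=
  .set .found (.lit 0) ;;
  .set .ia (.cell .off a) ;;
  .set .ib (.cell .off b) ;;
  .loop (.and (.eq Reg.found (.lit 0))
      (.and (.lt Reg.ia (.cell .off (.succ a))) (.lt Reg.ib (.cell .off (.succ b)))))
    (Cmd.when (.or (.eq (.cell .adj Reg.ia) b) (.eq (.cell .adj Reg.ib) a)) (.set .found (.lit 1)) ;;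
     .set .ia (.succ Reg.ia) ;;
     .set .ib (.succ Reg.ib))

/-- Determine the only possible outsider `o` of the vertex `u` of degree at least `3`. -/
def findOutsider : Cmd :=
  Cmd.when (.eq (.cell .outsider Reg.u) (.lit 0))
    (.set .w1 (.cell .adj (.cell .off Reg.u)) ;;
     .set .w2 (.cell .adj (.succ (.cell .off Reg.u))) ;;
     .set .w3 (.cell .adj (.succ (.succ (.cell .off Reg.u)))) ;;
     testAdj .w1 .w2 ;;
     .ite (.eq Reg.found (.lit 0))
       (testAdj .w1 .w3 ;;
        .ite (.eq Reg.found (.lit 0))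
          (.store .outsider Reg.u Reg.w1)
          (.store .outsider Reg.u Reg.w2))
       (forNeighbors .i .w .u
         (Cmd.when (.not (.eq Reg.w Reg.w1))
           (testAdj .w .w1 ;;
            Cmd.when (.eq Reg.found (.lit 0)) (.store .outsider Reg.u Reg.w))))) ;;
  .set .o (.cell .outsider Reg.u) ;;
  Cmd.when (.not (.eq Reg.o (.lit 0))) (.store .outsider Reg.o Reg.u)

/-- Advance `r.current` as long as the list lasts and `b` holds. Passing over a vertex other than
`u` makes it the outsider of `r`; the program ends with the answer NO if `r` has another one. -/
def passOver (r : Reg) (b : Test) : Cmd :=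
  .loop (.and (.lt (.cell .current r) (.cell .off (.succ r))) b)
    (.set .x (.cell .adj (.cell .current r)) ;;
     Cmd.when (.not (.eq Reg.x Reg.u))
       (.ite (.or (.eq (.cell .outsider r) (.lit 0)) (.eq (.cell .outsider r) Reg.x))
         (.store .outsider r Reg.x ;; .store .outsider Reg.x r)
         .ret) ;;
     .store .current r (.succ (.cell .current r)))

/-- Check that `u`, of degree at least `3`, is simplicial or 1-simplicial, and that `u` and its
neighbours other than its outsider `o` form a clique each vertex of which has at most one further
neighbour; this clique becomes an expanded clique. -/
def isSimp1Simp : Cmd :=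
  findOutsider ;;
  forNeighbors .i .w .u
    (Cmd.when (.not (.eq Reg.w Reg.o))
      (forNeighbors .j .z .u
        (Cmd.when (.and (.not (.eq Reg.z Reg.w)) (.not (.eq Reg.z Reg.o)))
          (passOver .z (.not (.eq (.cell .adj (.cell .current Reg.z)) Reg.w)) ;;
           Cmd.when (.eq (.cell .current Reg.z) (.cell .off (.succ Reg.z))) .ret ;;
           .store .current Reg.z (.succ (.cell .current Reg.z)))))) ;;
  newClique ;;
  mark .u ;;
  forNeighbors .i .w .u
    (Cmd.when (.not (.eq Reg.w Reg.o))
      (Cmd.when (.not (.eq (.cell .clique Reg.w) (.lit 0))) .ret ;;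
       mark .w ;;
       passOver .w (.eq (.lit 0) (.lit 0))))

/-- `r :=` the neighbour of `a` different from `b`, or null if there is none (`a` has degree at most
`2`; if `b` is null, the first neighbour is taken). -/
def otherNeighbor (r a b : Reg) : Cmd :=
  .ite (.eq (.cell .deg a) (.lit 0))
    (.set r (.lit 0))
    (.set r (.cell .adj (.cell .off a)) ;;
     Cmd.when (.eq r b)
       (.ite (.eq (.cell .deg a) (.lit 2))
         (.set r (.cell .adj (.succ (.cell .off a))))
         (.set r (.lit 0))))

/-- Traverse the chain of `u` from `u` in both directions. Afterwards `closed` is `1` if the chain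
is a component that is a cycle, `good` is `1` if the chain has an end of degree at most `1`, `q` is
the number of its vertices of degree at most `2`, and `start` is one of these vertices, from which
the chain can be traversed completely in the direction away from `before`: one that follows an
end `before` of degree at least `3`, if there is such an end. -/
def traverseChain : Cmd :=
  .set .q (.lit 1) ;;
  .set .good (.lit 0) ;;
  .set .closed (.lit 0) ;;
  .set .hub (.lit 0) ;;
  .set .start Reg.u ;;
  .set .before (.lit 0) ;;
  Cmd.when (.lt (.cell .deg Reg.u) (.lit 2)) (.set .good (.lit 1)) ;;
  forNeighbors .i .w .u
    (Cmd.when (.eq Reg.closed (.lit 0))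
      (.set .prev Reg.u ;;
       .loop (.and (.eq (.cell .deg Reg.w) (.lit 2)) (.not (.eq Reg.w Reg.u)))
         (.set .q (.succ Reg.q) ;;
          otherNeighbor .v .w .prev ;;
          .set .prev Reg.w ;;
          .set .w Reg.v) ;;
       .ite (.eq Reg.w Reg.u)
         (.set .closed (.lit 1))
         (.ite (.eq (.cell .deg Reg.w) (.lit 1))
           (.set .q (.succ Reg.q) ;;
            .set .good (.lit 1) ;;
            Cmd.when (.eq Reg.hub (.lit 0)) (.set .start Reg.w))
           (.set .hub (.lit 1) ;;
            .set .start Reg.prev ;;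
            .set .before Reg.w))))

/-- Divide the chain, from `start` on, into expanded cliques with two vertices each (one vertex
may remain at the end). -/
def pairChain : Cmd :=
  .set .cur Reg.start ;;
  .set .prev Reg.before ;;
  .loop (.not (.eq Reg.cur (.lit 0)))
    (newClique ;;
     mark .cur ;;
     otherNeighbor .next .cur .prev ;;
     .set .prev Reg.cur ;;
     .set .cur (.lit 0) ;;
     Cmd.when (.not (.eq Reg.next (.lit 0)))
       (mark .next ;;
        otherNeighbor .cur .next .prev ;;
        .set .prev Reg.next ;;
        Cmd.when (.not (.eq (.cell .clique Reg.cur) (.lit 0))) (.set .cur (.lit 0))))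

/-- Check that the chain of the vertex `u` of degree at most `2` is good, and divide it into
expanded cliques. If the chain is closed, a component of `H` is a cycle `C_q`: it is a single
expanded clique for `q = 3`, the answer is NO for `q = 4` and for odd `q ≥ 5`. -/
def isGoodChain : Cmd :=
  traverseChain ;;
  .ite (.eq Reg.closed (.lit 1))
    (.ite (.eq Reg.q (.lit 3))
      (newClique ;; mark .u ;; forNeighbors .i .w .u (mark .w))
      (.ite (.or (.eq Reg.q (.lit 4)) (.not (.even Reg.q))) .ret pairChain))
    (.ite (.or (.eq Reg.good (.lit 1)) (.even Reg.q)) pairChain .ret)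

/-- Build `(G, f)`. The vertices of `G` are the numbers of the expanded cliques, the array `size`
holds `f`, and an edge of `G` is listed for every edge of `H` between two expanded cliques; if two
such edges join the same pair of expanded cliques, the answer is NO. -/
def buildRoot : Cmd :=
  forRange .k (.lit 0) Reg.placed
    (.set .v (.cell .order Reg.k) ;;
     forNeighbors .i .w .v
       (Cmd.when (.not (.eq (.cell .clique Reg.w) (.cell .clique Reg.v)))
         (Cmd.when (.eq (.cell .stamp (.cell .clique Reg.w)) (.cell .clique Reg.v)) .ret ;;
          .store .stamp (.cell .clique Reg.w) (.cell .clique Reg.v) ;;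
          Cmd.when (.lt (.cell .clique Reg.v) (.cell .clique Reg.w))
            (.store .edgeFst Reg.edges (.cell .clique Reg.v) ;;
             .store .edgeSnd Reg.edges (.cell .clique Reg.w) ;;
             .set .edges (.succ Reg.edges)))))

/-- The recognition algorithm. At the end the register `answer` holds `1` for YES, and `0` for
NO. -/
def recognize : Cmd :=
  sortLists ;;
  initFields ;;
  forVertices .u
    (Cmd.when (.and (.eq (.cell .clique Reg.u) (.lit 0)) (.lt (.lit 2) (.cell .deg Reg.u)))
      isSimp1Simp) ;;
  forVertices .u
    (Cmd.when (.eq (.cell .clique Reg.u) (.lit 0)) isGoodChain) ;;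
  buildRoot ;;
  .set .answer (.lit 1)

end ExpandedClique

open ExpandedClique

namespace ExpandedClique

/-! ## Reasoning about programs -/

/-! A graph is an expanded-clique graph exactly if its vertices can be partitioned into cliques such
that every vertex has at most one neighbour outside its clique and any two cliques are joined by at
most one edge (`Good`). The expanded cliques form such a partition (`yes_of_isExpandedClique`);
conversely, contracting the classes yields a root (`isExpandedCliqueOf_of_partition`). It remains to
see that the marks form a good partition whenever the program reaches its end, and that `ret` is
executed only if no good partition exists.

The first point is maintained directly: `Cliques` is an invariant of the marking, and the last phase
verifies that no two classes are joined twice (`Built.good`).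

For the second point, let `P` be any good partition. A neighbour of `u` outside the class of `u` has
no neighbour in `N(u)` (`Good.not_adj_of_outside`), so for degree at least three a few adjacency
tests leave one candidate `o`, and the class of `u` must be `N[u]` without `o`. Hence the classes of
the vertices of large degree are forced, and a failed test refutes `P`. Along a chain of vertices of
degree at most two that is not a triangle, the edges inside a class and the edges between classes
alternate (`Thru.parity`). An unmarked chain is left through an edge between classes at an end of
large degree, so two such ends force an even number of vertices; a cycle other than a triangle must
be even and different from a 4-cycle. The pairing chosen on a chain need not agree with `P`. This
does no harm: if two edges join the same two marked cliques, their ends induce a 4-cycle, which no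
graph with a good partition contains (`Good.no_square`).

The running time is amortized. Treating `u` costs a constant times the degrees of `u` and of the
vertices in its clique, all of which become marked, so `weight` pays for it. The degree of the
outsider must not enter; this is why adjacency tests stop at the end of the shorter list
(`Net.sum_min_le`). The clique test looks at all pairs of vertices of the clique, but almost every
pair advances a pointer in a sorted list, and these pointers never move back (`advance`,
`sum_skips_le`). Chains are paid by their newly marked vertices.

`Runs` is a weakest precondition with a clock: one postcondition for normal termination, one for
`ret`. The facts about recorded outsiders and forced classes have the form "for every good `P`",
since in a graph without good partition the recorded data may be wrong until this is detected. -/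

/-- Started in `s` at time `t`, the command `c` ends normally with a memory and a time that satisfy
`N`, or it ends the program at a time that satisfies `R`. -/
def Runs (c : Cmd) (N : State → ℕ → Prop) (R : ℕ → Prop) (s : State) (t : ℕ) : Prop :=
  ∃ s' r t', Exec c s s' r t' ∧ (r = .normal → N s' (t + t')) ∧ (r = .returned → R (t + t'))

section Rules

variable {N N' : State → ℕ → Prop} {R : ℕ → Prop} {s s' : State} {t : ℕ} {c c₁ c₂ : Cmd} {b : Test}

theorem Runs.mono (h : Runs c N R s t) (hN : ∀ s t, N s t → N' s t) : Runs c N' R s t := by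
  obtain ⟨s', r, t', he, h1, h2⟩ := h
  exact ⟨s', r, t', he, fun h => hN _ _ (h1 h), h2⟩

theorem runs_skip : Runs .skip N R s t ↔ N s (t + 1) := by
  constructor
  · rintro ⟨s', r, t', he, h1, -⟩
    cases he
    exact h1 rfl
  · exact fun h => ⟨s, .normal, 1, .skip s, fun _ => h, fun h => nomatch h⟩

theorem runs_ret : Runs .ret N R s t ↔ R (t + 1) := by
  constructor
  · rintro ⟨s', r, t', he, -, h2⟩
    cases he
    exact h2 rfl
  · exact fun h => ⟨s, .returned, 1, .ret s, fun h => (nomatch h), fun _ => h⟩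

theorem runs_set {r : Reg} {e : Exp} :
    Runs (.set r e) N R s t ↔ N (s.setReg r (e.eval s)) (t + (e.cost + 1)) := by
  constructor
  · rintro ⟨s', r, t', he, h1, -⟩
    cases he
    exact h1 rfl
  · exact fun h => ⟨_, .normal, _, .set s r e, fun _ => h, fun h => nomatch h⟩

theorem runs_store {a : Arr} {e₁ e₂ : Exp} : Runs (.store a e₁ e₂) N R s t ↔
    N (s.setCell a (e₁.eval s) (e₂.eval s)) (t + (e₁.cost + e₂.cost + 1)) := by
  constructor
  · rintro ⟨s', r, t', he, h1, -⟩
    cases he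
    exact h1 rfl
  · exact fun h => ⟨_, .normal, _, .store s a e₁ e₂, fun _ => h, fun h => nomatch h⟩

theorem runs_seq : Runs (.seq c₁ c₂) N R s t ↔ Runs c₁ (fun s t => Runs c₂ N R s t) R s t := by
  constructor
  · rintro ⟨s', r, t', he, h1, h2⟩
    cases he with
    | seq_normal e1 e2 =>
      exact ⟨_, _, _, e1, fun _ => ⟨_, _, _, e2, by simpa only [add_assoc] using h1,
        by simpa only [add_assoc] using h2⟩, fun h => nomatch h⟩
    | seq_returned e1 => exact ⟨_, _, _, e1, fun h => (nomatch h), h2⟩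
  · rintro ⟨s', r, t', he, h1, h2⟩
    cases r with
    | normal =>
      obtain ⟨s'', r, t'', he', h3, h4⟩ := h1 rfl
      exact ⟨_, _, _, .seq_normal he he', by simpa only [add_assoc] using h3,
        by simpa only [add_assoc] using h4⟩
    | returned => exact ⟨_, _, _, .seq_returned he, fun h => (nomatch h), h2⟩

theorem runs_ite : Runs (.ite b c₁ c₂) N R s t ↔
    (b.eval s → Runs c₁ N R s (t + (b.cost + 1))) ∧
      (¬ b.eval s → Runs c₂ N R s (t + (b.cost + 1))) := by
  have key : ∀ x y, t + (x + y + 1) = t + (x + 1) + y := by intros; omega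
  constructor
  · rintro ⟨s', r, t', he, h1, h2⟩
    cases he with
    | ite_true hb e =>
      exact ⟨fun _ => ⟨_, _, _, e, by simpa only [key] using h1, by simpa only [key] using h2⟩,
        fun h => absurd hb h⟩
    | ite_false hb e =>
      exact ⟨fun h => absurd h hb,
        fun _ => ⟨_, _, _, e, by simpa only [key] using h1, by simpa only [key] using h2⟩⟩
  · rintro ⟨h1, h2⟩
    by_cases hb : b.eval s
    · obtain ⟨s', r, t', he, h3, h4⟩ := h1 hb
      exact ⟨_, _, _, .ite_true hb he, by simpa only [key] using h3, by simpa only [key] using h4⟩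
    · obtain ⟨s', r, t', he, h3, h4⟩ := h2 hb
      exact ⟨_, _, _, .ite_false hb he, by simpa only [key] using h3, by simpa only [key] using h4⟩

theorem runs_when : Runs (Cmd.when b c) N R s t ↔
    (b.eval s → Runs c N R s (t + (b.cost + 1))) ∧ (¬ b.eval s → N s (t + (b.cost + 2))) := by
  rw [Cmd.when, runs_ite, runs_skip]
  rfl

theorem runs_loop_of_not (hb : ¬ b.eval s) (h : N s (t + (b.cost + 1))) :
    Runs (.loop b c) N R s t :=
  ⟨s, .normal, _, .loop_done hb, fun _ => h, fun h => nomatch h⟩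

theorem runs_loop_of (hb : b.eval s)
    (h : Runs c (fun s t => Runs (.loop b c) N R s t) R s (t + (b.cost + 1))) :
    Runs (.loop b c) N R s t := by
  obtain ⟨s', r, t', he, h1, h2⟩ := h
  have key : ∀ x, t + (b.cost + 1 + t' + x) = t + (b.cost + 1) + t' + x := by intros; omega
  cases r with
  | normal =>
    obtain ⟨s'', r, t'', he', h3, h4⟩ := h1 rfl
    exact ⟨_, _, _, .loop_normal hb he he', by simpa only [key] using h3,
      by simpa only [key] using h4⟩
  | returned =>
    exact ⟨_, _, _, .loop_returned hb he, fun h => (nomatch h),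
      by simpa only [add_assoc] using h2⟩

/-- The loop rule: `I k` holds after `k` rounds, and there are at most `B` rounds. -/
theorem runs_loop (I : ℕ → State → ℕ → Prop) (B : ℕ) (h0 : I 0 s t)
    (hstep : ∀ k s t, I k s t → b.eval s →
      k < B ∧ Runs c (I (k + 1)) R s (t + (b.cost + 1)))
    (hN : ∀ k s t, I k s t → ¬ b.eval s → N s (t + (b.cost + 1))) :
    Runs (.loop b c) N R s t := by
  -- Induction on the number `d` of rounds that the bound still permits. For `d = 0` the loop
  -- condition must fail, because `hstep` would give `k < B`.
  have main : ∀ d k s t, B ≤ k + d → I k s t → Runs (.loop b c) N R s t := by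
    intro d
    induction d with
    | zero =>
      intro k s t hd hI
      by_cases hb : b.eval s
      · have := (hstep k s t hI hb).1
        omega
      · exact runs_loop_of_not hb (hN k s t hI hb)
    | succ d ih =>
      intro k s t hd hI
      by_cases hb : b.eval s
      · exact runs_loop_of hb ((hstep k s t hI hb).2.mono fun s t h => ih _ s t (by omega) h)
      · exact runs_loop_of_not hb (hN k s t hI hb)
  exact main B 0 s t (by omega) h0

end Rules

/-- The registers that a command may change. -/
def Cmd.regs : Cmd → List Reg
  | .skip => []
  | .ret => []
  | .set r _ => [r]
  | .store _ _ _ => []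
  | .seq c₁ c₂ => c₁.regs ++ c₂.regs
  | .ite _ c₁ c₂ => c₁.regs ++ c₂.regs
  | .loop _ c => c.regs

/-- The arrays that a command may change. -/
def Cmd.arrs : Cmd → List Arr
  | .skip => []
  | .ret => []
  | .set _ _ => []
  | .store a _ _ => [a]
  | .seq c₁ c₂ => c₁.arrs ++ c₂.arrs
  | .ite _ c₁ c₂ => c₁.arrs ++ c₂.arrs
  | .loop _ c => c.arrs

/-- The memories `s` and `s'` agree apart from what `c` may change. -/
structure Agree (c : Cmd) (s s' : State) : Prop where
  reg : ∀ r, r ∉ c.regs → s'.reg r = s.reg r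
  arr : ∀ a, a ∉ c.arrs → s'.arr a = s.arr a

theorem Agree.refl (c : Cmd) (s : State) : Agree c s s := ⟨fun _ _ => rfl, fun _ _ => rfl⟩

theorem Agree.trans {c : Cmd} {s s' s'' : State} (h : Agree c s s') (h' : Agree c s' s'') :
    Agree c s s'' :=
  ⟨fun r hr => (h'.reg r hr).trans (h.reg r hr), fun a ha => (h'.arr a ha).trans (h.arr a ha)⟩

theorem Agree.weaken {c c' : Cmd} {s s' : State} (h : Agree c s s') (hr : c.regs ⊆ c'.regs)
    (ha : c.arrs ⊆ c'.arrs) : Agree c' s s' :=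
  ⟨fun r hr' => h.reg r fun hh => hr' (hr hh), fun a ha' => h.arr a fun hh => ha' (ha hh)⟩

@[simp] theorem State.setReg_reg (s : State) (r r' : Reg) (y : ℕ) :
    (s.setReg r y).reg r' = if r' = r then y else s.reg r' := by
  simp [State.setReg, Function.update_apply]

@[simp] theorem State.setReg_arr (s : State) (r : Reg) (y : ℕ) : (s.setReg r y).arr = s.arr := rfl

@[simp] theorem State.setCell_reg (s : State) (a : Arr) (p y : ℕ) :
    (s.setCell a p y).reg = s.reg := rfl

@[simp] theorem State.setCell_arr (s : State) (a a' : Arr) (p y : ℕ) :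
    (s.setCell a p y).arr a' = if a' = a then Function.update (s.arr a) p y else s.arr a' := by
  by_cases h : a' = a
  · subst h
    simp [State.setCell]
  · simp [State.setCell, h]

/-- The frame property, read off from the syntax of the command. It allows the specification of a
subprogram to mention only what it changes; for concrete commands the side conditions are decidable.
-/
theorem Exec.agree {c : Cmd} {s s' : State} {r : Outcome} {t : ℕ} (h : Exec c s s' r t) :
    Agree c s s' := by
  induction h with
  | skip s => exact Agree.refl _ _
  | ret s => exact Agree.refl _ _
  | set s r e =>
    refine ⟨fun r' hr => ?_, fun a _ => rfl⟩
    have : r' ≠ r := by simpa [Cmd.regs] using hr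
    simp [this]
  | store s a e₁ e₂ =>
    refine ⟨fun r' hr => rfl, fun a' ha => ?_⟩
    have : a' ≠ a := by simpa [Cmd.arrs] using ha
    simp [this]
  | seq_normal _ _ ih1 ih2 =>
    exact (ih1.weaken (List.subset_append_left _ _) (List.subset_append_left _ _)).trans
      (ih2.weaken (List.subset_append_right _ _) (List.subset_append_right _ _))
  | seq_returned _ ih1 =>
    exact ih1.weaken (List.subset_append_left _ _) (List.subset_append_left _ _)
  | ite_true _ _ ih =>
    exact ih.weaken (List.subset_append_left _ _) (List.subset_append_left _ _)
  | ite_false _ _ ih =>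
    exact ih.weaken (List.subset_append_right _ _) (List.subset_append_right _ _)
  | loop_done _ => exact Agree.refl _ _
  | loop_normal _ _ _ ih1 ih2 => exact Agree.trans (ih1.weaken (c' := .loop _ _) (fun _ h => h) (fun _ h => h)) ih2
  | loop_returned _ _ ih => exact ih.weaken (c' := .loop _ _) (fun _ h => h) (fun _ h => h)

theorem Runs.agree {c : Cmd} {N : State → ℕ → Prop} {R : ℕ → Prop} {s : State} {t : ℕ}
    (h : Runs c N R s t) : Runs c (fun s' t' => Agree c s s' ∧ N s' t') R s t := by
  obtain ⟨s', r, t', he, h1, h2⟩ := h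
  exact ⟨s', r, t', he, fun h => ⟨he.agree, h1 h⟩, h2⟩

/-- A specification may use that whatever the command cannot change is unchanged. -/
theorem Runs.spec {c : Cmd} {N N' : State → ℕ → Prop} {R : ℕ → Prop} {s : State} {t : ℕ}
    (h : Runs c N R s t) (hN : ∀ s' t', Agree c s s' → N s' t' → N' s' t') : Runs c N' R s t :=
  h.agree.mono fun s' t' h => hN s' t' h.1 h.2

/-- The rule for `for`-loops whose body does not change the loop register; `I i` holds when the
loop register has got the value `i`. -/
theorem runs_forRange {r : Reg} {lo hi : Exp} {c : Cmd} {N : State → ℕ → Prop} {R : ℕ → Prop}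
    {s₀ : State} {t₀ : ℕ} (I : ℕ → State → ℕ → Prop) (a b : ℕ) (hr : r ∉ c.regs)
    (ha : lo.eval s₀ = a) (hab : a ≤ b) (h0 : I a (s₀.setReg r a) (t₀ + (lo.cost + 1)))
    (hhi : ∀ i s t, Agree (forRange r lo hi c) s₀ s → I i s t → hi.eval s = b)
    (hstep : ∀ i s t, Agree (forRange r lo hi c) s₀ s → a ≤ i → i < b → s.reg r = i → I i s t →
      Runs c (fun s' t' => I (i + 1) (s'.setReg r (i + 1)) (t' + 3)) R s (t + (hi.cost + 3)))
    (hN : ∀ s t, Agree (forRange r lo hi c) s₀ s → I b s t → N s (t + (hi.cost + 3))) :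
    Runs (forRange r lo hi c) N R s₀ t₀ := by
  rw [forRange, runs_seq, runs_set, ha]
  have hr0 : r ∈ (forRange r lo hi c).regs := by simp [forRange, Cmd.regs]
  have hset : ∀ s y, Agree (forRange r lo hi c) s (s.setReg r y) := fun s y => by
    refine ⟨fun r' h => ?_, fun _ _ => rfl⟩
    have : r' ≠ r := fun h' => h (h' ▸ hr0)
    simp [this]
  -- The price of one loop test, including the step that `loop` charges itself. The summand `3` in
  -- `hstep` is the price of the increment of `r`.
  have hcost : (Test.lt (Exp.reg r) hi).cost + 1 = hi.cost + 3 := by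
    simp [Test.cost, Exp.cost]
    omega
  refine runs_loop (fun k s t => a + k ≤ b ∧ s.reg r = a + k ∧ Agree (forRange r lo hi c) s₀ s ∧
    I (a + k) s t) (b - a) ⟨by omega, by simp, hset _ _, h0⟩ ?_ ?_
  · rintro k s t ⟨hk, hrk, hag, hI⟩ hb
    have hlt : a + k < b := by
      have := hhi _ _ _ hag hI
      simpa [Test.eval, Exp.eval, hrk, this] using hb
    refine ⟨by omega, ?_⟩
    rw [hcost, runs_seq]
    refine (hstep (a + k) s t hag (by omega) hlt hrk hI).spec fun s' t' hag' hI' => ?_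
    have hrk' : s'.reg r = a + k := (hag'.reg r hr).trans hrk
    rw [runs_set]
    simp only [Exp.eval, Exp.cost, hrk']
    refine ⟨by omega, by simp; omega, ?_, ?_⟩
    · refine (hag.trans (hag'.weaken ?_ ?_)).trans (hset _ _)
      · intro r' hx
        simp [forRange, Cmd.regs, hx]
      · intro a' hx
        simp [forRange, Cmd.arrs, hx]
    · simpa [add_assoc] using hI'
  · rintro k s t ⟨hk, hrk, hag, hI⟩ hb
    have hlt : ¬ a + k < b := by
      have := hhi _ _ _ hag hI
      simpa [Test.eval, Exp.eval, hrk, this] using hb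
    have : a + k = b := by omega
    rw [this] at hI
    rw [hcost]
    exact hN s t hag hI

theorem runs_forVertices {r : Reg} {c : Cmd} {N : State → ℕ → Prop} {R : ℕ → Prop}
    {s₀ : State} {t₀ : ℕ} (I : ℕ → State → ℕ → Prop) (n : ℕ) (hr : r ∉ c.regs)
    (hn : s₀.reg .n = n) (hc : Reg.n ∉ r :: c.regs) (h0 : I 1 (s₀.setReg r 1) (t₀ + 2))
    (hstep : ∀ i s t, Agree (forVertices r c) s₀ s → 1 ≤ i → i ≤ n → s.reg r = i → I i s t →
      Runs c (fun s' t' => I (i + 1) (s'.setReg r (i + 1)) (t' + 3)) R s (t + 5))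
    (hN : ∀ s t, Agree (forVertices r c) s₀ s → I (n + 1) s t → N s (t + 5)) :
    Runs (forVertices r c) N R s₀ t₀ := by
  refine runs_forRange I 1 (n + 1) hr rfl (by omega) h0 ?_ ?_ ?_
  · intro i s t hag _
    have := hag.reg .n (by simp [forRange, Cmd.regs] at hc ⊢; tauto)
    simp [Exp.eval, this, hn]
  · intro i s t hag h1 h2 h3 h4
    exact hstep i s t hag h1 (by omega) h3 h4
  · exact hN

attribute [simp] Exp.eval Exp.cost Test.eval Test.cost

/-! ## Graphs with sorted adjacency lists -/

/-- A graph on the numbers `1, …, n` with sorted adjacency lists, as they are stored in the arrays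
`off`, `adj` and `deg` after sorting. -/
structure Net where
  n : ℕ
  A : ℕ → ℕ → Prop
  off : ℕ → ℕ
  adj : ℕ → ℕ
  deg : ℕ → ℕ
  symm : ∀ {v w}, A v w → A w v
  irrefl : ∀ {v}, ¬ A v v
  bound : ∀ {v w}, A v w → 1 ≤ v ∧ v ≤ n
  off_one : off 1 = 0
  off_succ : ∀ {v}, 1 ≤ v → v ≤ n → off (v + 1) = off v + deg v
  mono : ∀ {v i j}, 1 ≤ v → v ≤ n → off v ≤ i → i < j → j < off (v + 1) → adj i < adj j
  mem : ∀ {v w}, 1 ≤ v → v ≤ n → (A v w ↔ ∃ i, off v ≤ i ∧ i < off (v + 1) ∧ adj i = w)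

/-- A partition into cliques, given by the class `P v` of every vertex `v`, such that every vertex
has at most one neighbour outside its class, and two classes are joined by at most one edge. -/
structure Good (E : Net) (P : ℕ → ℕ) : Prop where
  clique : ∀ {v w}, 1 ≤ v → v ≤ E.n → 1 ≤ w → w ≤ E.n → v ≠ w → P v = P w → E.A v w
  outside : ∀ {v a b}, E.A v a → E.A v b → P a ≠ P v → P b ≠ P v → a = b
  edge : ∀ {a b c d}, E.A a b → E.A c d → P a = P c → P b = P d → P a ≠ P b → a = c

namespace Net

variable (E : Net)

/-- The graph has a partition as in `Good`. -/
def Yes : Prop := ∃ P, Good E P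

/-- The number `v` is a vertex. -/
def V (v : ℕ) : Prop := 1 ≤ v ∧ v ≤ E.n

variable {E}

theorem A.left {v w : ℕ} (h : E.A v w) : E.V v := E.bound h

theorem A.right {v w : ℕ} (h : E.A v w) : E.V w := E.bound (E.symm h)

theorem A.ne {v w : ℕ} (h : E.A v w) : v ≠ w := fun h' => E.irrefl (h' ▸ h)

theorem A.pos {v w : ℕ} (h : E.A v w) : w ≠ 0 := fun h' => by have := A.right h; simp [V, h'] at this

theorem off_le_succ {v : ℕ} (h : E.V v) : E.off v ≤ E.off (v + 1) := by
  rw [E.off_succ h.1 h.2]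
  omega

theorem A_adj {v i : ℕ} (hv : E.V v) (h1 : E.off v ≤ i) (h2 : i < E.off (v + 1)) :
    E.A v (E.adj i) := (E.mem hv.1 hv.2).2 ⟨i, h1, h2, rfl⟩

theorem A.exists_adj {v w : ℕ} (h : E.A v w) : ∃ i, E.off v ≤ i ∧ i < E.off (v + 1) ∧ E.adj i = w :=
  (E.mem (A.left h).1 (A.left h).2).1 h

theorem adj_inj {v i j : ℕ} (hv : E.V v) (hi : E.off v ≤ i) (hi' : i < E.off (v + 1))
    (hj : E.off v ≤ j) (hj' : j < E.off (v + 1)) (h : E.adj i = E.adj j) : i = j := by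
  rcases lt_trichotomy i j with hij | hij | hij
  · have := E.mono hv.1 hv.2 hi hij hj'
    omega
  · exact hij
  · have := E.mono hv.1 hv.2 hj hij hi'
    omega

/-- The neighbours of a vertex as a finset. -/
def nbrs (E : Net) (v : ℕ) : Finset ℕ := (Finset.Ico (E.off v) (E.off (v + 1))).image E.adj

theorem mem_nbrs {v w : ℕ} (hv : E.V v) : w ∈ E.nbrs v ↔ E.A v w := by
  simp [nbrs, E.mem hv.1 hv.2, and_assoc]

theorem card_nbrs {v : ℕ} (hv : E.V v) : (E.nbrs v).card = E.deg v := by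
  rw [nbrs, Finset.card_image_of_injOn, Nat.card_Ico, E.off_succ hv.1 hv.2, Nat.add_sub_cancel_left]
  intro i hi j hj h
  simp only [Finset.coe_Ico, Set.mem_Ico] at hi hj
  exact adj_inj hv hi.1 hi.2 hj.1 hj.2 h

/-- A sum over an adjacency list is a sum over the neighbours. -/
theorem sum_adj {v : ℕ} (hv : E.V v) (f : ℕ → ℕ) :
    ∑ i ∈ Finset.Ico (E.off v) (E.off (v + 1)), f (E.adj i) = ∑ w ∈ E.nbrs v, f w := by
  rw [nbrs, Finset.sum_image]
  intro i hi j hj h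
  simp only [Finset.coe_Ico, Set.mem_Ico] at hi hj
  exact adj_inj hv hi.1 hi.2 hj.1 hj.2 h

theorem card_le_deg {v : ℕ} (hv : E.V v) (S : Finset ℕ) (h : ∀ w ∈ S, E.A v w) :
    S.card ≤ E.deg v := by
  rw [← card_nbrs hv]
  exact Finset.card_le_card fun w hw => (mem_nbrs hv).2 (h w hw)

/-- The sum of all degrees. -/
theorem sum_deg : ∑ v ∈ Finset.Icc 1 E.n, E.deg v = E.off (E.n + 1) := by
  have : ∀ k, k ≤ E.n → ∑ v ∈ Finset.Icc 1 k, E.deg v = E.off (k + 1) := by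
    intro k
    induction k with
    | zero => simp [E.off_one]
    | succ k ih =>
      intro hk
      rw [Finset.sum_Icc_succ_top (by omega), ih (by omega), E.off_succ (v := k + 1) (by omega) hk]
  exact this _ le_rfl

theorem sum_nbrs_deg_le {v : ℕ} (hv : E.V v) : ∑ w ∈ E.nbrs v, E.deg w ≤ E.off (E.n + 1) := by
  rw [← sum_deg]
  refine Finset.sum_le_sum_of_subset fun w hw => ?_
  have := A.right ((mem_nbrs hv).1 hw)
  exact Finset.mem_Icc.2 this

theorem deg_le {v : ℕ} (hv : E.V v) : E.deg v ≤ E.off (E.n + 1) := by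
  rw [← sum_deg]
  exact Finset.single_le_sum (f := E.deg) (fun _ _ => Nat.zero_le _) (Finset.mem_Icc.2 hv)

end Net

open Net

/-- The arrays of the sorted adjacency lists are in the memory. -/
structure Base (E : Net) (s : State) : Prop where
  n : s.reg .n = E.n
  off : s.arr .off = E.off
  adj : s.arr .adj = E.adj
  deg : s.arr .deg = E.deg

/-- The command does not change the sorted adjacency lists. -/
def Cmd.Keeps (c : Cmd) : Prop := Reg.n ∉ c.regs ∧ Arr.off ∉ c.arrs ∧ Arr.adj ∉ c.arrs ∧
  Arr.deg ∉ c.arrs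

instance (c : Cmd) : Decidable c.Keeps := by unfold Cmd.Keeps; infer_instance

variable {E : Net} {N : State → ℕ → Prop} {R : ℕ → Prop} {s s' : State} {t : ℕ} {P : ℕ → ℕ}

theorem Base.agree {c : Cmd} (h : Base E s) (h' : Agree c s s') (hc : c.Keeps) : Base E s' :=
  ⟨(h'.reg _ hc.1).trans h.n, (h'.arr _ hc.2.1).trans h.off, (h'.arr _ hc.2.2.1).trans h.adj,
    (h'.arr _ hc.2.2.2).trans h.deg⟩

theorem Base.setReg (h : Base E s) (r : Reg) (y : ℕ) (hr : r ≠ .n) : Base E (s.setReg r y) :=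
  ⟨by simp [hr.symm, h.n], h.off, h.adj, h.deg⟩

/-- The loop rule for adjacency lists. -/
theorem runs_forNeighbors {pos r a : Reg} {c : Cmd} (I : ℕ → State → ℕ → Prop) (v : ℕ)
    (hs : Base E s) (hv : s.reg a = v) (hV : E.V v)
    (hr : pos ∉ r :: c.regs) (hc : (forNeighbors pos r a c).Keeps)
    (hra : a ∉ (forNeighbors pos r a c).regs)
    (h0 : I (E.off v) (s.setReg pos (E.off v)) (t + 3))
    (hstep : ∀ i s₁ t₁, Agree (forNeighbors pos r a c) s s₁ → Base E s₁ → s₁.reg a = v →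
      E.off v ≤ i → i < E.off (v + 1) → E.A v (E.adj i) → s₁.reg pos = i → I i s₁ t₁ →
      Runs c (fun s' t' => I (i + 1) (s'.setReg pos (i + 1)) (t' + 3)) R
        (s₁.setReg r (E.adj i)) (t₁ + 9))
    (hN : ∀ s₁ t₁, Agree (forNeighbors pos r a c) s s₁ → Base E s₁ → s₁.reg a = v →
      I (E.off (v + 1)) s₁ t₁ → N s₁ (t₁ + 6)) :
    Runs (forNeighbors pos r a c) N R s t := by
  have hcost : (Exp.cell Arr.off (Exp.succ (Exp.reg a))).cost + 3 = 6 := by simp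
  refine runs_forRange I (E.off v) (E.off (v + 1)) hr (by simp [hs.off, hv]) (off_le_succ hV) h0
    ?_ ?_ ?_
  · intro i s₁ t₁ hag _
    simp [(hs.agree hag hc).off, hag.reg a hra, hv]
  · intro i s₁ t₁ hag h1 h2 h3 h4
    have hB := hs.agree hag hc
    have := hstep i s₁ t₁ hag hB ((hag.reg a hra).trans hv) h1 h2 (A_adj hV h1 h2) h3 h4
    rw [hcost, runs_seq, runs_set]
    simpa [hB.adj, h3] using this
  · intro s₁ t₁ hag h
    rw [hcost]
    exact hN s₁ t₁ hag (hs.agree hag hc) ((hag.reg a hra).trans hv) h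

/-! ## Adjacency tests -/

/-- One list suffices to decide adjacency, by symmetry; which one is decided by the list that ends
first. Therefore the time depends only on the smaller degree. The invariant says that the first `k`
cells of both lists contain no hit. -/
theorem runs_testAdj (a b : Reg) (hs : Base E s) (ha : E.V (s.reg a)) (hb : E.V (s.reg b))
    (ha' : a ∉ (testAdj a b).regs) (hb' : b ∉ (testAdj a b).regs)
    (h : ∀ s' t', Agree (testAdj a b) s s' → (s'.reg .found = 0 ↔ ¬ E.A (s.reg a) (s.reg b)) →
      t' ≤ t + 40 + 60 * min (E.deg (s.reg a)) (E.deg (s.reg b)) → N s' t') :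
    Runs (testAdj a b) N R s t := by
  have hk : (testAdj a b).Keeps := by
    simp [Cmd.Keeps, testAdj, Cmd.regs, Cmd.arrs, Cmd.when]
  refine Runs.spec (N := fun s' t' => (s'.reg .found = 0 ↔ ¬ E.A (s.reg a) (s.reg b)) ∧
      t' ≤ t + 40 + 60 * min (E.deg (s.reg a)) (E.deg (s.reg b))) ?_
    fun s' t' h1 h2 => h s' t' h1 h2.1 h2.2
  simp only [testAdj, Cmd.when, Cmd.regs, List.mem_append, List.mem_cons, List.not_mem_nil,
    or_false, not_or] at ha' hb'
  set x := s.reg a with hx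
  set y := s.reg b with hy
  have hox := E.off_succ ha.1 ha.2
  have hoy := E.off_succ hb.1 hb.2
  simp only [testAdj, runs_seq, runs_set]
  refine runs_loop (fun k s' t' => Base E s' ∧ s'.reg a = x ∧ s'.reg b = y ∧
    s'.reg .ia = E.off x + k ∧ s'.reg .ib = E.off y + k ∧
    (s'.reg .found = 0 ∧ (∀ i < k, E.adj (E.off x + i) ≠ y ∧ E.adj (E.off y + i) ≠ x) ∨
      s'.reg .found = 1 ∧ E.A x y) ∧ k ≤ E.deg x ∧ k ≤ E.deg y ∧ t' ≤ t + 8 + 50 * k)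
    (min (E.deg x) (E.deg y)) ?_ ?_ ?_
  · refine ⟨?_, ?_⟩
    · exact ((hs.setReg _ _ (by simp)).setReg _ _ (by simp)).setReg _ _ (by simp)
    · simp [ha', hb', hs.off, ← hx, ← hy]
  · rintro k s' t' ⟨hB, hsa, hsb, hia, hib, hf, hkx, hky, ht⟩ hcond
    simp only [Test.eval, Exp.eval, hB.off, hsa, hsb, hia, hib] at hcond
    obtain ⟨hf0, hlx, hly⟩ := hcond
    have hf : ∀ i < k, E.adj (E.off x + i) ≠ y ∧ E.adj (E.off y + i) ≠ x := by
      rcases hf with hf | hf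
      · exact hf.2
      · omega
    refine ⟨by omega, ?_⟩
    simp only [runs_seq, runs_when, runs_set]
    have hAx : E.A x (E.adj (E.off x + k)) := A_adj ha (by omega) hlx
    have hAy : E.A y (E.adj (E.off y + k)) := A_adj hb (by omega) hly
    constructor
    · intro hcond
      simp only [Test.eval, Exp.eval, hB.adj, hsa, hsb, hia, hib] at hcond
      refine ⟨?_, ?_⟩
      · exact ((hB.setReg _ _ (by simp)).setReg _ _ (by simp)).setReg _ _ (by simp)
      · have hA : E.A x y := by
          rcases hcond with h | h
          · rwa [h] at hAx
          · rw [h] at hAy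
            exact E.symm hAy
        simp [ha', hb', hsa, hsb, hia, hib, hA]
        omega
    · intro hcond
      simp only [Test.eval, Exp.eval, hB.adj, hsa, hsb, hia, hib, not_or] at hcond
      refine ⟨?_, ?_⟩
      · exact (hB.setReg _ _ (by simp)).setReg _ _ (by simp)
      · refine ⟨by simp [ha', hsa], by simp [hb', hsb], by simp [hia, add_assoc],
          by simp [hib, add_assoc], Or.inl ⟨by simp [hf0], fun i hi => ?_⟩, by omega, by omega, ?_⟩
        · rcases Nat.lt_succ_iff_lt_or_eq.1 hi with h | h
          · exact hf i h
          · rw [h]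
            exact hcond
        · simp
          omega
  · rintro k s' t' ⟨hB, hsa, hsb, hia, hib, hf, hkx, hky, ht⟩ hcond
    simp only [Test.eval, Exp.eval, hB.off, hsa, hsb, hia, hib] at hcond
    constructor
    · rcases hf with hf | hf
      · simp only [hf.1, true_iff]
        intro hA
        obtain ⟨i, h1, h2, h3⟩ := A.exists_adj hA
        obtain ⟨j, h4, h5, h6⟩ := A.exists_adj (E.symm hA)
        -- Without a hit, the loop stops because one of the lists is exhausted; the entry that an
        -- edge `xy` has in that list would have been seen.
        by_cases hk : k = E.deg x
        · refine (hf.2 (i - E.off x) (by omega)).1 ?_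
          rwa [Nat.add_sub_cancel' h1]
        · by_cases hk' : k = E.deg y
          · refine (hf.2 (j - E.off y) (by omega)).2 ?_
            rwa [Nat.add_sub_cancel' h4]
          · exact hcond ⟨hf.1, by omega, by omega⟩
      · simp [hf]
    · simp only [Test.cost, Exp.cost]
      omega

/-! ## Outsiders -/

/-- The vertex `o` is the only neighbour of `u` outside the class of `u`, or there is no such
neighbour and `o` is null. -/
def IsOut (E : Net) (P : ℕ → ℕ) (u o : ℕ) : Prop :=
  (∀ w, E.A u w → (P w ≠ P u ↔ w = o)) ∧ (o ≠ 0 → E.A u o)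

theorem Good.adj_of_inside (hP : Good E P) {u w w' : ℕ} (hw : E.A u w) (hw' : E.A u w')
    (h : P w = P u) (h' : P w' = P u) (hne : w ≠ w') : E.A w w' :=
  hP.clique (A.right hw).1 (A.right hw).2 (A.right hw').1 (A.right hw').2 hne (h.trans h'.symm)

/-- Since `o` is the only outside neighbour of `u`, the vertex `w` lies in the class of `u`. An edge
`ow` would then be a second edge between the classes of `u` and `o`, besides `uo`. -/
theorem Good.not_adj_of_outside (hP : Good E P) {u o w : ℕ} (ho : E.A u o) (hw : E.A u w)
    (h : P o ≠ P u) : ¬ E.A o w := by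
  intro hA
  have hwo : w ≠ o := (A.ne hA).symm
  have h' : P w = P u := by
    by_contra h'
    exact hwo (hP.outside hw ho h' h)
  exact A.ne hw (hP.edge ho (E.symm hA) h'.symm rfl (Ne.symm h))

theorem Good.isOut (hP : Good E P) {u o : ℕ} (ho : E.A u o) (h : P o ≠ P u) : IsOut E P u o :=
  ⟨fun _ hw => ⟨fun h' => hP.outside hw ho h' h, fun h' => h' ▸ h⟩, fun _ => ho⟩

/-- The search for the outsider of a vertex for which none has been recorded. -/
def searchOutsider : Cmd :=
  .set .w1 (.cell .adj (.cell .off Reg.u)) ;;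
  .set .w2 (.cell .adj (.succ (.cell .off Reg.u))) ;;
  .set .w3 (.cell .adj (.succ (.succ (.cell .off Reg.u)))) ;;
  testAdj .w1 .w2 ;;
  .ite (.eq Reg.found (.lit 0))
    (testAdj .w1 .w3 ;;
      .ite (.eq Reg.found (.lit 0))
        (.store .outsider Reg.u Reg.w1)
        (.store .outsider Reg.u Reg.w2))
    (forNeighbors .i .w .u
      (Cmd.when (.not (.eq Reg.w Reg.w1))
        (testAdj .w .w1 ;;
        Cmd.when (.eq Reg.found (.lit 0)) (.store .outsider Reg.u Reg.w))))

/-- The sum of the degrees of the neighbours of `u` other than `o`. -/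
def Net.degSum (E : Net) (u o : ℕ) : ℕ := ∑ w ∈ (E.nbrs u).erase o, E.deg w

theorem Net.degSum_le {u : ℕ} (hu : E.V u) (o : ℕ) : E.degSum u o ≤ E.off (E.n + 1) :=
  (Finset.sum_le_sum_of_subset (Finset.erase_subset _ _)).trans (sum_nbrs_deg_le hu)

theorem Net.deg_le_degSum {u w o : ℕ} (h : E.A u w) (hne : w ≠ o) : E.deg w ≤ E.degSum u o :=
  Finset.single_le_sum (f := E.deg) (fun _ _ => Nat.zero_le _)
    (Finset.mem_erase.2 ⟨hne, (mem_nbrs (A.left h)).2 h⟩)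

/-- The test of `o` against `w₁` costs at most the degree of `w₁`, and every other test at most the
degree of the vertex tested. So each of the two parts is at most the sum of degrees without `o`,
however large the degree of `o` is. -/
theorem Net.sum_min_le {u w₁ o : ℕ} (h : E.A u w₁) (hne : w₁ ≠ o) :
    ∑ w ∈ E.nbrs u, (if w = w₁ then 0 else min (E.deg w) (E.deg w₁)) ≤ 2 * E.degSum u o := by
  have h1 : ∀ w, (if w = w₁ then 0 else min (E.deg w) (E.deg w₁)) ≤ E.deg w := by
    intro w
    split_ifs
    · omega
    · exact min_le_left _ _
  have h2 : (if o = w₁ then 0 else min (E.deg o) (E.deg w₁)) ≤ E.degSum u o := by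
    rw [if_neg hne.symm]
    exact (min_le_right _ _).trans (deg_le_degSum h hne)
  by_cases ho : o ∈ E.nbrs u
  · rw [← Finset.add_sum_erase _ _ ho, two_mul]
    exact add_le_add h2 (Finset.sum_le_sum fun w _ => h1 w)
  · rw [← Finset.erase_eq_of_notMem ho]
    have := Finset.sum_le_sum fun w (_ : w ∈ (E.nbrs u).erase o) => h1 w
    unfold degSum
    omega

/-- Two nonadjacent neighbours of `u` cannot both lie in its class, and an outsider is adjacent to
no other neighbour of `u`. If `w₁` and `w₂` are nonadjacent, one of them is the outsider, and `w₃`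
tells which. If they are adjacent, `w₁` is in the class of `u`, and the outsider is the neighbour of
`u` not adjacent to `w₁`, if there is one. The time is measured against whatever candidate is
stored, so that the bound also holds without a good partition. -/
theorem runs_searchOutsider (hs : Base E s) (hu : E.V (s.reg .u)) (hd : 2 < E.deg (s.reg .u))
    (h0 : s.arr .outsider (s.reg .u) = 0) :
    Runs searchOutsider (fun s' t' => (∀ y, y ≠ s.reg .u → s'.arr .outsider y = s.arr .outsider y) ∧
      (∀ P, Good E P → IsOut E P (s.reg .u) (s'.arr .outsider (s.reg .u))) ∧
      t' ≤ t + 300 + 100 * E.deg (s.reg .u) +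
        180 * E.degSum (s.reg .u) (s'.arr .outsider (s.reg .u))) R s t := by
  set u := s.reg .u with hu'
  have hoff := E.off_succ hu.1 hu.2
  have key : ∀ i, E.off u ≤ i → i < E.off (u + 1) → E.A u (E.adj i) := fun i => A_adj hu
  obtain ⟨w₁, hw₁⟩ : ∃ w₁, w₁ = E.adj (E.off u) := ⟨_, rfl⟩
  obtain ⟨w₂, hw₂⟩ : ∃ w₂, w₂ = E.adj (E.off u + 1) := ⟨_, rfl⟩
  obtain ⟨w₃, hw₃⟩ : ∃ w₃, w₃ = E.adj (E.off u + 1 + 1) := ⟨_, rfl⟩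
  have a1 : E.A u w₁ := hw₁ ▸ key _ (by omega) (by omega)
  have a2 : E.A u w₂ := hw₂ ▸ key _ (by omega) (by omega)
  have a3 : E.A u w₃ := hw₃ ▸ key _ (by omega) (by omega)
  have l12 : w₁ < w₂ := by
    rw [hw₁, hw₂]
    exact E.mono hu.1 hu.2 le_rfl (by omega) (by omega)
  have l23 : w₂ < w₃ := by
    rw [hw₂, hw₃]
    exact E.mono hu.1 hu.2 (by omega) (by omega) (by omega)
  simp only [searchOutsider, runs_seq, runs_set]
  set s₁ := ((s.setReg .w1 (Exp.eval s (Exp.cell Arr.adj (Exp.cell Arr.off (Exp.reg Reg.u))))).setReg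
    .w2 _).setReg .w3 _ with hs₁
  have hB₁ : Base E s₁ := ((hs.setReg _ _ (by simp)).setReg _ _ (by simp)).setReg _ _ (by simp)
  have e1 : s₁.reg .w1 = w₁ := by simp [hs₁, hs.adj, hs.off, ← hu', hw₁]
  have e2 : s₁.reg .w2 = w₂ := by simp [hs₁, hs.adj, hs.off, ← hu', hw₂]
  have e3 : s₁.reg .w3 = w₃ := by simp [hs₁, hs.adj, hs.off, ← hu', hw₃]
  have eu : s₁.reg .u = u := by simp [hs₁, ← hu']
  have eo : s₁.arr .outsider = s.arr .outsider := by simp [hs₁]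
  clear_value s₁
  refine runs_testAdj .w1 .w2 hB₁ (e1 ▸ A.right a1) (e2 ▸ A.right a2) (by decide) (by decide)
    fun s₂ t₂ hag hf ht₂ => ?_
  have hB₂ := hB₁.agree hag (by decide)
  rw [e1, e2] at hf ht₂
  replace e1 : s₂.reg .w1 = w₁ := (hag.reg _ (by decide)).trans e1
  replace e2 : s₂.reg .w2 = w₂ := (hag.reg _ (by decide)).trans e2
  replace e3 : s₂.reg .w3 = w₃ := (hag.reg _ (by decide)).trans e3
  replace eu : s₂.reg .u = u := (hag.reg _ (by decide)).trans eu
  replace eo : s₂.arr .outsider = s.arr .outsider := (hag.arr _ (by decide)).trans eo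
  clear hag hB₁ hs₁ s₁
  simp only [Exp.cost] at ht₂
  refine runs_ite.2 ⟨fun hcond => ?_, fun hcond => ?_⟩
  · have hn12 : ¬ E.A w₁ w₂ := hf.1 hcond
    rw [runs_seq]
    refine runs_testAdj .w1 .w3 hB₂ (e1 ▸ A.right a1) (e3 ▸ A.right a3) (by decide) (by decide)
      fun s₃ t₃ hag hf' ht₃ => ?_
    have hB₃ := hB₂.agree hag (by decide)
    rw [e1, e3] at hf' ht₃
    replace e1 : s₃.reg .w1 = w₁ := (hag.reg _ (by decide)).trans e1
    replace e2 : s₃.reg .w2 = w₂ := (hag.reg _ (by decide)).trans e2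
    replace eu : s₃.reg .u = u := (hag.reg _ (by decide)).trans eu
    replace eo : s₃.arr .outsider = s.arr .outsider := (hag.arr _ (by decide)).trans eo
    have d3 := deg_le_degSum (o := w₁) a3 (by omega)
    have d2 := deg_le_degSum (o := w₁) a2 (by omega)
    have d3' := deg_le_degSum (o := w₂) a3 (by omega)
    have d1' := deg_le_degSum (o := w₂) a1 (by omega)
    refine runs_ite.2 ⟨fun hcond' => ?_, fun hcond' => ?_⟩
    · have hn13 : ¬ E.A w₁ w₃ := hf'.1 hcond'
      rw [runs_store]
      refine ⟨fun y hy => ?_, fun P hP => ?_, ?_⟩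
      · simp [eu, eo, hy]
      · simp only [Exp.eval, eu, e1, State.setCell_arr, if_true, Function.update_self]
        refine hP.isOut a1 fun h => ?_
        by_cases h2 : P w₂ = P u
        -- If `w₁` were in the class of `u`, then `w₂` and `w₃`, not being adjacent to `w₁`, would
        -- be two neighbours outside.
        · exact hn12 (hP.adj_of_inside a1 a2 h h2 (by omega))
        · have h3 : P w₃ = P u := by
            by_contra h3
            have := hP.outside a2 a3 h2 h3
            omega
          exact hn13 (hP.adj_of_inside a1 a3 h h3 (by omega))
      · simp only [Exp.eval, eu, e1, State.setCell_arr, if_true, Function.update_self]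
        simp only [Exp.cost, Test.cost] at ht₃ ⊢
        omega
    · have hn13 : E.A w₁ w₃ := by
        by_contra h
        exact hcond' (hf'.2 h)
      rw [runs_store]
      refine ⟨fun y hy => ?_, fun P hP => ?_, ?_⟩
      · simp [eu, eo, hy]
      · simp only [Exp.eval, eu, e2, State.setCell_arr, if_true, Function.update_self]
        refine hP.isOut a2 fun h => ?_
        have h1 : P w₁ = P u := by
          by_contra h1
          exact hP.not_adj_of_outside a1 a3 h1 hn13
        exact hn12 (hP.adj_of_inside a1 a2 h1 h (by omega))
      · simp only [Exp.eval, eu, e2, State.setCell_arr, if_true, Function.update_self]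
        simp only [Exp.cost, Test.cost] at ht₃ ⊢
        omega
  · have hn12 : E.A w₁ w₂ := by
      by_contra h
      exact hcond (hf.2 h)
    obtain ⟨g, hg⟩ : ∃ g : ℕ → ℕ, g = fun w => if w = w₁ then 0 else min (E.deg w) (E.deg w₁) :=
      ⟨_, rfl⟩
    -- Any non-neighbour of `w₁` seen so far makes the stored value nonzero, and a stored value is a
    -- non-neighbour of `w₁`. Several candidates may overwrite each other, but then no good
    -- partition exists. The sum over `g` collects the prices of the adjacency tests.
    refine runs_forNeighbors (fun p s' t' => s'.reg .w1 = w₁ ∧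
      (∀ y, y ≠ u → s'.arr .outsider y = s.arr .outsider y) ∧
      (∀ i, E.off u ≤ i → i < p → E.adj i ≠ w₁ → ¬ E.A (E.adj i) w₁ → s'.arr .outsider u ≠ 0) ∧
      (s'.arr .outsider u ≠ 0 → E.A u (s'.arr .outsider u) ∧ s'.arr .outsider u ≠ w₁ ∧
        ¬ E.A (s'.arr .outsider u) w₁) ∧
      t' ≤ t₂ + 20 + 80 * (p - E.off u) + 60 * ∑ i ∈ Finset.Ico (E.off u) p, g (E.adj i))
      u hB₂ eu hu (by decide) (by decide) (by decide) ?_ ?_ ?_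
    · refine ⟨by simp [e1], by simp [eo], fun i h1 h2 => by omega, ?_, ?_⟩
      · intro h
        simp [eo, h0] at h
      · simp only [Test.cost, Exp.cost]
        omega
    · rintro i s₁ t₁ hag hB hru h1 h2 hA hri ⟨ew1, hy, hall, hso, ht⟩
      have hB' := hB.setReg .w (E.adj i) (by simp)
      rw [Finset.sum_Ico_succ_top h1]
      refine runs_when.2 ⟨fun hcond => ?_, fun hcond => ?_⟩
      · have hne : E.adj i ≠ w₁ := by simpa [ew1] using hcond
        rw [runs_seq]
        refine runs_testAdj .w .w1 hB' (by simpa using A.right hA) (by simpa [ew1] using A.right a1)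
          (by decide) (by decide) fun s₃ t₃ hag3 hf3 ht₃ => ?_
        have f1 : s₃.reg .w1 = w₁ := (hag3.reg _ (by decide)).trans (by simp [ew1])
        have f2 : s₃.reg .u = u := (hag3.reg _ (by decide)).trans (by simp [hru])
        have f3 : s₃.reg .w = E.adj i := (hag3.reg _ (by decide)).trans (by simp)
        have f4 : s₃.arr .outsider = s₁.arr .outsider := (hag3.arr _ (by decide)).trans (by simp)
        have hgi : g (E.adj i) = min (E.deg (E.adj i)) (E.deg w₁) := by simp [hg, hne]
        simp only [State.setReg_reg, if_true, ew1, reduceCtorEq, if_false] at hf3 ht₃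
        have ht' : t₃ + 10 ≤ t₂ + 20 + 80 * (i + 1 - E.off u) +
            60 * (∑ i ∈ Finset.Ico (E.off u) i, g (E.adj i) + g (E.adj i)) := by
          simp only [Test.cost, Exp.cost] at ht₃
          omega
        refine runs_when.2 ⟨fun hcond => ?_, fun hcond => ?_⟩
        · have hnA : ¬ E.A (E.adj i) w₁ := hf3.1 hcond
          rw [runs_store]
          refine ⟨by simp [f1], fun y hy' => ?_, fun _ _ _ _ _ => ?_, fun _ => ?_, ?_⟩
          · simp [f2, f4, hy', hy y hy']
          · simpa [f2, f3] using A.pos hA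
          · simpa [f2, f3] using ⟨hA, hne, hnA⟩
          · simp only [Test.cost, Exp.cost]
            omega
        · have hA' : E.A (E.adj i) w₁ := by
            by_contra h
            exact hcond (hf3.2 h)
          refine ⟨by simp [f1], fun y hy' => ?_, fun j hj hj' hj2 hj3 => ?_, ?_, ?_⟩
          · simp [f4, hy y hy']
          · have : j ≠ i := by
              rintro rfl
              exact hj3 hA'
            simpa [f4] using hall j hj (by omega) hj2 hj3
          · simpa [f4] using hso
          · simp only [Test.cost, Exp.cost]
            omega
      · have heq : E.adj i = w₁ := by simpa [ew1] using hcond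
        refine ⟨by simp [ew1], by simpa using hy, fun j hj hj' hj2 hj3 => ?_, by simpa using hso, ?_⟩
        · have : j ≠ i := by
            rintro rfl
            exact hj2 heq
          simpa using hall j hj (by omega) hj2 hj3
        · simp only [Test.cost, Exp.cost]
          omega
    · rintro s₁ t₁ hag hB hru ⟨ew1, hy, hall, hso, ht⟩
      refine ⟨hy, fun P hP => ?_, ?_⟩
      · have h1 : P w₁ = P u := by
          by_contra h1
          exact hP.not_adj_of_outside a1 a2 h1 hn12
        by_cases ho : s₁.arr .outsider u = 0
        · refine ⟨fun w hw => ⟨fun h => ?_, fun h => absurd h (ho ▸ A.pos hw)⟩,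
            fun h => absurd ho h⟩
          obtain ⟨i, hi, hi', rfl⟩ := A.exists_adj hw
          refine absurd ho (hall i hi hi' (fun h' => h (h' ▸ h1)) ?_)
          exact hP.not_adj_of_outside hw a1 h
        · obtain ⟨b1, b2, b3⟩ := hso ho
          exact hP.isOut b1 fun h => b3 (hP.adj_of_inside b1 a1 h h1 b2)
      · have hne : w₁ ≠ s₁.arr .outsider u := by
          intro h
          by_cases ho : s₁.arr .outsider u = 0
          · exact A.pos a1 (h.trans ho)
          · exact (hso ho).2.1 h.symm
        have hsum := sum_min_le a1 hne
        have d1 := deg_le_degSum a1 hne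
        rw [sum_adj hu g] at ht
        simp only [hg] at ht
        omega

/-- A recorded outsider is taken over without a search, hence the hypothesis in the clause about
`IsOut` that it is correct for `P`. Writing `u` into the entry of `o` may destroy an older entry;
under a good partition this loses nothing, because `u` is then the only outside neighbour of `o`. -/
theorem runs_findOutsider (hs : Base E s) (hu : E.V (s.reg .u)) (hd : 2 < E.deg (s.reg .u))
    (h : ∀ s' t', Agree findOutsider s s' → Base E s' → s'.arr .outsider (s.reg .u) = s'.reg .o →
      (s'.reg .o ≠ 0 → s'.arr .outsider (s'.reg .o) = s.reg .u) →
      (∀ y, y ≠ s.reg .u → y ≠ s'.reg .o → s'.arr .outsider y = s.arr .outsider y) →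
      (∀ P, Good E P → (s.arr .outsider (s.reg .u) ≠ 0 →
        E.A (s.reg .u) (s.arr .outsider (s.reg .u)) ∧
        P (s.arr .outsider (s.reg .u)) ≠ P (s.reg .u)) → IsOut E P (s.reg .u) (s'.reg .o)) →
      t' ≤ t + 330 + 100 * E.deg (s.reg .u) + 180 * E.degSum (s.reg .u) (s'.reg .o) → N s' t') :
    Runs findOutsider N R s t := by
  set u := s.reg .u with hu'
  have main : Runs (Cmd.when (.eq (.cell .outsider Reg.u) (.lit 0)) searchOutsider)
      (fun s' t' => (∀ y, y ≠ u → s'.arr .outsider y = s.arr .outsider y) ∧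
      (∀ P, Good E P → (s.arr .outsider u ≠ 0 → E.A u (s.arr .outsider u) ∧
        P (s.arr .outsider u) ≠ P u) → IsOut E P u (s'.arr .outsider u)) ∧
      t' ≤ t + 310 + 100 * E.deg u + 180 * E.degSum u (s'.arr .outsider u)) R s t := by
    refine runs_when.2 ⟨fun h0 => ?_, fun h0 => ?_⟩
    · refine (runs_searchOutsider hs hu hd h0).mono fun s' t' h => ?_
      obtain ⟨h1, h2, h3⟩ := h
      rw [← hu'] at h1 h2 h3
      refine ⟨h1, fun P hP _ => h2 P hP, h3.trans ?_⟩
      simp only [Test.cost, Exp.cost]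
      omega
    · refine ⟨fun _ _ => rfl, fun P hP h => ?_, ?_⟩
      · exact hP.isOut (h h0).1 (h h0).2
      · simp only [Test.cost, Exp.cost]
        omega
  refine Runs.spec (N := fun s' t' => s'.arr .outsider u = s'.reg .o ∧
    (s'.reg .o ≠ 0 → s'.arr .outsider (s'.reg .o) = u) ∧
    (∀ y, y ≠ u → y ≠ s'.reg .o → s'.arr .outsider y = s.arr .outsider y) ∧
    (∀ P, Good E P → (s.arr .outsider u ≠ 0 → E.A u (s.arr .outsider u) ∧
        P (s.arr .outsider u) ≠ P u) → IsOut E P u (s'.reg .o)) ∧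
    t' ≤ t + 330 + 100 * E.deg u + 180 * E.degSum u (s'.reg .o)) ?_ fun s' t' h1 h2 =>
      h s' t' h1 (hs.agree h1 (by decide)) h2.1 h2.2.1 h2.2.2.1 h2.2.2.2.1 h2.2.2.2.2
  -- `searchOutsider` is literally the body of the first conditional.
  change Runs (.seq (Cmd.when _ searchOutsider) (.seq _ _)) _ R s t
  rw [runs_seq]
  refine main.spec fun s₁ t₁ hag ⟨h1, h2, h3⟩ => ?_
  have hu1 : s₁.reg .u = u := (hag.reg _ (by decide)).trans rfl
  rw [runs_seq, runs_set]
  refine runs_when.2 ⟨fun h0 => ?_, fun h0 => ?_⟩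
  · rw [runs_store]
    refine ⟨?_, fun _ => ?_, fun y hy hy' => ?_, fun P hP hh => ?_, ?_⟩
    · by_cases ho : s₁.arr .outsider u = u
      · simp [hu1, ho]
      · simp [hu1, Ne.symm ho]
    · simp [hu1]
    · simp only [Exp.eval, State.setReg_reg, if_true, State.setCell_reg, hu1] at hy'
      simp [hu1, hy', h1 y hy]
    · simpa [hu1] using h2 P hP hh
    · simp only [Test.cost, Exp.cost, Exp.eval, State.setReg_reg, if_true, State.setCell_reg, hu1]
      omega
  · simp only [Test.eval, Exp.eval, State.setReg_reg, if_true, hu1] at h0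
    refine ⟨by simp [hu1], fun h => absurd (by simpa [hu1] using h) h0, fun y hy _ => ?_,
      fun P hP hh => ?_, ?_⟩
    · simpa using h1 y hy
    · simpa [hu1] using h2 P hP hh
    · simp only [Test.cost, Exp.cost, Exp.eval, State.setReg_reg, if_true, hu1]
      omega

/-! ## Passing over a part of an adjacency list -/

/-- The effect of passing over the cells from `current[v]` on in the list of `v`, where `u` is the
vertex that is being processed. -/
structure Passed (E : Net) (u v : ℕ) (s s' : State) : Prop where
  le : s.arr .current v ≤ s'.arr .current v
  le_off : s'.arr .current v ≤ E.off (v + 1)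
  other : ∀ y, y ≠ v → s'.arr .current y = s.arr .current y
  eq_outsider : ∀ i, s.arr .current v ≤ i → i < s'.arr .current v → E.adj i ≠ u →
    E.adj i = s'.arr .outsider v
  source : s'.arr .outsider v = s.arr .outsider v ∨ (s.arr .outsider v = 0 ∧
    ∃ i, s.arr .current v ≤ i ∧ i < s'.arr .current v ∧ E.adj i ≠ u ∧
      E.adj i = s'.arr .outsider v)
  changed : ∀ y, y ≠ v → s'.arr .outsider y ≠ s.arr .outsider y →
    s'.arr .outsider y = v ∧ ∃ i, s.arr .current v ≤ i ∧ i < s'.arr .current v ∧ E.adj i ≠ u ∧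
      E.adj i = y

/-- Passing over the cells up to `i` shows that `v` has two outsiders. -/
def Conflict (E : Net) (u v : ℕ) (s : State) (i : ℕ) : Prop :=
  s.arr .current v ≤ i ∧ i < E.off (v + 1) ∧ E.adj i ≠ u ∧ ∃ o, o ≠ 0 ∧ o ≠ E.adj i ∧
    (o = s.arr .outsider v ∨ ∃ j, s.arr .current v ≤ j ∧ j < i ∧ E.adj j ≠ u ∧ E.adj j = o)

/-- The predicate `cont` is the meaning of the test `b` in terms of the vertex in the current cell.
The loop ends at the end of the list, at a vertex that violates `cont`, or at a conflict between two
outsiders of `v`; only the last case ends the program. The time is proportional to the advance of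
the pointer, which is what the later amortization needs. -/
theorem runs_passOver {r : Reg} {b : Test} (cont : ℕ → Prop) (v u : ℕ) (hs : Base E s)
    (hv : s.reg r = v) (hu : s.reg .u = u) (hV : E.V v) (hrx : r ≠ .x)
    (h1 : E.off v ≤ s.arr .current v) (h2 : s.arr .current v ≤ E.off (v + 1))
    (hb : ∀ s', Base E s' → Agree (passOver r b) s s' →
      (b.eval s' ↔ cont (E.adj (s'.arr .current v))))
    (hcost : b.cost ≤ 20)
    (hR : ∀ i t', Conflict E u v s i → (∀ j, s.arr .current v ≤ j → j ≤ i → cont (E.adj j)) →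
      t' ≤ t + 100 + 100 * E.deg v → R t')
    (hN : ∀ s' t', Agree (passOver r b) s s' → Base E s' → Passed E u v s s' →
      (∀ i, s.arr .current v ≤ i → i < s'.arr .current v → cont (E.adj i)) →
      (s'.arr .current v = E.off (v + 1) ∨ ¬ cont (E.adj (s'.arr .current v))) →
      t' ≤ t + 100 + 100 * (s'.arr .current v - s.arr .current v) → N s' t') :
    Runs (passOver r b) N R s t := by
  have hk : (passOver r b).Keeps := by
    simp [Cmd.Keeps, passOver, Cmd.regs, Cmd.arrs, Cmd.when]
  have hru : Reg.u ∉ (passOver r b).regs := by simp [passOver, Cmd.regs, Cmd.when]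
  have hrr : r ∉ (passOver r b).regs := by simp [passOver, Cmd.regs, Cmd.when, hrx]
  refine Runs.spec (N := fun s' t' => Passed E u v s s' ∧
    (∀ i, s.arr .current v ≤ i → i < s'.arr .current v → cont (E.adj i)) ∧
    (s'.arr .current v = E.off (v + 1) ∨ ¬ cont (E.adj (s'.arr .current v))) ∧
    t' ≤ t + 100 + 100 * (s'.arr .current v - s.arr .current v)) ?_ fun s' t' h h' =>
      hN s' t' h (hs.agree h hk) h'.1 h'.2.1 h'.2.2.1 h'.2.2.2
  have hdeg := E.off_succ hV.1 hV.2
  set p := s.arr .current v with hp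
  have hagree : ∀ {s₁ s₂ : State}, Agree (passOver r b) s s₁ →
      (∀ r', r' ≠ .x → s₂.reg r' = s₁.reg r') →
      (∀ a, a ≠ .outsider → a ≠ .current → s₂.arr a = s₁.arr a) → Agree (passOver r b) s s₂ := by
    intro s₁ s₂ h h1 h2
    refine h.trans ⟨fun r' hr' => h1 r' ?_, fun a ha => h2 a ?_ ?_⟩
    · rintro rfl
      simp [passOver, Cmd.regs, Cmd.when] at hr'
    · rintro rfl
      simp [passOver, Cmd.arrs, Cmd.when] at ha
    · rintro rfl
      simp [passOver, Cmd.arrs, Cmd.when] at ha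
  refine runs_loop (fun k s' t' => Agree (passOver r b) s s' ∧ Passed E u v s s' ∧
    s'.arr .current v = p + k ∧ (∀ i, p ≤ i → i < p + k → cont (E.adj i)) ∧ t' ≤ t + 100 * k)
    (E.off (v + 1) - p) ?_ ?_ ?_
  · exact ⟨Agree.refl _ _, ⟨le_rfl, h2, fun _ _ => rfl, fun i _ _ => by omega, Or.inl rfl,
      fun y _ h => absurd rfl h⟩, rfl, fun i _ _ => by omega, by omega⟩
  · rintro k s₁ t₁ ⟨hag, hps, hc, hcont, ht⟩ ⟨hcond1, hcond2⟩
    have hB := hs.agree hag hk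
    have er : s₁.reg r = v := (hag.reg _ hrr).trans hv
    have eu : s₁.reg .u = u := (hag.reg _ hru).trans hu
    rw [hb s₁ hB hag, hc] at hcond2
    have hlt : p + k < E.off (v + 1) := by simpa [er, hc, hB.off] using hcond1
    have hA : E.A v (E.adj (p + k)) := A_adj hV (by omega) hlt
    have hne : E.adj (p + k) ≠ v := (A.ne hA).symm
    have hcont' : ∀ i, p ≤ i → i < p + (k + 1) → cont (E.adj i) := by
      intro i hi hi'
      by_cases h : i = p + k
      · rwa [h]
      · exact hcont i hi (by omega)
    refine ⟨by omega, ?_⟩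
    rw [runs_seq, runs_set, runs_seq, runs_when]
    simp only [Exp.eval, er, hc, hB.adj]
    constructor
    · intro hxu
      have hxu : E.adj (p + k) ≠ u := by simpa [eu] using hxu
      refine runs_ite.2 ⟨fun ho => ?_, fun ho => ?_⟩
      · have ho : s₁.arr .outsider v = 0 ∨ s₁.arr .outsider v = E.adj (p + k) := by
          simpa [er, hrx] using ho
        rw [runs_seq, runs_store, runs_store, runs_store]
        simp only [Exp.eval, State.setReg_reg, if_true, er, hrx, if_false, State.setCell_reg,
          State.setCell_arr, State.setReg_arr, reduceCtorEq, hc]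
        refine ⟨?_, ?_, ?_, hcont', ?_⟩
        · refine hagree hag (fun r' hr' => by simp [hr']) fun a ha ha' => by simp [ha, ha']
        · refine ⟨?_, ?_, fun y hy => ?_, fun i hi hi' hiu => ?_, ?_, fun y hy hch => ?_⟩
          · simp; omega
          · simp; omega
          · simpa [hy] using hps.other y hy
          · simp only [State.setCell_arr, if_true, Function.update_self] at hi'
            simp only [State.setCell_arr, reduceCtorEq, if_false, if_true,
              Function.update_of_ne hne.symm, Function.update_self]
            by_cases h : i = p + k
            · rw [h]
            -- If the entry of `v` was null, no earlier cell held a vertex other than `u`: that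
            -- vertex would have been recorded, and null is no vertex.
            · have := hps.eq_outsider i hi (by omega) hiu
              rcases ho with ho | ho
              · rw [ho] at this
                exact absurd this (A.pos (A_adj hV (by omega) (by omega)))
              · rw [this, ho]
          · simp only [State.setCell_arr, reduceCtorEq, if_false, if_true,
              Function.update_of_ne hne.symm, Function.update_self]
            rcases hps.source with hsrc | ⟨hsrc, i, hi1, hi2, hi3, hi4⟩
            · rcases ho with ho | ho
              · exact Or.inr ⟨hsrc ▸ ho, p + k, by omega, by omega, hxu, rfl⟩
              · exact Or.inl (ho ▸ hsrc)
            · exact Or.inr ⟨hsrc, p + k, by omega, by omega, hxu, rfl⟩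
          · simp only [State.setCell_arr, reduceCtorEq, if_false, if_true,
              Function.update_self] at hch ⊢
            by_cases hyx : y = E.adj (p + k)
            · subst hyx
              exact ⟨by simp, p + k, by omega, by omega, hxu, rfl⟩
            · simp only [Function.update_of_ne hyx, Function.update_of_ne hy] at hch ⊢
              obtain ⟨h3, i, h4, h5, h6⟩ := hps.changed y hy hch
              exact ⟨h3, i, h4, by omega, h6⟩
        · simp [add_assoc]
        · simp only [Test.cost, Exp.cost]
          omega
      · have ho : ¬ (s₁.arr .outsider v = 0 ∨ s₁.arr .outsider v = E.adj (p + k)) := by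
          simpa [er, hrx] using ho
        rw [not_or] at ho
        rw [runs_ret]
        refine hR (p + k) _ ⟨by omega, hlt, hxu, s₁.arr .outsider v, ho.1, ho.2, ?_⟩
          (fun j hj hj' => hcont' j hj (by omega)) ?_
        · rcases hps.source with hsrc | ⟨hsrc, i, hi1, hi2, hi3, hi4⟩
          · exact Or.inl hsrc
          · exact Or.inr ⟨i, hi1, by omega, hi3, hi4⟩
        · simp only [Test.cost, Exp.cost]
          omega
    · intro hxu
      have hxu : E.adj (p + k) = u := by simpa [eu] using hxu
      rw [runs_store]
      simp only [Exp.eval, State.setReg_reg, if_true, er, hrx, if_false,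
        State.setCell_arr, State.setReg_arr, hc]
      refine ⟨?_, ?_, by simp [add_assoc], hcont', ?_⟩
      · refine hagree hag (fun r' hr' => by simp [hr']) fun a ha ha' => by simp [ha']
      · refine ⟨?_, ?_, fun y hy => ?_, fun i hi hi' hiu => ?_, ?_, fun y hy hch => ?_⟩
        · simp; omega
        · simp; omega
        · simpa [hy] using hps.other y hy
        · simp only [State.setCell_arr, if_true, Function.update_self] at hi'
          have : i ≠ p + k := by
            rintro rfl
            exact hiu hxu
          simpa using hps.eq_outsider i hi (by omega) hiu
        · rcases hps.source with hsrc | ⟨hsrc, i, hi1, hi2, hi3, hi4⟩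
          · exact Or.inl (by simpa using hsrc)
          · exact Or.inr ⟨hsrc, i, hi1, by simp; omega, hi3, by simpa using hi4⟩
        · obtain ⟨h3, i, h4, h5, h6⟩ := hps.changed y hy (by simpa using hch)
          exact ⟨by simpa using h3, i, h4, by simp; omega, h6⟩
      · simp only [Test.cost, Exp.cost]
        omega
  · rintro k s₁ t₁ ⟨hag, hps, hc, hcont, ht⟩ hcond
    have hB := hs.agree hag hk
    have er : s₁.reg r = v := (hag.reg _ hrr).trans hv
    refine ⟨hps, ?_, ?_, ?_⟩
    · rwa [hc]
    · have hcond : ¬ ((p + k < E.off (v + 1)) ∧ b.eval s₁) := by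
        simpa [er, hc, hB.off] using hcond
      rw [hb s₁ hB hag, hc] at hcond
      rw [hc]
      have := hps.le_off
      by_cases h : p + k < E.off (v + 1)
      · exact Or.inr fun h' => hcond ⟨h, h'⟩
      · exact Or.inl (by omega)
    · simp only [Test.cost, Exp.cost]
      omega

/-- Recorded outsiders are correct. -/
def OutsidersOK (E : Net) (P : ℕ → ℕ) (s : State) : Prop :=
  ∀ x, E.V x → s.arr .outsider x ≠ 0 →
    E.A x (s.arr .outsider x) ∧ P (s.arr .outsider x) ≠ P x

theorem Passed.outsidersOK {u v : ℕ} (h : Passed E u v s s') (hV : E.V v)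
    (h1 : E.off v ≤ s.arr .current v) (hs : OutsidersOK E P s)
    (hout : ∀ i, s.arr .current v ≤ i → i < s'.arr .current v → E.adj i ≠ u → P (E.adj i) ≠ P v) :
    OutsidersOK E P s' := by
  intro x hx hne
  have hA : ∀ i, s.arr .current v ≤ i → i < s'.arr .current v → E.A v (E.adj i) := fun i hi hi' =>
    A_adj hV (by omega) (by have := h.le_off; omega)
  by_cases hxv : x = v
  · subst hxv
    rcases h.source with hsrc | ⟨hsrc, i, hi1, hi2, hi3, hi4⟩
    · rw [hsrc] at hne ⊢
      exact hs x hx hne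
    · rw [← hi4]
      exact ⟨hA i hi1 hi2, hout i hi1 hi2 hi3⟩
  · by_cases hch : s'.arr .outsider x = s.arr .outsider x
    · rw [hch] at hne ⊢
      exact hs x hx hne
    · obtain ⟨h3, i, hi1, hi2, hi3, hi4⟩ := h.changed x hxv hch
      rw [h3, ← hi4]
      exact ⟨E.symm (hA i hi1 hi2), (hout i hi1 hi2 hi3).symm⟩

/-- The two outsiders of a conflict would be two distinct neighbours of `v` outside its class. -/
theorem Good.no_conflict {u v i : ℕ} (hP : Good E P) (hs : OutsidersOK E P s) (hV : E.V v)
    (h1 : E.off v ≤ s.arr .current v)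
    (hout : ∀ j, s.arr .current v ≤ j → j ≤ i → E.adj j ≠ u → P (E.adj j) ≠ P v) :
    ¬ Conflict E u v s i := by
  rintro ⟨hi, hi', hiu, o, ho, hne, hor⟩
  have hAi := A_adj hV (h1.trans hi) hi'
  refine hne ?_
  rcases hor with rfl | ⟨j, hj, hj', hju, rfl⟩
  · exact hP.outside (hs v hV ho).1 hAi (hs v hV ho).2 (hout i hi le_rfl hiu)
  · exact hP.outside (A_adj hV (h1.trans hj) (by omega)) hAi (hout j hj (by omega) hju)
      (hout i hi le_rfl hiu)

/-! ## The clique test -/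

/-- The neighbours of `u` other than `o`. -/
def InK (E : Net) (u o z : ℕ) : Prop := E.A u z ∧ z ≠ o

theorem mem_erase_nbrs {u o z : ℕ} (hu : E.V u) : z ∈ (E.nbrs u).erase o ↔ InK E u o z := by
  rw [Finset.mem_erase, mem_nbrs hu, InK, and_comm]

theorem IsOut.class_eq {u o z : ℕ} (h : IsOut E P u o) (hz : InK E u o z) : P z = P u := by
  by_contra h'
  exact hz.2 ((h.1 z hz.1).1 h')

theorem IsOut.adj (hP : Good E P) {u o z w : ℕ} (h : IsOut E P u o) (hz : InK E u o z)
    (hw : InK E u o w) (hne : z ≠ w) : E.A z w :=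
  hP.adj_of_inside hz.1 hw.1 (h.class_eq hz) (h.class_eq hw) hne

theorem IsOut.inK_of_class_eq (hP : Good E P) {u o x : ℕ} (h : IsOut E P u o) (hu : E.V u)
    (hx : E.V x) (hne : x ≠ u) (hPx : P x = P u) : InK E u o x := by
  have hA := hP.clique hu.1 hu.2 hx.1 hx.2 hne.symm hPx.symm
  exact ⟨hA, fun h' => (h.1 x hA).2 h' hPx⟩

/-- What is known during the clique test, where `D z w` says that the list of `z` has been searched
for `w`, and `U` says that the vertices to be tested were unmarked. -/
structure Chk (E : Net) (u o : ℕ) (U : Prop) (D : ℕ → ℕ → Prop) (s : State) : Prop where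
  le : ∀ z, E.V z → E.off z ≤ s.arr .current z
  le_succ : ∀ z, E.V z → s.arr .current z ≤ E.off (z + 1)
  before : U → ∀ z w, InK E u o z → InK E u o w → w ≠ z → D z w →
    ∃ i, E.off z ≤ i ∧ i < s.arr .current z ∧ E.adj i = w
  only : U → ∀ z i, InK E u o z → E.off z ≤ i → i < s.arr .current z →
    E.adj i = u ∨ InK E u o (E.adj i) ∧ D z (E.adj i) ∨ E.adj i = s.arr .outsider z
  outs : ∀ P, Good E P → OutsidersOK E P s

/-- Only pairs of distinct tested vertices matter: a list never contains its own vertex, so the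
values of `D` on the diagonal are never used. -/
theorem Chk.congr {u o : ℕ} {U : Prop} {D D' : ℕ → ℕ → Prop} (h : Chk E u o U D s)
    (hD : ∀ z w, InK E u o z → InK E u o w → w ≠ z → (D z w ↔ D' z w)) : Chk E u o U D' s := by
  refine ⟨h.le, h.le_succ, fun hU z w hz hw hne hd => h.before hU z w hz hw hne
    ((hD z w hz hw hne).2 hd), fun hU z i hz hi hi' => ?_, h.outs⟩
  rcases h.only hU z i hz hi hi' with h1 | ⟨h1, h2⟩ | h1
  · exact Or.inl h1
  · refine Or.inr (Or.inl ⟨h1, (hD z _ hz h1 ?_).1 h2⟩)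
    have hV := A.right hz.1
    exact (A.ne (A_adj hV hi (lt_of_lt_of_le hi' (h.le_succ z hV)))).symm
  · exact Or.inr (Or.inr h1)

theorem Chk.of_eq {u o : ℕ} {U : Prop} {D : ℕ → ℕ → Prop} (h : Chk E u o U D s)
    (h1 : s'.arr .current = s.arr .current) (h2 : s'.arr .outsider = s.arr .outsider) :
    Chk E u o U D s' := by
  refine ⟨?_, ?_, ?_, ?_, ?_⟩
  · rw [h1]; exact h.le
  · rw [h1]; exact h.le_succ
  · rw [h1]; exact h.before
  · rw [h1, h2]; exact h.only
  · intro P hP x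
    rw [h2]
    exact h.outs P hP x

/-- Search the list of `z` for `w`. -/
def checkPair : Cmd :=
  passOver .z (.not (.eq (.cell .adj (.cell .current Reg.z)) Reg.w)) ;;
  Cmd.when (.eq (.cell .current Reg.z) (.cell .off (.succ Reg.z))) .ret ;;
  .store .current Reg.z (.succ (.cell .current Reg.z))

/-- The vertices `w` are searched for in ascending order and the list of `z` is sorted, so the
pointer never has to go back. Under a good partition `w` occurs at or after the pointer: the cells
before it hold `u`, smaller tested vertices or the outsider of `z`. The vertices passed over on the
way are outsiders or `u`, since smaller tested vertices have been passed before and larger ones come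
after `w`. Hence a conflict or the end of the list refutes every good partition. The hypothesis `U`
is needed because the pointer of a marked vertex has already moved; by `hY` it holds whenever a good
partition exists. -/
theorem runs_checkPair {u o z w : ℕ} {U : Prop} {D : ℕ → ℕ → Prop} (hs : Base E s)
    (hu : s.reg .u = u) (hz : s.reg .z = z) (hw : s.reg .w = w) (hzK : InK E u o z)
    (hwK : InK E u o w) (hne : z ≠ w) (hC : Chk E u o U D s)
    (hD : ∀ x, InK E u o x → x ≠ z → (D z x ↔ x < w))
    (hY : ∀ P, Good E P → U ∧ IsOut E P u o)
    (hR : ¬ E.Yes → ∀ t', t' ≤ t + 200 + 100 * E.deg z → R t')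
    (hN : ∀ s' t', Agree checkPair s s' → Base E s' →
      Chk E u o U (fun a b => D a b ∨ a = z ∧ b = w) s' →
      s.arr .current z < s'.arr .current z →
      (∀ y, y ≠ z → s'.arr .current y = s.arr .current y) →
      t' ≤ t + 200 + 100 * (s'.arr .current z - s.arr .current z) → N s' t') :
    Runs checkPair N R s t := by
  have hV : E.V z := A.right hzK.1
  have hVu : E.V u := A.left hzK.1
  have hdeg := E.off_succ hV.1 hV.2
  have hle := hC.le z hV
  have hle' := hC.le_succ z hV
  -- In a graph with a good partition, `w` is found, and only outsiders are passed over.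
  have hfind : ∀ P, Good E P → ∃ i, s.arr .current z ≤ i ∧ i < E.off (z + 1) ∧ E.adj i = w := by
    intro P hP
    obtain ⟨hU, hO⟩ := hY P hP
    have hA : E.A z w := hO.adj hP hzK hwK hne
    obtain ⟨i, h1, h2, h3⟩ := A.exists_adj hA
    refine ⟨i, ?_, h2, h3⟩
    -- If `w` stood before the pointer, it would be `u`, an already treated vertex, or the recorded
    -- outsider of `z`; all three are impossible.
    by_contra hlt
    rcases hC.only hU z i hzK h1 (by omega) with h | ⟨-, h⟩ | h
    · exact A.ne hwK.1 (h.symm.trans h3)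
    · rw [h3] at h
      exact lt_irrefl w ((hD w hwK hne.symm).1 h)
    · have h0 : s.arr .outsider z ≠ 0 := by
        rw [← h, h3]
        exact A.pos hwK.1
      refine (hC.outs P hP z hV h0).2 ?_
      rw [← h, h3, hO.class_eq hwK, hO.class_eq hzK]
  have hpass : ∀ P, Good E P → ∀ i, s.arr .current z ≤ i → i < E.off (z + 1) →
      (∀ j, s.arr .current z ≤ j → j ≤ i → E.adj j ≠ w) → E.adj i ≠ u → P (E.adj i) ≠ P z := by
    intro P hP i hi hi' hj hiu hPi
    obtain ⟨hU, hO⟩ := hY P hP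
    have hA : E.A z (E.adj i) := A_adj hV (by omega) hi'
    have hiK : InK E u o (E.adj i) :=
      hO.inK_of_class_eq hP hVu (A.right hA) hiu (hPi.trans (hO.class_eq hzK))
    have hiz : E.adj i ≠ z := (A.ne hA).symm
    -- A vertex of the class of `z` in this cell is a tested vertex. If it is smaller than `w`, it
    -- has an earlier cell of its own; if it is larger, then `w` stands before it and would have
    -- stopped the search.
    rcases lt_trichotomy (E.adj i) w with h | h | h
    · obtain ⟨k, hk1, hk2, hk3⟩ := hC.before hU z _ hzK hiK hiz ((hD _ hiK hiz).2 h)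
      have := adj_inj hV hk1 (by omega) (by omega) hi' hk3
      omega
    · exact hj i hi le_rfl h
    · obtain ⟨k, hk1, hk2, hk3⟩ := hfind P hP
      have hki : i < k := by
        by_contra hki
        exact hj k hk1 (by omega) hk3
      have := E.mono hV.1 hV.2 (hle.trans hi) hki hk2
      omega
  refine Runs.spec (N := fun s' t' => Chk E u o U (fun a b => D a b ∨ a = z ∧ b = w) s' ∧
      s.arr .current z < s'.arr .current z ∧
      (∀ y, y ≠ z → s'.arr .current y = s.arr .current y) ∧
      t' ≤ t + 200 + 100 * (s'.arr .current z - s.arr .current z)) ?_ fun s' t' h h' =>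
    hN s' t' h (hs.agree h (by decide)) h'.1 h'.2.1 h'.2.2.1 h'.2.2.2
  rw [checkPair, runs_seq]
  refine runs_passOver (fun x => x ≠ w) z u hs hz hu hV (by simp) hle hle' ?_ (by simp) ?_ ?_
  · intro s' hB hag
    have e1 : s'.reg .z = z := (hag.reg _ (by decide)).trans hz
    have e2 : s'.reg .w = w := (hag.reg _ (by decide)).trans hw
    simp [hB.adj, e1, e2]
  · intro i t' hcf hcont ht'
    refine hR ?_ t' (by omega)
    rintro ⟨P, hP⟩
    refine hP.no_conflict (hC.outs P hP) hV hle (fun j hj hji => ?_) hcf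
    exact hpass P hP j hj (by have := hcf.2.1; omega) fun k hk hkj => hcont k hk (by omega)
  · intro s₁ t₁ hag hB hps hcont hfin ht
    have e1 : s₁.reg .z = z := (hag.reg _ (by decide)).trans hz
    have hple := hps.le
    have hple' := hps.le_off
    rw [runs_seq]
    refine runs_when.2 ⟨fun hcond => ?_, fun hcond => ?_⟩
    · have hend : s₁.arr .current z = E.off (z + 1) := by simpa [e1, hB.off] using hcond
      rw [runs_ret]
      refine hR ?_ _ ?_
      · rintro ⟨P, hP⟩
        obtain ⟨i, hi1, hi2, hi3⟩ := hfind P hP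
        exact hcont i hi1 (by omega) hi3
      · simp only [Test.cost, Exp.cost]
        omega
    · have hend : ¬ s₁.arr .current z = E.off (z + 1) := by simpa [e1, hB.off] using hcond
      have hlt : s₁.arr .current z < E.off (z + 1) := by omega
      have hfound : E.adj (s₁.arr .current z) = w := by
        rcases hfin with h | h
        · exact absurd h hend
        · exact not_not.1 h
      rw [runs_store]
      simp only [Exp.eval, e1]
      -- The vertices that are tested do not get new outsiders from `z`.
      have hsame : U → ∀ y, InK E u o y → y ≠ z → s₁.arr .outsider y = s.arr .outsider y := by
        intro hU y hy hyz
        by_contra hch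
        obtain ⟨-, i, hi1, hi2, hi3, hi4⟩ := hps.changed y hyz hch
        have hyw : y < w := by
          rw [← hi4, ← hfound]
          exact E.mono hV.1 hV.2 (hle.trans hi1) hi2 hlt
        obtain ⟨k, hk1, hk2, hk3⟩ := hC.before hU z y hzK hy hyz ((hD y hy hyz).2 hyw)
        have := adj_inj hV hk1 (by omega) (hle.trans hi1) (by omega) (hk3.trans hi4.symm)
        omega
      refine ⟨⟨fun y hy => ?_, fun y hy => ?_, fun hU a x ha hx hxa hd => ?_,
        fun hU a i ha hi hi' => ?_, fun P hP => ?_⟩, ?_, fun y hy => ?_, ?_⟩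
      · by_cases hyz : y = z
        · subst hyz
          simp
          omega
        · simpa [hyz, hps.other y hyz] using hC.le y hy
      · by_cases hyz : y = z
        · subst hyz
          simp
          omega
        · simpa [hyz, hps.other y hyz] using hC.le_succ y hy
      · by_cases haz : a = z
        · subst haz
          by_cases hxw : x = w
          · exact ⟨_, by omega, by simp, hfound.trans hxw.symm⟩
          · have hd' : D a x := by
              rcases hd with hd | hd
              · exact hd
              · exact absurd hd.2 hxw
            obtain ⟨i, h1, h2, h3⟩ := hC.before hU a x ha hx hxa hd'
            exact ⟨i, h1, by simp; omega, h3⟩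
        · have hd' : D a x := by
            rcases hd with hd | hd
            · exact hd
            · exact absurd hd.1 haz
          obtain ⟨i, h1, h2, h3⟩ := hC.before hU a x ha hx hxa hd'
          exact ⟨i, h1, by simpa [haz, hps.other a haz] using h2, h3⟩
      · by_cases haz : a = z
        · subst haz
          simp only [State.setCell_arr, if_true, Function.update_self] at hi'
          simp only [State.setCell_arr, reduceCtorEq, if_false]
          by_cases h1 : i < s.arr .current a
          · rcases hC.only hU a i ha hi h1 with h | ⟨h, h'⟩ | h
            · exact Or.inl h
            · exact Or.inr (Or.inl ⟨h, Or.inl h'⟩)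
            · refine Or.inr (Or.inr ?_)
              rcases hps.source with hsrc | ⟨hsrc, -⟩
              · rw [h, hsrc]
              · rw [hsrc] at h
                exact absurd h (A.pos (A_adj hV hi (by omega)))
          · by_cases h2 : i = s₁.arr .current a
            · rw [h2, hfound]
              exact Or.inr (Or.inl ⟨hwK, Or.inr (by simp)⟩)
            · by_cases h3 : E.adj i = u
              · exact Or.inl h3
              · exact Or.inr (Or.inr (hps.eq_outsider i (by omega) (by omega) h3))
        · have hi'' : i < s.arr .current a := by simpa [haz, hps.other a haz] using hi'
          simp only [State.setCell_arr, reduceCtorEq, if_false, hsame hU a ha haz]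
          rcases hC.only hU a i ha hi hi'' with h | ⟨h, h'⟩ | h
          · exact Or.inl h
          · exact Or.inr (Or.inl ⟨h, Or.inl h'⟩)
          · exact Or.inr (Or.inr h)
      · have := hps.outsidersOK hV hle (hC.outs P hP) fun i hi hi' hiu =>
          hpass P hP i hi (by omega) (fun j hj hji => hcont j hj (by omega)) hiu
        intro x
        simpa using this x
      · simp
        omega
      · simpa [hy] using hps.other y hy
      · simp [Test.cost, Exp.cost]
        omega

/-- The number of cells that have been passed over in the lists of the tested vertices. -/
def advance (E : Net) (u o : ℕ) (cur : ℕ → ℕ) : ℕ := ∑ z ∈ (E.nbrs u).erase o, (cur z - E.off z)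

theorem advance_update {u o z : ℕ} {cur cur' : ℕ → ℕ} (hz : InK E u o z) (h1 : E.off z ≤ cur z)
    (h2 : cur z ≤ cur' z) (h : ∀ y, y ≠ z → cur' y = cur y) :
    advance E u o cur' = advance E u o cur + (cur' z - cur z) := by
  have hz' : z ∈ (E.nbrs u).erase o := (mem_erase_nbrs (A.left hz.1)).2 hz
  unfold advance
  rw [← Finset.add_sum_erase _ _ hz', ← Finset.add_sum_erase _ (fun z => cur z - E.off z) hz']
  have : ∑ x ∈ ((E.nbrs u).erase o).erase z, (cur' x - E.off x) =
      ∑ x ∈ ((E.nbrs u).erase o).erase z, (cur x - E.off x) :=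
    Finset.sum_congr rfl fun x hx => by rw [h x (Finset.ne_of_mem_erase hx)]
  rw [this]
  omega

theorem advance_le {u o : ℕ} {cur : ℕ → ℕ} (hu : E.V u)
    (h : ∀ z, E.V z → cur z ≤ E.off (z + 1)) : advance E u o cur ≤ E.degSum u o := by
  refine Finset.sum_le_sum fun z hz => ?_
  have hV := A.right ((mem_erase_nbrs hu).1 hz).1
  have h1 := h z hV
  have h2 := E.off_succ hV.1 hV.2
  omega

/-- The inner loop of the clique test skips a search at most twice, for `w` and for `o`. All its
other rounds advance a pointer, so although there are quadratically many rounds, the skipped ones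
cost only a constant for each round of the outer loop. -/
theorem sum_skips_le {u w o : ℕ} (hu : E.V u) :
    ∑ i ∈ Finset.Ico (E.off u) (E.off (u + 1)), (if E.adj i = w ∨ E.adj i = o then 1 else 0) ≤ 2 := by
  rw [sum_adj hu fun x => if x = w ∨ x = o then 1 else 0, ← Finset.card_filter]
  refine (Finset.card_le_card (t := {w, o}) fun x hx => ?_).trans Finset.card_le_two
  simpa using (Finset.mem_filter.1 hx).2

/-- The clique test. -/
def checkClique : Cmd :=
  forNeighbors .i .w .u
    (Cmd.when (.not (.eq Reg.w Reg.o))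
      (forNeighbors .j .z .u
        (Cmd.when (.and (.not (.eq Reg.z Reg.w)) (.not (.eq Reg.z Reg.o))) checkPair)))

/-- The vertex `w` is one of the vertices in the cells from `off[u]` to `p - 1`. -/
def Before (E : Net) (u p w : ℕ) : Prop := ∃ i, E.off u ≤ i ∧ i < p ∧ E.adj i = w

theorem before_succ {u p w : ℕ} (hp : E.off u ≤ p) :
    Before E u (p + 1) w ↔ Before E u p w ∨ w = E.adj p := by
  constructor
  · rintro ⟨i, h1, h2, h3⟩
    by_cases h : i = p
    · exact Or.inr (h ▸ h3.symm)
    · exact Or.inl ⟨i, h1, by omega, h3⟩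
  · rintro (⟨i, h1, h2, h3⟩ | h)
    · exact ⟨i, h1, by omega, h3⟩
    · exact ⟨p, hp, by omega, h.symm⟩

/-- Because the list of `u` is sorted, having been treated before the current vertex means being
smaller. This translates the progress of the outer loop into the form that `runs_checkPair` asks
for. -/
theorem before_iff_lt {u p w : ℕ} (hp : E.off u ≤ p) (hp' : p < E.off (u + 1)) (hA : E.A u w) :
    Before E u p w ↔ w < E.adj p := by
  have hu := A.left hA
  constructor
  · rintro ⟨i, h1, h2, rfl⟩
    exact E.mono hu.1 hu.2 h1 h2 hp'
  · intro h
    obtain ⟨i, h1, h2, rfl⟩ := A.exists_adj hA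
    refine ⟨i, h1, ?_, rfl⟩
    by_contra hlt
    rcases Nat.lt_or_eq_of_le (not_lt.1 hlt) with h' | h'
    · have := E.mono hu.1 hu.2 hp h' h2
      omega
    · rw [h'] at h
      exact lt_irrefl _ h

theorem not_before_self {u p : ℕ} (hu : E.V u) (hp' : p < E.off (u + 1)) :
    ¬ Before E u p (E.adj p) := by
  rintro ⟨i, h1, h2, h3⟩
  have := adj_inj hu h1 (by omega) (by omega) hp' h3
  omega

theorem before_all {u w : ℕ} (hA : E.A u w) : Before E u (E.off (u + 1)) w := A.exists_adj hA

/-- The potential `Ψ` counts the cells passed over in the lists of the tested vertices. Each search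
moves a pointer by at least one cell, which pays for the search and for its round; the total advance
is bounded by the degrees without that of `o`. -/
theorem runs_checkClique {u o : ℕ} {U : Prop} (hs : Base E s) (hu : s.reg .u = u) (hV : E.V u)
    (ho : s.reg .o = o) (hC : Chk E u o U (fun _ _ => False) s)
    (hY : ∀ P, Good E P → U ∧ IsOut E P u o)
    (hR : ¬ E.Yes → ∀ t', t' ≤ t + 1000 + 1000 * E.deg u + 1000 * E.degSum u o → R t')
    (hN : ∀ s' t', Agree checkClique s s' → Base E s' → Chk E u o U (fun _ _ => True) s' →
      (∀ y, ¬ InK E u o y → s'.arr .current y = s.arr .current y) →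
      t' ≤ t + 1000 + 1000 * E.deg u + 1000 * E.degSum u o → N s' t') :
    Runs checkClique N R s t := by
  have hdegu := E.off_succ hV.1 hV.2
  obtain ⟨Ψ, hΨ⟩ : ∃ Ψ : State → ℕ, Ψ = fun s => advance E u o (s.arr .current) := ⟨_, rfl⟩
  -- The potential at the start appears on the left because pointers of vertices marked earlier may
  -- already be advanced.
  refine runs_forNeighbors (fun p s' t' => Chk E u o U (fun _ x => Before E u p x) s' ∧
    (∀ y, ¬ InK E u o y → s'.arr .current y = s.arr .current y) ∧
    t' + 400 * Ψ s ≤ t + 100 + 500 * (p - E.off u) + 400 * Ψ s') u hs hu hV (by decide) (by decide)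
    (by decide) ?_ ?_ ?_
  · refine ⟨(hC.congr fun _ x _ _ _ => ⟨False.elim, fun ⟨i, h1, h2, _⟩ => by omega⟩).of_eq rfl rfl,
      fun _ _ => rfl, ?_⟩
    simp only [hΨ, State.setReg_arr]
    omega
  · rintro p s₁ t₁ hag hB hru h1 h2 hA hrp ⟨hC₁, hcur, ht⟩
    have ho1 : s₁.reg .o = o := (hag.reg _ (by decide)).trans ho
    refine runs_when.2 ⟨fun hcond => ?_, fun hcond => ?_⟩
    · have hne : E.adj p ≠ o := by simpa [ho1] using hcond
      have hwK : InK E u o (E.adj p) := ⟨hA, hne⟩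
      refine runs_forNeighbors (fun q s' t' =>
        Chk E u o U (fun z x => Before E u p x ∨ x = E.adj p ∧ Before E u q z) s' ∧
        (∀ y, ¬ InK E u o y → s'.arr .current y = s.arr .current y) ∧
        t' + 400 * Ψ s₁ ≤ t₁ + 100 + 60 * ∑ i ∈ Finset.Ico (E.off u) q,
          (if E.adj i = E.adj p ∨ E.adj i = o then 1 else 0) + 400 * Ψ s') u
        (hB.setReg _ _ (by simp)) (by simp [hru]) hV (by decide) (by decide) (by decide) ?_ ?_ ?_
      · refine ⟨(hC₁.congr fun _ x _ _ _ => ⟨Or.inl, ?_⟩).of_eq rfl rfl, hcur, ?_⟩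
        · rintro (h | ⟨-, i, h1, h2, -⟩)
          · exact h
          · omega
        · simp only [hΨ, State.setReg_arr]
          simp only [Test.cost, Exp.cost]
          omega
      · rintro q s₂ t₂ hag' hB₂ hru₂ h3 h4 hA' hrq ⟨hC₂, hcur₂, ht₂⟩
        have ho2 : s₂.reg .o = o := (hag'.reg _ (by decide)).trans (by simp [ho1])
        have hw2 : s₂.reg .w = E.adj p := (hag'.reg _ (by decide)).trans (by simp)
        rw [Finset.sum_Ico_succ_top h3]
        refine runs_when.2 ⟨fun hcond => ?_, fun hcond => ?_⟩
        · have hzw : E.adj q ≠ E.adj p ∧ E.adj q ≠ o := by simpa [ho2, hw2] using hcond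
          have hzK : InK E u o (E.adj q) := ⟨hA', hzw.2⟩
          refine runs_checkPair (hB₂.setReg _ _ (by simp)) (by simp [hru₂]) (z := E.adj q)
            (by simp) (w := E.adj p) (by simp [hw2]) hzK hwK hzw.1 (hC₂.of_eq rfl rfl) ?_ hY ?_ ?_
          -- The list of `z` itself has not yet been searched for the current `w`, since `z` stands
          -- at the current cell of the inner loop. Thus only the vertices before `w` count, and
          -- these are the smaller ones.
          · intro x hx hxz
            rw [← before_iff_lt h1 h2 hx.1]
            exact ⟨fun h => h.resolve_right fun h' => not_before_self hV h4 h'.2, Or.inl⟩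
          · intro hYes t' ht'
            refine hR hYes t' ?_
            have b1 := advance_le (o := o) hV hC₂.le_succ
            have b2 := deg_le_degSum hA' hzw.2
            have b3 : ∑ i ∈ Finset.Ico (E.off u) q,
                (if E.adj i = E.adj p ∨ E.adj i = o then 1 else 0) ≤ 2 :=
              (Finset.sum_le_sum_of_subset (Finset.Ico_subset_Ico le_rfl h4.le)).trans
                (sum_skips_le hV)
            simp only [hΨ, Test.cost, Exp.cost] at ht ht₂ ht'
            omega
          · intro s₃ t₃ hag₃ hB₃ hC₃ hlt hcur₃ ht₃
            refine ⟨(hC₃.congr fun z x hz hx hxz => ?_).of_eq rfl rfl, fun y hy => ?_, ?_⟩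
            · rw [before_succ h3]
              tauto
            · have hyz : y ≠ E.adj q := by
                rintro rfl
                exact hy hzK
              simpa using (hcur₃ y hyz).trans (hcur₂ y hy)
            · have := advance_update (u := u) (o := o) hzK (hC₂.le _ (A.right hA')) hlt.le hcur₃
              simp only [State.setReg_arr] at this hlt ht₃
              simp only [hΨ, Test.cost, Exp.cost, State.setReg_arr] at ht₂ ht₃ ⊢
              omega
        · have hzw : E.adj q = E.adj p ∨ E.adj q = o := by
            by_contra h
            rw [not_or] at h
            exact hcond (by simpa [ho2, hw2] using h)
          rw [if_pos hzw]
          refine ⟨(hC₂.congr fun z x hz hx hxz => ?_).of_eq rfl rfl, hcur₂, ?_⟩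
          · rw [before_succ h3]
            refine ⟨fun h => h.imp id (And.imp id Or.inl), fun h => h.imp id ?_⟩
            rintro ⟨hx', hz' | hz'⟩
            · exact ⟨hx', hz'⟩
            · rcases hzw with h | h
              · exact absurd (hx'.trans (h.symm.trans hz'.symm)) hxz
              · exact absurd (hz'.trans h) hz.2
          · simp only [hΨ, State.setReg_arr, Test.cost, Exp.cost] at ht₂ ⊢
            omega
      · rintro s₂ t₂ hag' hB₂ hru₂ ⟨hC₂, hcur₂, ht₂⟩
        refine ⟨(hC₂.congr fun z x hz hx hxz => ?_).of_eq rfl rfl, hcur₂, ?_⟩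
        · rw [before_succ h1]
          refine ⟨fun h => h.imp id And.left, fun h => h.imp id fun h => ⟨h, before_all hz.1⟩⟩
        · have b3 := sum_skips_le (w := E.adj p) (o := o) hV
          simp only [hΨ, State.setReg_arr] at ht ht₂ ⊢
          omega
    · have heq : E.adj p = o := by simpa [ho1] using hcond
      refine ⟨(hC₁.congr fun z x hz hx hxz => ?_).of_eq rfl rfl, hcur, ?_⟩
      · rw [before_succ h1]
        refine ⟨Or.inl, fun h => h.resolve_right fun h => hx.2 (h.trans heq)⟩
      · simp only [hΨ, State.setReg_arr, Test.cost, Exp.cost] at ht ⊢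
        omega
  · rintro s₁ t₁ hag hB hru ⟨hC₁, hcur, ht⟩
    refine hN s₁ _ hag hB (hC₁.congr fun z x hz hx hxz => ⟨fun _ => trivial, fun _ =>
      before_all hx.1⟩) hcur ?_
    have b1 := advance_le (o := o) hV hC₁.le_succ
    simp only [hΨ] at ht
    omega

/-! ## Marking -/

/-- The records of the marked vertices are consistent. -/
structure Marked (E : Net) (s : State) : Prop where
  class_le : ∀ v, s.arr .clique v ≤ s.reg .cliques
  order_mem : ∀ k, k < s.reg .placed → E.V (s.arr .order k) ∧ s.arr .clique (s.arr .order k) ≠ 0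
  order_inj : ∀ k l, k < s.reg .placed → l < s.reg .placed → s.arr .order k = s.arr .order l → k = l
  order_surj : ∀ v, E.V v → s.arr .clique v ≠ 0 → ∃ k, k < s.reg .placed ∧ s.arr .order k = v
  order_mono : ∀ k l, k ≤ l → l < s.reg .placed →
    s.arr .clique (s.arr .order k) ≤ s.arr .clique (s.arr .order l)
  size_eq : ∀ c, c ≠ 0 →
    s.arr .size c = ((Finset.Icc 1 E.n).filter fun v => s.arr .clique v = c).card

theorem Marked.of_eq (h : Marked E s) (h1 : s'.reg .cliques = s.reg .cliques)
    (h2 : s'.reg .placed = s.reg .placed) (h3 : s'.arr .clique = s.arr .clique)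
    (h4 : s'.arr .order = s.arr .order) (h5 : s'.arr .size = s.arr .size) : Marked E s' := by
  constructor
  · rw [h1, h3]; exact h.class_le
  · rw [h2, h3, h4]; exact h.order_mem
  · rw [h2, h4]; exact h.order_inj
  · rw [h2, h3, h4]; exact h.order_surj
  · rw [h2, h3, h4]; exact h.order_mono
  · rw [h3, h5]; exact h.size_eq

theorem Marked.newClique (h : Marked E s) : Marked E (s.setReg .cliques (s.reg .cliques + 1)) := by
  constructor
  · intro v
    have := h.class_le v
    simp
    omega
  · simpa using h.order_mem
  · simpa using h.order_inj
  · simpa using h.order_surj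
  · simpa using h.order_mono
  · exact h.size_eq

theorem runs_mark {r : Reg} {v : ℕ} (hv : s.reg r = v) (hV : E.V v)
    (hM : Marked E s) (hcl : s.arr .clique v = 0) (hc : s.reg .cliques ≠ 0)
    (hN : ∀ s', Agree (mark r) s s' → Marked E s' →
      s'.arr .clique = Function.update (s.arr .clique) v (s.reg .cliques) → N s' (t + 14)) :
    Runs (mark r) N R s t := by
  refine Runs.spec (N := fun s' t' => Marked E s' ∧
    s'.arr .clique = Function.update (s.arr .clique) v (s.reg .cliques) ∧ t' = t + 14) ?_
    fun s' t' h h' => h'.2.2 ▸ hN s' h h'.1 h'.2.1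
  simp only [mark, runs_seq, runs_store, runs_set]
  have hnot : ∀ k, k < s.reg .placed → s.arr .order k ≠ v := fun k hk h =>
    (hM.order_mem k hk).2 (h ▸ hcl)
  refine ⟨⟨fun x => ?_, fun k hk => ?_, fun k l hk hl h => ?_, fun x hx hne => ?_,
    fun k l hkl hl => ?_, fun c hc0 => ?_⟩, by simp [hv], by simp⟩
  · have := hM.class_le x
    by_cases h : x = v <;> simp [h, hv, this]
  · simp only [State.setCell_arr, State.setReg_arr, State.setReg_reg, State.setCell_reg, Exp.eval,
      reduceCtorEq, if_true, if_false, hv] at hk ⊢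
    by_cases hk' : k = s.reg .placed
    · simp [hk', hV, hc]
    · have hlt : k < s.reg .placed := by omega
      simp [hk', hM.order_mem k hlt, hnot k hlt]
  · simp only [State.setCell_arr, State.setReg_arr, State.setReg_reg, State.setCell_reg, Exp.eval,
      reduceCtorEq, if_true, if_false, hv, Function.update_apply] at hk hl h
    split_ifs at h with h1 h2 h2
    · omega
    · exact absurd h.symm (hnot l (by omega))
    · exact absurd h (hnot k (by omega))
    · exact hM.order_inj k l (by omega) (by omega) h
  · simp only [State.setCell_arr, State.setReg_arr, State.setReg_reg, State.setCell_reg, Exp.eval,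
      reduceCtorEq, if_true, if_false, hv] at hne ⊢
    by_cases h : x = v
    · exact ⟨s.reg .placed, by omega, by simp [h]⟩
    · rw [Function.update_of_ne h] at hne
      obtain ⟨k, hk, hk'⟩ := hM.order_surj x hx hne
      exact ⟨k, by omega, by rw [Function.update_of_ne (by omega), hk']⟩
  · simp only [State.setCell_arr, State.setReg_arr, State.setReg_reg, State.setCell_reg, Exp.eval,
      reduceCtorEq, if_true, if_false, hv] at hl ⊢
    -- The newly marked vertex gets the largest number in use, so the order of marking remains
    -- monotone in the clique numbers. The stamps of `buildRoot` rely on this.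
    by_cases hl' : l = s.reg .placed
    · subst hl'
      have : ∀ y, Function.update (s.arr .clique) v (s.reg .cliques) y ≤ s.reg .cliques := by
        intro y
        rw [Function.update_apply]
        split_ifs
        · exact le_rfl
        · exact hM.class_le y
      simpa using this _
    · have h1 : k < s.reg .placed := by omega
      have h2 : l < s.reg .placed := by omega
      rw [Function.update_of_ne hl', Function.update_of_ne (hnot l h2),
        Function.update_of_ne (show k ≠ s.reg .placed by omega), Function.update_of_ne (hnot k h1)]
      exact hM.order_mono k l hkl h2
  · simp only [State.setCell_arr, State.setReg_arr, State.setCell_reg, Exp.eval,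
      reduceCtorEq, if_true, if_false, hv]
    by_cases hcc : c = s.reg .cliques
    · subst hcc
      have : ((Finset.Icc 1 E.n).filter fun x =>
          Function.update (s.arr .clique) v (s.reg .cliques) x = s.reg .cliques) =
          insert v ((Finset.Icc 1 E.n).filter fun x => s.arr .clique x = s.reg .cliques) := by
        ext x
        have := hV.1
        have := hV.2
        by_cases h : x = v <;> simp [h]
        omega
      rw [this, Finset.card_insert_of_notMem (by simp [hcl, Ne.symm hc]), Function.update_self,
        hM.size_eq _ hc0]
    · have : ((Finset.Icc 1 E.n).filter fun x =>
          Function.update (s.arr .clique) v (s.reg .cliques) x = c) =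
          ((Finset.Icc 1 E.n).filter fun x => s.arr .clique x = c) := by
        ext x
        by_cases h : x = v
        · simp [h, Ne.symm hcc, hcl, Ne.symm hc0]
        · simp [h]
      rw [this, Function.update_of_ne hcc, hM.size_eq _ hc0]

/-- The marked vertices are divided into cliques, and every marked vertex has at most one neighbour
outside its clique. -/
structure Cliques (E : Net) (cl : ℕ → ℕ) : Prop where
  adj : ∀ {v w}, E.V v → E.V w → v ≠ w → cl v ≠ 0 → cl v = cl w → E.A v w
  outside : ∀ {v a b}, cl v ≠ 0 → E.A v a → E.A v b → cl a ≠ cl v → cl b ≠ cl v → a = b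

/-- As `c` exceeds all numbers in use, the new class is disjoint from the old ones. A vertex of `K`
had number `0`, hence was outside every old clique before and still is, so the outside neighbours of
the old cliques do not change. -/
theorem Cliques.extend {cl cl' : ℕ → ℕ} (h : Cliques E cl) (K : ℕ → Prop) [DecidablePred K] (c : ℕ)
    (hc : ∀ v, cl v < c) (hcl' : ∀ x, cl' x = if K x then c else cl x)
    (hK : ∀ x, K x → cl x = 0) (hadj : ∀ x y, K x → K y → x ≠ y → E.A x y)
    (hout : ∀ x a b, K x → E.A x a → E.A x b → ¬ K a → ¬ K b → a = b) : Cliques E cl' := by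
  constructor
  · intro v w hv hw hne h0 heq
    rw [hcl'] at h0
    rw [hcl', hcl'] at heq
    have h1 := hc v
    have h2 := hc w
    split_ifs at h0 heq with h3 h4 h4
    · exact hadj v w h3 h4 hne
    · omega
    · omega
    · exact h.adj hv hw hne h0 heq
  · intro v a b h0 ha hb hane hbne
    rw [hcl'] at h0
    rw [hcl', hcl' v] at hane hbne
    by_cases hv : K v
    · rw [if_pos hv] at h0 hane hbne
      exact hout v a b hv ha hb (fun h => hane (if_pos h)) (fun h => hbne (if_pos h))
    · rw [if_neg hv] at h0 hane hbne
      refine h.outside h0 ha hb ?_ ?_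
      · by_cases hKa : K a
        · rw [hK a hKa]
          exact h0.symm
        · rwa [if_neg hKa] at hane
      · by_cases hKb : K b
        · rw [hK b hKb]
          exact h0.symm
        · rwa [if_neg hKb] at hbne

/-- The memory between two steps of the treatment of the vertices of degree at least `3`. -/
structure Inv (E : Net) (s : State) : Prop where
  base : Base E s
  marked : Marked E s
  cliques : Cliques E (s.arr .clique)
  closed : ∀ v w, E.A v w → s.arr .clique v ≠ 0 → E.deg v ≤ 2 → E.deg w ≤ 2 → s.arr .clique w ≠ 0
  le : ∀ z, E.V z → E.off z ≤ s.arr .current z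
  le_succ : ∀ z, E.V z → s.arr .current z ≤ E.off (z + 1)
  current : ∀ z, E.V z → s.arr .clique z = 0 → s.arr .current z = E.off z
  outs : ∀ P, Good E P → OutsidersOK E P s
  classes : ∀ P, Good E P → ∀ v w, E.V v → E.V w → s.arr .clique v ≠ 0 →
    (s.arr .clique w = s.arr .clique v ↔ P w = P v)

/-- Marking the tested vertices. -/
def markClique : Cmd :=
  forNeighbors .i .w .u
    (Cmd.when (.not (.eq Reg.w Reg.o))
      (Cmd.when (.not (.eq (.cell .clique Reg.w) (.lit 0))) .ret ;;
       mark .w ;;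
       passOver .w (.eq (.lit 0) (.lit 0))))

/-- After the clique test the list of a tested vertex contains every other tested vertex before the
pointer. The remaining cells can therefore hold only `u` and outsiders, and passing over them to the
end shows that there is at most one outsider. The assumption `U` is discharged here: the loop
survives only if every tested vertex was unmarked. -/
theorem runs_markClique {u o c : ℕ} {cl : ℕ → ℕ} {U : Prop} (hs : Base E s) (hu : s.reg .u = u)
    (hV : E.V u) (ho : s.reg .o = o) (hU : U ↔ ∀ x, InK E u o x → cl x = 0)
    (hC : Chk E u o U (fun _ _ => True) s) (hM : Marked E s) (hc : s.reg .cliques = c) (hc0 : c ≠ 0)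
    (hcl : ∀ x, s.arr .clique x = if x = u then c else cl x)
    (hY : ∀ P, Good E P → U ∧ IsOut E P u o)
    (hR : ¬ E.Yes → ∀ t', t' ≤ t + 1000 + 1000 * E.deg u + 1000 * E.degSum u o → R t')
    (hN : ∀ s' t', Agree markClique s s' → Base E s' → Chk E u o True (fun _ _ => True) s' →
      Marked E s' → (∀ x, InK E u o x → cl x = 0) →
      (∀ x, x = u ∨ InK E u o x → s'.arr .clique x = c) →
      (∀ x, ¬ (x = u ∨ InK E u o x) → s'.arr .clique x = cl x) →
      (∀ x, InK E u o x → s'.arr .current x = E.off (x + 1)) →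
      (∀ y, ¬ InK E u o y → s'.arr .current y = s.arr .current y) →
      t' ≤ t + 1000 + 1000 * E.deg u + 1000 * E.degSum u o → N s' t') :
    Runs markClique N R s t := by
  have hdegu := E.off_succ hV.1 hV.2
  obtain ⟨Ψ, hΨ⟩ : ∃ Ψ : State → ℕ, Ψ = fun s => advance E u o (s.arr .current) := ⟨_, rfl⟩
  refine runs_forNeighbors (fun p s' t' => Chk E u o U (fun _ _ => True) s' ∧ Marked E s' ∧
    (∀ x, InK E u o x → Before E u p x → cl x = 0) ∧
    (∀ x, x = u ∨ InK E u o x ∧ Before E u p x → s'.arr .clique x = c) ∧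
    (∀ x, ¬ (x = u ∨ InK E u o x ∧ Before E u p x) → s'.arr .clique x = cl x) ∧
    (U → ∀ x, InK E u o x → Before E u p x → s'.arr .current x = E.off (x + 1)) ∧
    (∀ y, ¬ InK E u o y → s'.arr .current y = s.arr .current y) ∧
    t' + 400 * Ψ s ≤ t + 100 + 500 * (p - E.off u) + 400 * Ψ s') u hs hu hV (by decide) (by decide)
    (by decide) ?_ ?_ ?_
  · have hnb : ∀ x, ¬ Before E u (E.off u) x := by
      rintro x ⟨i, h1, h2, -⟩
      omega
    refine ⟨hC.of_eq rfl rfl, hM.of_eq rfl rfl rfl rfl rfl, fun x _ h => absurd h (hnb x),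
      fun x hx => ?_, fun x hx => ?_, fun _ x _ h => absurd h (hnb x), fun _ _ => rfl, ?_⟩
    · rcases hx with h | h
      · simpa [h] using hcl u
      · exact absurd h.2 (hnb x)
    · have := hcl x
      rw [if_neg fun h => hx (Or.inl h)] at this
      simpa using this
    · simp only [hΨ, State.setReg_arr]
      omega
  · rintro p s₁ t₁ hag hB hru h1 h2 hA hrp ⟨hC₁, hM₁, hz, hin, hnin, hend, hcur, ht⟩
    have ho1 : s₁.reg .o = o := (hag.reg _ (by decide)).trans ho
    have hc1 : s₁.reg .cliques = c := (hag.reg _ (by decide)).trans hc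
    refine runs_when.2 ⟨fun hcond => ?_, fun hcond => ?_⟩
    · have hne : E.adj p ≠ o := by simpa [ho1] using hcond
      obtain ⟨w, hw⟩ : ∃ w, w = E.adj p := ⟨_, rfl⟩
      rw [← hw] at hA hne ⊢
      have hwK : InK E u o w := ⟨hA, hne⟩
      have hVw : E.V w := A.right hA
      have hdegw := E.off_succ hVw.1 hVw.2
      have hdw := deg_le_degSum hA hne
      have b1 := advance_le (o := o) hV hC₁.le_succ
      have hnot : ¬ (w = u ∨ InK E u o w ∧ Before E u p w) := by
        rintro (h | h)
        · exact A.ne hA h.symm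
        · exact not_before_self hV h2 (hw ▸ h.2)
      have hclw : s₁.arr .clique w = cl w := hnin w hnot
      -- Only outsiders are passed over now.
      have hpass : U → ∀ i, s₁.arr .current w ≤ i → i < E.off (w + 1) → ¬ InK E u o (E.adj i) := by
        intro hUU i hi hi' hiK
        have hiV := hC₁.le w hVw
        have hiw : E.adj i ≠ w := (A.ne (A_adj hVw (by omega) hi')).symm
        obtain ⟨k, hk1, hk2, hk3⟩ := hC₁.before hUU w _ hwK hiK hiw trivial
        have := adj_inj hVw hk1 (by omega) (by omega) hi' hk3
        omega
      have hpassP : ∀ P, Good E P → ∀ i, s₁.arr .current w ≤ i → i < E.off (w + 1) →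
          E.adj i ≠ u → P (E.adj i) ≠ P w := by
        intro P hP i hi hi' hiu hPi
        obtain ⟨hUU, hO⟩ := hY P hP
        have := hC₁.le w hVw
        exact hpass hUU i hi hi' (hO.inK_of_class_eq hP hV (A.right (A_adj hVw (by omega) hi')) hiu
          (hPi.trans (hO.class_eq hwK)))
      rw [runs_seq]
      refine runs_when.2 ⟨fun hcond' => ?_, fun hcond' => ?_⟩
      · have hcw : cl w ≠ 0 := by simpa [hclw] using hcond'
        rw [runs_ret]
        refine hR ?_ _ ?_
        -- A tested vertex that is already marked contradicts `U`, which every good partition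
        -- implies.
        · rintro ⟨P, hP⟩
          exact hcw (hU.1 (hY P hP).1 w hwK)
        · simp only [hΨ, Test.cost, Exp.cost] at ht ⊢
          omega
      · have hcw : cl w = 0 := by simpa [hclw] using hcond'
        rw [runs_seq]
        refine runs_mark (v := w) (by simp) hVw (hM₁.of_eq rfl rfl rfl rfl rfl)
          (by simpa [hclw] using hcw) (by simpa [hc1] using hc0) fun s₂ hag₂ hM₂ hcl₂ => ?_
        have hB₂ : Base E s₂ := (hB.setReg .w w (by simp)).agree hag₂ (by decide)
        have e1 : s₂.reg .w = w := (hag₂.reg _ (by decide)).trans (by simp)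
        have e2 : s₂.reg .u = u := (hag₂.reg _ (by decide)).trans (by simp [hru])
        have e3 : s₂.arr .current = s₁.arr .current := (hag₂.arr _ (by decide)).trans (by simp)
        have e4 : s₂.arr .outsider = s₁.arr .outsider := (hag₂.arr _ (by decide)).trans (by simp)
        have hC₂ : Chk E u o U (fun _ _ => True) s₂ := hC₁.of_eq e3 e4
        rw [← e3] at hpass hpassP
        refine runs_passOver (fun _ => True) w u hB₂ e1 e2 hVw (by simp) (hC₂.le w hVw)
          (hC₂.le_succ w hVw) (by simp) (by simp) ?_ ?_
        · intro i t' hcf _ ht'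
          refine hR ?_ t' ?_
          · rintro ⟨P, hP⟩
            refine hP.no_conflict (hC₂.outs P hP) hVw (hC₂.le w hVw) (fun j hj hji => ?_) hcf
            exact hpassP P hP j hj (by have := hcf.2.1; omega)
          · simp only [hΨ, Test.cost, Exp.cost] at ht ht'
            omega
        · intro s₃ t₃ hag₃ hB₃ hps _ hfin ht₃
          have f1 : s₃.arr .clique = s₂.arr .clique := hag₃.arr _ (by decide)
          have hcw3 : s₃.arr .current w = E.off (w + 1) := hfin.resolve_right (by simp)
          have hsame : U → ∀ y, InK E u o y → y ≠ w → s₃.arr .outsider y = s₂.arr .outsider y := by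
            intro hUU y hy hyw
            by_contra hch
            obtain ⟨-, i, hi1, hi2, hi3, hi4⟩ := hps.changed y hyw hch
            exact hpass hUU i hi1 (by omega) (hi4 ▸ hy)
          have hbs : ∀ x, Before E u (p + 1) x ↔ Before E u p x ∨ x = w := fun x => by
            rw [before_succ h1, hw]
          refine ⟨⟨fun y hy => ?_, fun y hy => ?_, fun hUU a x ha hx hxa _ => ?_,
            fun hUU a i ha hi hi' => ?_, fun P hP => ?_⟩,
            hM₂.of_eq (hag₃.reg _ (by decide)) (hag₃.reg _ (by decide)) f1
              (hag₃.arr _ (by decide)) (hag₃.arr _ (by decide)), fun x hx hb => ?_, fun x hx => ?_,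
            fun x hx => ?_, fun hUU x hx hb => ?_, fun y hy => ?_, ?_⟩
          · by_cases hyw : y = w
            · subst hyw
              exact (hC₂.le y hy).trans hps.le
            · simpa [hps.other y hyw] using hC₂.le y hy
          · by_cases hyw : y = w
            · subst hyw
              exact hps.le_off
            · simpa [hps.other y hyw] using hC₂.le_succ y hy
          · obtain ⟨i, hi1, hi2, hi3⟩ := hC₂.before hUU a x ha hx hxa trivial
            refine ⟨i, hi1, ?_, hi3⟩
            by_cases haw : a = w
            · subst haw
              exact lt_of_lt_of_le hi2 hps.le
            · simpa [hps.other a haw] using hi2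
          · by_cases haw : a = w
            · subst haw
              simp only [State.setReg_arr] at hi' ⊢
              by_cases h1 : i < s₂.arr .current a
              · rcases hC₂.only hUU a i ha hi h1 with h | h | h
                · exact Or.inl h
                · exact Or.inr (Or.inl h)
                · refine Or.inr (Or.inr ?_)
                  rcases hps.source with hsrc | ⟨hsrc, -⟩
                  · rw [h, hsrc]
                  · rw [hsrc] at h
                    exact absurd h (A.pos (A_adj hVw hi (by omega)))
              · by_cases h3 : E.adj i = u
                · exact Or.inl h3
                · exact Or.inr (Or.inr (hps.eq_outsider i (by omega) hi' h3))
            · have hi'' : i < s₂.arr .current a := by simpa [hps.other a haw] using hi'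
              simpa [hsame hUU a ha haw] using hC₂.only hUU a i ha hi hi''
          · have := hps.outsidersOK hVw (hC₂.le w hVw) (hC₂.outs P hP) fun i hi hi' hiu =>
              hpassP P hP i hi (by omega) hiu
            intro x
            simpa using this x
          · rcases (hbs x).1 hb with h | h
            · exact hz x hx h
            · rwa [h]
          · simp only [State.setReg_arr, f1, hcl₂]
            by_cases hxw : x = w
            · simp [hxw, hc1]
            · rw [Function.update_of_ne hxw]
              refine hin x (hx.imp id fun h => ⟨h.1, ((hbs x).1 h.2).resolve_right hxw⟩)
          · simp only [State.setReg_arr, f1, hcl₂]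
            have hxw : x ≠ w := fun h => hx (Or.inr ⟨h ▸ hwK, (hbs x).2 (Or.inr h)⟩)
            rw [Function.update_of_ne hxw]
            exact hnin x fun h => hx (h.imp id fun h => ⟨h.1, (hbs x).2 (Or.inl h.2)⟩)
          · by_cases hxw : x = w
            · rw [hxw]
              simpa using hcw3
            · simpa [hps.other x hxw, e3] using hend hUU x hx (((hbs x).1 hb).resolve_right hxw)
          · have hyw : y ≠ w := by
              rintro rfl
              exact hy hwK
            simpa [hps.other y hyw, e3] using hcur y hy
          · have := advance_update (u := u) (o := o) hwK (hC₂.le _ hVw) hps.le hps.other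
            have hle := hps.le
            rw [e3] at this ht₃ hle
            simp only [hΨ, Test.cost, Exp.cost, State.setReg_arr] at ht ht₃ ⊢
            omega
    · have heq : E.adj p = o := by simpa [ho1] using hcond
      have hbs : ∀ x, InK E u o x → (Before E u (p + 1) x ↔ Before E u p x) := fun x hx => by
        rw [before_succ h1]
        exact ⟨fun h => h.resolve_right fun h => hx.2 (h.trans heq), Or.inl⟩
      refine ⟨hC₁.of_eq rfl rfl, hM₁.of_eq rfl rfl rfl rfl rfl,
        fun x hx hb => hz x hx ((hbs x hx).1 hb),
        fun x hx => hin x (hx.imp id fun h => ⟨h.1, (hbs x h.1).1 h.2⟩),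
        fun x hx => hnin x fun h => hx (h.imp id fun h => ⟨h.1, (hbs x h.1).2 h.2⟩),
        fun hUU x hx hb => hend hUU x hx ((hbs x hx).1 hb), hcur, ?_⟩
      simp only [hΨ, State.setReg_arr, Test.cost, Exp.cost] at ht ⊢
      omega
  · rintro s₁ t₁ hag hB hru ⟨hC₁, hM₁, hz, hin, hnin, hend, hcur, ht⟩
    have hb : ∀ x, InK E u o x → Before E u (E.off (u + 1)) x := fun x hx => before_all hx.1
    have hUU : U := hU.2 fun x hx => hz x hx (hb x hx)
    refine hN s₁ _ hag hB ⟨hC₁.le, hC₁.le_succ, fun _ => hC₁.before hUU, fun _ => hC₁.only hUU,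
      hC₁.outs⟩ hM₁ (fun x hx => hz x hx (hb x hx))
      (fun x hx => hin x (hx.imp id fun h => ⟨h, hb x h⟩))
      (fun x hx => hnin x fun h => hx (h.imp id And.left)) (fun x hx => hend hUU x hx (hb x hx))
      hcur ?_
    have b1 := advance_le (o := o) hV hC₁.le_succ
    simp only [hΨ] at ht
    omega

/-! ## The vertices of degree at least three -/

/-- The number of marked vertices plus the sum of their degrees. -/
def weight (E : Net) (cl : ℕ → ℕ) : ℕ :=
  ∑ v ∈ Finset.Icc 1 E.n, if cl v = 0 then 0 else E.deg v + 1

theorem weight_le (cl : ℕ → ℕ) : weight E cl ≤ E.n + E.off (E.n + 1) := by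
  have : weight E cl ≤ ∑ v ∈ Finset.Icc 1 E.n, (E.deg v + 1) :=
    Finset.sum_le_sum fun v _ => by split_ifs <;> omega
  rw [Finset.sum_add_distrib, sum_deg] at this
  simp at this
  omega

/-- Marking `K` raises the potential at least by the degrees in `K` plus one per vertex. The total
potential is bounded by `weight_le`, so all steps paid in this way are linear altogether. -/
theorem weight_add_le {cl cl' : ℕ → ℕ} (K : Finset ℕ) (hK : ∀ v ∈ K, E.V v) (h0 : ∀ v ∈ K, cl v = 0)
    (h1 : ∀ v ∈ K, cl' v ≠ 0) (h : ∀ v, cl v ≠ 0 → cl' v ≠ 0) :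
    weight E cl + ∑ v ∈ K, (E.deg v + 1) ≤ weight E cl' := by
  have : ∑ v ∈ K, (E.deg v + 1) = ∑ v ∈ Finset.Icc 1 E.n, if v ∈ K then E.deg v + 1 else 0 := by
    rw [← Finset.sum_filter]
    refine Finset.sum_congr ?_ fun _ _ => rfl
    ext v
    simp only [Finset.mem_filter, Finset.mem_Icc]
    exact ⟨fun hv => ⟨hK v hv, hv⟩, And.right⟩
  rw [this, weight, weight, ← Finset.sum_add_distrib]
  refine Finset.sum_le_sum fun v _ => ?_
  by_cases hv : v ∈ K
  · simp [hv, h0 v hv, h1 v hv]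
  · by_cases hv' : cl v = 0
    · simp [hv, hv']
    · simp [hv, hv', h v hv']

/-- In a good partition the class of `u` consists of `u` and its neighbours other than `o`. None of
these can be marked already, because marked classes agree with the classes of `P` and `u` is
unmarked. The time up to success is paid by the degrees of the newly marked vertices; a failure
happens only once and is bounded by the sum of all degrees. -/
theorem runs_isSimp1Simp {u : ℕ} (hI : Inv E s) (hu : s.reg .u = u) (hV : E.V u)
    (hd : 2 < E.deg u) (hcu : s.arr .clique u = 0)
    (hR : ¬ E.Yes → ∀ t', t' ≤ t + 4000 + 4000 * E.deg u + 4000 * E.off (E.n + 1) → R t')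
    (hN : ∀ s' t', Agree isSimp1Simp s s' → Inv E s' → s'.arr .clique u ≠ 0 →
      (∀ x, s.arr .clique x ≠ 0 → s'.arr .clique x ≠ 0) →
      t' + 4000 * weight E (s.arr .clique) ≤ t + 4000 * weight E (s'.arr .clique) → N s' t') :
    Runs isSimp1Simp N R s t := by
  refine Runs.spec (N := fun s' t' => Inv E s' ∧ s'.arr .clique u ≠ 0 ∧
      (∀ x, s.arr .clique x ≠ 0 → s'.arr .clique x ≠ 0) ∧
      t' + 4000 * weight E (s.arr .clique) ≤ t + 4000 * weight E (s'.arr .clique)) ?_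
    fun s' t' h h' => hN s' t' h h'.1 h'.2.1 h'.2.2.1 h'.2.2.2
  change Runs (.seq findOutsider (.seq checkClique (.seq newClique (.seq (mark .u) markClique))))
    _ _ _ _
  set cl := s.arr .clique with hcl
  set c := s.reg .cliques + 1 with hc
  have hclc : ∀ x, cl x < c := fun x => Nat.lt_succ_of_le (hI.marked.class_le x)
  rw [runs_seq]
  refine runs_findOutsider hI.base (hu ▸ hV) (hu ▸ hd) fun s₁ t₁ hag₁ hB₁ ho₁ ho₁' hy₁ hP₁ ht₁ => ?_
  rw [hu] at ho₁ ho₁' hy₁ hP₁ ht₁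
  set o := s₁.reg .o with ho
  have hdS := degSum_le hV o
  have hO : ∀ P, Good E P → IsOut E P u o := fun P hP => hP₁ P hP (hI.outs P hP u hV)
  set U := ∀ x, InK E u o x → cl x = 0 with hU
  have hY : ∀ P, Good E P → U ∧ IsOut E P u o := by
    refine fun P hP => ⟨fun x hx => ?_, hO P hP⟩
    by_contra hne
    have := (hI.classes P hP x u (A.right hx.1) hV hne).2 ((hO P hP).class_eq hx).symm
    exact hne (this.symm.trans hcu)
  have u1 : s₁.reg .u = u := (hag₁.reg _ (by decide)).trans hu
  have c1 : s₁.arr .current = s.arr .current := hag₁.arr _ (by decide)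
  -- Under `U` the pointers of the tested vertices are still at the beginning of their lists, so
  -- nothing has been passed over.
  have hC₁ : Chk E u o U (fun _ _ => False) s₁ := by
    refine ⟨?_, ?_, fun _ _ _ _ _ _ h => h.elim, fun hUU z i hz hi hi' => ?_, fun P hP x hx hne => ?_⟩
    · rw [c1]; exact hI.le
    · rw [c1]; exact hI.le_succ
    · rw [c1, hI.current z (A.right hz.1) (hUU z hz)] at hi'
      omega
    · by_cases hxu : x = u
      · rw [hxu, ho₁] at hne ⊢
        have := (hO P hP).2 hne
        exact ⟨this, ((hO P hP).1 o this).2 rfl⟩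
      · by_cases hxo : x = o
        · have h0 : o ≠ 0 := by
            rintro h0
            have := hx.1
            omega
          rw [hxo, ho₁' h0]
          have := (hO P hP).2 h0
          exact ⟨E.symm this, (((hO P hP).1 o this).2 rfl).symm⟩
        · rw [hy₁ x hxu hxo] at hne ⊢
          exact hI.outs P hP x hx hne
  rw [runs_seq]
  refine runs_checkClique hB₁ u1 hV ho.symm hC₁ hY (fun h t' ht' => hR h t' (by omega))
    fun s₂ t₂ hag₂ hB₂ hC₂ hcur₂ ht₂ => ?_
  have u2 : s₂.reg .u = u := (hag₂.reg _ (by decide)).trans u1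
  have m2 : Marked E s₂ := by
    refine hI.marked.of_eq ?_ ?_ ?_ ?_ ?_
    · exact (hag₂.reg _ (by decide)).trans (hag₁.reg _ (by decide))
    · exact (hag₂.reg _ (by decide)).trans (hag₁.reg _ (by decide))
    · exact (hag₂.arr _ (by decide)).trans (hag₁.arr _ (by decide))
    · exact (hag₂.arr _ (by decide)).trans (hag₁.arr _ (by decide))
    · exact (hag₂.arr _ (by decide)).trans (hag₁.arr _ (by decide))
  have cl2 : s₂.arr .clique = cl := (hag₂.arr _ (by decide)).trans (hag₁.arr _ (by decide))
  have cc2 : s₂.reg .cliques = s.reg .cliques :=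
    (hag₂.reg _ (by decide)).trans (hag₁.reg _ (by decide))
  have o2 : s₂.reg .o = o := hag₂.reg _ (by decide)
  rw [runs_seq, newClique, runs_set, runs_seq]
  refine runs_mark (v := u) (by simp [u2]) hV m2.newClique (by simp [cl2, hcu]) (by simp)
    fun s₃ hag₃ m3 cl3 => ?_
  have hB₃ : Base E s₃ := (hB₂.setReg _ _ (by simp)).agree hag₃ (by decide)
  have e3 : s₃.arr .current = s₂.arr .current := (hag₃.arr _ (by decide)).trans rfl
  have f3 : s₃.arr .outsider = s₂.arr .outsider := (hag₃.arr _ (by decide)).trans rfl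
  refine runs_markClique (cl := cl) (c := c) (U := U) hB₃
    ((hag₃.reg _ (by decide)).trans (by simp [u2])) hV
    ((hag₃.reg _ (by decide)).trans (by simp [o2])) Iff.rfl (hC₂.of_eq e3 f3) m3
    ((hag₃.reg _ (by decide)).trans (by simp [cc2, hc])) (by omega) ?_ hY ?_ ?_
  · intro x
    rw [cl3, Function.update_apply]
    simp [cl2, cc2, hc]
  · intro h t' ht'
    refine hR h t' ?_
    simp only [Exp.cost] at ht'
    omega
  · intro s₄ t₄ hag₄ hB₄ hC₄ m4 hUU hin hnin hend hcur₄ ht₄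
    have huK : ¬ InK E u o u := fun h => E.irrefl h.1
    classical
    have hcl4 : ∀ x, s₄.arr .clique x = if x = u ∨ InK E u o x then c else cl x := by
      intro x
      split_ifs with h
      · exact hin x h
      · exact hnin x h
    have hzero : ∀ x, x = u ∨ InK E u o x → cl x = 0 := by
      rintro x (h | h)
      · exact h ▸ hcu
      · exact hUU x h
    have hKV : ∀ x, x = u ∨ InK E u o x → E.V x := by
      rintro x (h | h)
      · exact h ▸ hV
      · exact A.right h.1
    have hadj : ∀ x y, (x = u ∨ InK E u o x) → (y = u ∨ InK E u o y) → x ≠ y → E.A x y := by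
      rintro x y (rfl | hx) (rfl | hy) hne
      · exact absurd rfl hne
      · exact hy.1
      · exact E.symm hx.1
      · obtain ⟨i, h1, h2, h3⟩ := hC₄.before trivial x y hx hy hne.symm trivial
        have hVx := A.right hx.1
        exact h3 ▸ A_adj hVx h1 (lt_of_lt_of_le h2 (hC₄.le_succ x hVx))
    have hout : ∀ x a b, (x = u ∨ InK E u o x) → E.A x a → E.A x b → ¬ (a = u ∨ InK E u o a) →
        ¬ (b = u ∨ InK E u o b) → a = b := by
      rintro x a b (rfl | hx) ha hb ha' hb'
      · have h1 : a = o := by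
          by_contra h
          exact ha' (Or.inr ⟨ha, h⟩)
        have h2 : b = o := by
          by_contra h
          exact hb' (Or.inr ⟨hb, h⟩)
        rw [h1, h2]
      · have key : ∀ a, E.A x a → ¬ (a = u ∨ InK E u o a) → a = s₄.arr .outsider x := by
          intro a ha ha'
          obtain ⟨i, h1, h2, rfl⟩ := A.exists_adj ha
          rcases hC₄.only trivial x i hx h1 (hend x hx ▸ h2) with h | h | h
          · exact absurd (Or.inl h) ha'
          · exact absurd (Or.inr h.1) ha'
          · exact h
        rw [key a ha ha', key b hb hb']
    have hcq : Cliques E (s₄.arr .clique) :=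
      hI.cliques.extend (fun x => x = u ∨ InK E u o x) c hclc hcl4 hzero hadj hout
    have hmono : ∀ x, cl x ≠ 0 → s₄.arr .clique x ≠ 0 := by
      intro x hx
      rw [hcl4]
      split_ifs
      · omega
      · exact hx
    have hKu : ∀ x, x ∈ insert u ((E.nbrs u).erase o) ↔ x = u ∨ InK E u o x := fun x => by
      rw [Finset.mem_insert, mem_erase_nbrs hV]
    have huK' : u ∉ (E.nbrs u).erase o := by
      rw [mem_erase_nbrs hV]
      exact huK
    -- The new clique has at least three vertices because the degree of `u` is at least three. So a
    -- vertex of degree two in it has no neighbour outside, and no chain is cut by the marking.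
    have hcard : 3 ≤ (insert u ((E.nbrs u).erase o)).card := by
      rw [Finset.card_insert_of_notMem huK']
      have h1 := Finset.pred_card_le_card_erase (s := E.nbrs u) (a := o)
      rw [card_nbrs hV] at h1
      omega
    refine ⟨⟨hB₄, m4, hcq, fun v w hA hv hdv hdw => ?_, hC₄.le, hC₄.le_succ, fun z hz hz0 => ?_,
      hC₄.outs, fun P hP v w hv hw hne => ?_⟩, ?_, hmono, ?_⟩
    · by_cases hvK : v = u ∨ InK E u o v
      · by_contra hw0
        have hwK : ¬ (w = u ∨ InK E u o w) := by
          intro h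
          rw [hcl4, if_pos h] at hw0
          omega
        -- An unmarked neighbour of `v` would be a third neighbour, besides at least two in the
        -- clique.
        have h1 := card_le_deg (A.left hA) (insert w ((insert u ((E.nbrs u).erase o)).erase v)) (by
          intro x hx
          rcases Finset.mem_insert.1 hx with h | h
          · exact h ▸ hA
          · have h' := Finset.mem_erase.1 h
            exact hadj v x hvK ((hKu x).1 h'.2) h'.1.symm)
        rw [Finset.card_insert_of_notMem (fun h => hwK ((hKu w).1 (Finset.mem_of_mem_erase h))),
          Finset.card_erase_of_mem ((hKu v).2 hvK)] at h1
        omega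
      · rw [hcl4, if_neg hvK] at hv
        exact hmono w (hI.closed v w hA hv hdv hdw)
    · have hzK : ¬ (z = u ∨ InK E u o z) := by
        intro h
        rw [hcl4, if_pos h] at hz0
        omega
      rw [hcl4, if_neg hzK] at hz0
      have hz' : ¬ InK E u o z := fun h => hzK (Or.inr h)
      rw [hcur₄ z hz', e3, hcur₂ z hz', c1]
      exact hI.current z hz hz0
    · have hPu : ∀ x, E.V x → ((x = u ∨ InK E u o x) ↔ P x = P u) := by
        refine fun x hx => ⟨?_, fun h => ?_⟩
        · rintro (h | h)
          · rw [h]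
          · exact (hO P hP).class_eq h
        · by_cases hxu : x = u
          · exact Or.inl hxu
          · exact Or.inr ((hO P hP).inK_of_class_eq hP hV hx hxu h)
      rw [hcl4] at hne
      rw [hcl4, hcl4]
      by_cases hvK : v = u ∨ InK E u o v
      · rw [if_pos hvK, (hPu v hv).1 hvK, ← hPu w hw]
        split_ifs with h
        · simp [h]
        · have := hclc w
          simp only [h, iff_false]
          omega
      · rw [if_neg hvK] at hne ⊢
        by_cases hwK : w = u ∨ InK E u o w
        · rw [if_pos hwK, (hPu w hw).1 hwK]
          have h1 := hclc v
          refine iff_of_false (by omega) fun h => ?_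
          have := (hI.classes P hP v u hv hV hne).2 h
          rw [← hcl, hcu] at this
          exact hne this.symm
        · rw [if_neg hwK]
          exact hI.classes P hP v w hv hw hne
    · rw [hin u (Or.inl rfl)]
      omega
    · have h1 := weight_add_le (E := E) (insert u ((E.nbrs u).erase o))
        (fun v hv => hKV v ((hKu v).1 hv)) (fun v hv => hzero v ((hKu v).1 hv))
        (cl' := s₄.arr .clique) (fun v hv => by
          rw [hin v ((hKu v).1 hv)]
          omega) hmono
      rw [Finset.sum_insert huK', Finset.sum_add_distrib] at h1
      change _ + (_ + (E.degSum u o + _)) ≤ _ at h1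
      simp only [Exp.cost] at ht₄
      omega

/-- The treatment of the vertices of degree at least `3`. -/
theorem runs_markLarge (hI : Inv E s)
    (hR : ¬ E.Yes → ∀ t', t' ≤ t + 10000 + 20000 * (E.n + E.off (E.n + 1)) → R t')
    (hN : ∀ s' t', Inv E s' → (∀ v, E.V v → 2 < E.deg v → s'.arr .clique v ≠ 0) →
      t' ≤ t + 10000 + 20000 * (E.n + E.off (E.n + 1)) → N s' t') :
    Runs (forVertices .u (Cmd.when (.and (.eq (.cell .clique Reg.u) (.lit 0))
      (.lt (.lit 2) (.cell .deg Reg.u))) isSimp1Simp)) N R s t := by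
  refine runs_forVertices (fun i s' t' => Inv E s' ∧
    (∀ v, E.V v → v < i → 2 < E.deg v → s'.arr .clique v ≠ 0) ∧
    t' ≤ t + 100 * i + 4000 * weight E (s'.arr .clique)) E.n (by decide) hI.base.n (by decide)
    ?_ ?_ ?_
  · refine ⟨?_, fun v hv hv1 => by have := hv.1; omega, by omega⟩
    exact ⟨hI.base.setReg _ _ (by simp), hI.marked.of_eq rfl rfl rfl rfl rfl, hI.cliques, hI.closed,
      hI.le, hI.le_succ, hI.current, hI.outs, hI.classes⟩
  · rintro i s₁ t₁ hag h1 h2 hri ⟨hI₁, hm, ht⟩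
    have hset : ∀ s, Inv E s → Inv E (s.setReg .u (i + 1)) := fun s hI =>
      ⟨hI.base.setReg _ _ (by simp), hI.marked.of_eq rfl rfl rfl rfl rfl, hI.cliques, hI.closed,
        hI.le, hI.le_succ, hI.current, hI.outs, hI.classes⟩
    have hw := weight_le (E := E) (s₁.arr .clique)
    have hdeg := deg_le (E := E) (v := i) ⟨h1, h2⟩
    refine runs_when.2 ⟨fun hcond => ?_, fun hcond => ?_⟩
    · have hcond' : s₁.arr .clique i = 0 ∧ 2 < E.deg i := by simpa [hri, hI₁.base.deg] using hcond
      refine runs_isSimp1Simp hI₁ hri ⟨h1, h2⟩ hcond'.2 hcond'.1 (fun h t' ht' => hR h t' ?_) ?_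
      · simp only [Test.cost, Exp.cost] at ht'
        omega
      · intro s₂ t₂ _ hI₂ hi hmono ht₂
        refine ⟨hset _ hI₂, fun v hv hv1 hv2 => ?_, ?_⟩
        · by_cases hvi : v = i
          · exact hvi ▸ hi
          · exact hmono v (hm v hv (by omega) hv2)
        · simp only [Test.cost, Exp.cost, State.setReg_arr] at ht₂ ⊢
          omega
    · have hcond' : ¬ (s₁.arr .clique i = 0 ∧ 2 < E.deg i) := by
        simpa [hri, hI₁.base.deg] using hcond
      refine ⟨hset _ hI₁, fun v hv hv1 hv2 => ?_, ?_⟩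
      · by_cases hvi : v = i
        · subst hvi
          exact fun h0 => hcond' ⟨h0, hv2⟩
        · exact hm v hv (by omega) hv2
      · simp only [Test.cost, Exp.cost, State.setReg_arr] at ht ⊢
        omega
  · rintro s₁ t₁ hag ⟨hI₁, hm, ht⟩
    have hw := weight_le (E := E) (s₁.arr .clique)
    refine hN s₁ _ hI₁ (fun v hv hv' => hm v hv (Nat.lt_succ_of_le hv.2) hv') (by omega)

/-! ## Walking along a chain -/

/-- The neighbour of `a` different from `b`, or `0`. -/
def Net.oth (E : Net) (a b : ℕ) : ℕ :=
  if E.deg a = 0 then 0 else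
    if E.adj (E.off a) = b then (if E.deg a = 2 then E.adj (E.off a + 1) else 0)
    else E.adj (E.off a)

theorem State.setReg_setReg (s : State) (r : Reg) (x y : ℕ) :
    (s.setReg r x).setReg r y = s.setReg r y := by
  simp [State.setReg]

theorem runs_otherNeighbor {r a b : Reg} (hs : Base E s) (hra : a ≠ r) (hrb : b ≠ r)
    (hN : ∀ t', t' ≤ t + 40 → N (s.setReg r (E.oth (s.reg a) (s.reg b))) t') :
    Runs (otherNeighbor r a b) N R s t := by
  rw [otherNeighbor, runs_ite]
  simp only [Test.eval, Exp.eval, hs.deg, Net.oth] at hN ⊢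
  refine ⟨fun h => ?_, fun h => ?_⟩
  · rw [runs_set]
    simp only [h, if_true] at hN
    exact hN _ (by simp only [Test.cost, Exp.cost]; omega)
  · rw [runs_seq, runs_set, runs_when]
    simp only [h, if_false, Exp.eval, Test.eval, State.setReg_reg, if_true, hrb, hs.off, hs.adj] at hN ⊢
    refine ⟨fun h1 => ?_, fun h1 => ?_⟩
    · rw [runs_ite]
      simp only [h1, if_true] at hN
      simp only [Exp.eval, Test.eval, State.setReg_reg, State.setReg_arr, hs.deg, hra, if_false]
      refine ⟨fun h2 => ?_, fun h2 => ?_⟩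
      · rw [runs_set, State.setReg_setReg]
        simp only [h2, if_true] at hN
        simp only [Exp.eval, State.setReg_reg, State.setReg_arr, hs.off, hs.adj, hra, if_false]
        exact hN _ (by simp only [Test.cost, Exp.cost]; omega)
      · rw [runs_set, State.setReg_setReg]
        simp only [h2, if_false] at hN
        exact hN _ (by simp only [Test.cost, Exp.cost]; omega)
    · simp only [h1, if_false] at hN
      exact hN _ (by simp only [Test.cost, Exp.cost]; omega)

/-! ### The other neighbour of a vertex of degree at most two -/

section Oth

variable {a b c x : ℕ}

theorem A_iff_of_deg_le_two (ha : E.V a) (hd : E.deg a ≤ 2) :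
    E.A a x ↔ (E.deg a ≠ 0 ∧ E.adj (E.off a) = x) ∨ (E.deg a = 2 ∧ E.adj (E.off a + 1) = x) := by
  have hoff := E.off_succ ha.1 ha.2
  rw [E.mem ha.1 ha.2]
  constructor
  · rintro ⟨i, h1, h2, h3⟩
    by_cases hi : i = E.off a
    · exact Or.inl ⟨by omega, hi ▸ h3⟩
    · have : i = E.off a + 1 := by omega
      exact Or.inr ⟨by omega, this ▸ h3⟩
  · rintro (⟨h1, h2⟩ | ⟨h1, h2⟩)
    · exact ⟨_, le_rfl, by omega, h2⟩
    · exact ⟨_, by omega, by omega, h2⟩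

theorem adj_oth (ha : E.V a) (hd : E.deg a ≤ 2) (h : E.oth a b ≠ 0) :
    E.A a (E.oth a b) ∧ E.oth a b ≠ b := by
  have hoff := E.off_succ ha.1 ha.2
  unfold Net.oth at h ⊢
  split_ifs at h ⊢ with h0 h1 h2
  · exact absurd rfl h
  · refine ⟨(A_iff_of_deg_le_two ha hd).2 (Or.inr ⟨h2, rfl⟩), ?_⟩
    rw [← h1]
    exact (E.mono ha.1 ha.2 le_rfl (Nat.lt_succ_self _) (by omega)).ne'
  · exact absurd rfl h
  · exact ⟨(A_iff_of_deg_le_two ha hd).2 (Or.inl ⟨h0, rfl⟩), h1⟩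

theorem oth_ne_zero (ha : E.V a) (hd : E.deg a = 2) : E.oth a b ≠ 0 := by
  have hoff := E.off_succ ha.1 ha.2
  have h1 := A.pos (A_adj ha (i := E.off a) (by omega) (by omega))
  have h2 := A.pos (A_adj ha (i := E.off a + 1) (by omega) (by omega))
  unfold Net.oth
  split_ifs
  · omega
  · exact h2
  · exact h1

theorem oth_eq (hb : E.A a b) (hc : E.A a c) (hne : b ≠ c) (hd : E.deg a ≤ 2) : E.oth a b = c := by
  have ha := A.left hb
  have h1 := (A_iff_of_deg_le_two ha hd).1 hb
  have h2 := (A_iff_of_deg_le_two ha hd).1 hc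
  unfold Net.oth
  split_ifs with h3 h4 h5
  · omega
  · omega
  · omega
  · omega

theorem oth_eq_zero (hb : E.A a b) (hd : E.deg a ≤ 1) : E.oth a b = 0 := by
  have h1 := (A_iff_of_deg_le_two (A.left hb) (by omega)).1 hb
  unfold Net.oth
  split_ifs <;> omega

theorem oth_zero (hb : E.A a b) (hd : E.deg a ≤ 1) : E.oth a 0 = b := by
  have h1 := (A_iff_of_deg_le_two (A.left hb) (by omega)).1 hb
  have h2 := A.pos hb
  unfold Net.oth
  split_ifs <;> omega

theorem eq_or_eq_oth (hb : E.A a b) (hx : E.A a x) (hd : E.deg a ≤ 2) : x = b ∨ x = E.oth a b := by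
  by_cases h : x = b
  · exact Or.inl h
  · exact Or.inr (oth_eq hb hx (Ne.symm h) hd).symm

theorem eq_or_eq_of_deg (hb : E.A a b) (hc : E.A a c) (hne : b ≠ c) (hd : E.deg a ≤ 2)
    (hx : E.A a x) : x = b ∨ x = c :=
  oth_eq hb hc hne hd ▸ eq_or_eq_oth hb hx hd

theorem deg_eq_two_of (hb : E.A a b) (hc : E.A a c) (hne : b ≠ c) (hd : E.deg a ≤ 2) :
    E.deg a = 2 := by
  have := card_le_deg (A.left hb) {b, c} (by simp [hb, hc])
  rw [Finset.card_pair hne] at this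
  omega

end Oth

/-- The walk from `u` through its neighbour `w`. -/
def Net.walk (E : Net) (u w : ℕ) : ℕ → ℕ
  | 0 => u
  | 1 => w
  | k + 2 => E.oth (E.walk u w (k + 1)) (E.walk u w k)

/-- The first `k` vertices after `u` on the walk have degree `2` and differ from `u`. -/
structure Thru (E : Net) (u w k : ℕ) : Prop where
  adj : E.A u w
  deg_le : E.deg u ≤ 2
  deg : ∀ i, 1 ≤ i → i ≤ k → E.deg (E.walk u w i) = 2
  ne : ∀ i, 1 ≤ i → i ≤ k → E.walk u w i ≠ u

/-! ### Walks through vertices of degree two -/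

namespace Thru

variable {u w k : ℕ}

theorem adj_walk (h : Thru E u w k) : ∀ i, i ≤ k → E.A (E.walk u w i) (E.walk u w (i + 1)) := by
  intro i
  induction i with
  | zero => exact fun _ => h.adj
  | succ i ih =>
    intro hi
    have hd := h.deg (i + 1) (by omega) hi
    have hV := A.right (ih (by omega))
    exact (adj_oth hV hd.le (oth_ne_zero hV hd)).1

theorem V (h : Thru E u w k) {i : ℕ} (hi : i ≤ k + 1) : E.V (E.walk u w i) := by
  cases i with
  | zero => exact A.left h.adj
  | succ i => exact A.right (h.adj_walk i (by omega))

theorem walk_ne (h : Thru E u w k) {i : ℕ} (hi : i < k) : E.walk u w (i + 2) ≠ E.walk u w i := by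
  have hd := h.deg (i + 1) (by omega) hi
  have hV := h.V (i := i + 1) (by omega)
  exact (adj_oth hV hd.le (oth_ne_zero hV hd)).2

theorem nbr (h : Thru E u w k) {i x : ℕ} (hi : i < k) (hx : E.A (E.walk u w (i + 1)) x) :
    x = E.walk u w i ∨ x = E.walk u w (i + 2) :=
  eq_or_eq_oth (E.symm (h.adj_walk i (by omega))) hx (h.deg (i + 1) (by omega) hi).le

theorem deg_le_two (h : Thru E u w k) {i : ℕ} (hi : i ≤ k) : E.deg (E.walk u w i) ≤ 2 := by
  cases i with
  | zero => exact h.deg_le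
  | succ i => exact (h.deg (i + 1) (by omega) hi).le

/-- A walk that never turns back inside vertices of degree two can repeat no vertex except its
start. In a repetition, the predecessor of the later occurrence is a neighbour of the earlier one,
hence its predecessor or successor on the walk. This produces an earlier repetition, or the walk
would turn back or have a loop. -/
theorem eq_zero_of_eq (h : Thru E u w k) : ∀ j i, i < j → j ≤ k + 1 →
    E.walk u w i = E.walk u w j → i = 0 := by
  intro j
  induction j using Nat.strong_induction_on with
  | _ j ih =>
    intro i hij hj heq
    by_contra hi0
    obtain ⟨i, rfl⟩ : ∃ i', i = i' + 1 := ⟨i - 1, by omega⟩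
    obtain ⟨j, rfl⟩ : ∃ j', j = j' + 1 := ⟨j - 1, by omega⟩
    have hA : E.A (E.walk u w (i + 1)) (E.walk u w j) := by
      rw [heq]
      exact E.symm (h.adj_walk j (by omega))
    rcases h.nbr (i := i) (by omega) hA with h1 | h1
    · have := ih j (by omega) i (by omega) (by omega) h1.symm
      subst this
      exact h.ne j (by omega) (by omega) h1
    · rcases lt_trichotomy (i + 2) j with h2 | h2 | h2
      · have := ih j (by omega) (i + 2) h2 (by omega) h1.symm
        omega
      · subst h2
        exact h.walk_ne (i := i + 1) (by omega) heq.symm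
      · have : j = i + 1 := by omega
        subst this
        exact A.ne (h.adj_walk (i + 1) (by omega)) heq

theorem inj (h : Thru E u w k) {i j : ℕ} (hi : i ≤ k) (hj : j ≤ k)
    (heq : E.walk u w i = E.walk u w j) : i = j := by
  rcases lt_trichotomy i j with h1 | h1 | h1
  · have := h.eq_zero_of_eq j i h1 (by omega) heq
    subst this
    exact absurd heq.symm (h.ne j (by omega) hj)
  · exact h1
  · have := h.eq_zero_of_eq i j h1 (by omega) heq.symm
    subst this
    exact absurd heq (h.ne i (by omega) hi)

/-- The vertices of the walk are distinct; this is why the traversal terminates. -/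
theorem lt_n (h : Thru E u w k) : k < E.n := by
  have h1 : ((Finset.range (k + 1)).image (E.walk u w)).card = k + 1 := by
    rw [Finset.card_image_of_injOn, Finset.card_range]
    intro i hi j hj heq
    simp only [Finset.coe_range, Set.mem_Iio] at hi hj
    exact h.inj (by omega) (by omega) heq
  have h2 : ((Finset.range (k + 1)).image (E.walk u w)).card ≤ (Finset.Icc 1 E.n).card := by
    refine Finset.card_le_card fun x hx => ?_
    obtain ⟨i, hi, rfl⟩ := Finset.mem_image.1 hx
    exact Finset.mem_Icc.2 (h.V (by have := Finset.mem_range.1 hi; omega))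
  rw [Nat.card_Icc] at h2
  omega

/-- Marks spread along vertices of degree at most two by `hcl`, so a mark anywhere on the walk would
lead back to a mark on `u`. -/
theorem unmarked (h : Thru E u w k) {cl : ℕ → ℕ} (hcu : cl u = 0)
    (hcl : ∀ v w, E.A v w → cl v ≠ 0 → E.deg v ≤ 2 → E.deg w ≤ 2 → cl w ≠ 0) {i : ℕ} (hi : i ≤ k) :
    cl (E.walk u w i) = 0 := by
  induction i with
  | zero => exact hcu
  | succ i ih =>
    by_contra hne
    exact hcl _ _ (E.symm (h.adj_walk i (by omega))) hne (h.deg_le_two hi)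
      (h.deg_le_two (by omega)) (ih (by omega))

theorem two_le_of_closed (h : Thru E u w k) (hcl : E.walk u w (k + 1) = u) : 2 ≤ k := by
  have h1 := A.ne h.adj
  by_contra hlt
  interval_cases k
  · exact h1 hcl.symm
  · exact h.walk_ne (i := 0) (by omega) hcl

theorem adj_last (h : Thru E u w k) (hcl : E.walk u w (k + 1) = u) :
    E.A u (E.walk u w k) ∧ w ≠ E.walk u w k := by
  have hk := h.two_le_of_closed hcl
  have hA := E.symm (h.adj_walk k le_rfl)
  rw [hcl] at hA
  refine ⟨hA, fun heq => ?_⟩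
  have := h.inj (i := 1) (j := k) (by omega) le_rfl heq
  omega

theorem closed_nbr (h : Thru E u w k) (hcl : E.walk u w (k + 1) = u) {i x : ℕ} (hi : i ≤ k)
    (hx : E.A (E.walk u w i) x) : ∃ j, j ≤ k ∧ E.walk u w j = x := by
  have hk := h.two_le_of_closed hcl
  cases i with
  | zero =>
    obtain ⟨hk1, hne⟩ := h.adj_last hcl
    rcases eq_or_eq_of_deg h.adj hk1 hne h.deg_le hx with h1 | h1
    · exact ⟨1, by omega, h1.symm⟩
    · exact ⟨k, le_rfl, h1.symm⟩
  | succ i =>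
    rcases h.nbr (by omega) hx with h1 | h1
    · exact ⟨i, by omega, h1.symm⟩
    · by_cases hi : i + 2 ≤ k
      · exact ⟨i + 2, hi, h1.symm⟩
      · have : i + 2 = k + 1 := by omega
        rw [this, hcl] at h1
        exact ⟨0, by omega, h1.symm⟩

/-- If one direction is closed, then so is the other one. -/
theorem deg_eq_two_of_closed {w' k' : ℕ} (h : Thru E u w k) (h' : Thru E u w' k')
    (hcl : E.walk u w (k + 1) = u) : E.deg (E.walk u w' (k' + 1)) = 2 := by
  have hdu : E.deg u = 2 := by
    obtain ⟨hk1, hne⟩ := h.adj_last hcl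
    exact deg_eq_two_of h.adj hk1 hne h.deg_le
  have key : ∀ i, i ≤ k' + 1 → ∃ j, j ≤ k ∧ E.walk u w j = E.walk u w' i := by
    intro i
    induction i with
    | zero => exact fun _ => ⟨0, by omega, rfl⟩
    | succ i ih =>
      intro hi
      obtain ⟨j, hj, heq⟩ := ih (by omega)
      exact h.closed_nbr hcl hj (heq ▸ h'.adj_walk i (by omega))
  obtain ⟨j, hj, heq⟩ := key (k' + 1) le_rfl
  rw [← heq]
  cases j with
  | zero => exact hdu
  | succ j => exact h.deg (j + 1) (by omega) hj

end Thru

/-- The vertices that follow the vertex `u` in one direction on its chain are `d 1, …, d K`. -/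
structure Dir (E : Net) (u : ℕ) (d : ℕ → ℕ) (K : ℕ) : Prop where
  zero : d 0 = u
  V : ∀ i, i ≤ K → E.V (d i)
  deg : ∀ i, i ≤ K → E.deg (d i) ≤ 2
  fwd : ∀ i, i < K → E.oth (d (i + 1)) (d i) = d (i + 2)
  bwd : ∀ i, i < K → E.oth (d (i + 1)) (d (i + 2)) = d i
  adj : ∀ i, i < K → E.A (d i) (d (i + 1))
  nbr : ∀ i, i < K → ∀ x, E.A (d (i + 1)) x → x = d i ∨ x = d (i + 2)
  inj : ∀ i j, i ≤ K → j ≤ K → d i = d j → i = j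
  last : d (K + 1) = 0 ∨ 2 < E.deg (d (K + 1))

namespace Dir

variable {u w k : ℕ}

theorem of_large (h : Thru E u w k) (hd : 2 < E.deg (E.walk u w (k + 1))) :
    Dir E u (E.walk u w) k where
  zero := rfl
  V i hi := h.V (by omega)
  deg i hi := h.deg_le_two hi
  fwd i hi := rfl
  bwd i hi := oth_eq (h.adj_walk (i + 1) (by omega)) (E.symm (h.adj_walk i (by omega)))
    (h.walk_ne hi) (h.deg_le_two (by omega))
  adj i hi := h.adj_walk i (by omega)
  nbr i hi x hx := h.nbr hi hx
  inj i j hi hj heq := h.inj hi hj heq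
  last := Or.inr hd

theorem of_leaf (h : Thru E u w k) (hd : E.deg (E.walk u w (k + 1)) = 1)
    (hne : E.walk u w (k + 1) ≠ u) : Dir E u (E.walk u w) (k + 1) := by
  have hA := E.symm (h.adj_walk k le_rfl)
  have hz : E.walk u w (k + 2) = 0 := oth_eq_zero hA hd.le
  have hlast : ∀ i, i ≤ k → E.walk u w i ≠ E.walk u w (k + 1) := by
    intro i hi heq
    have := h.eq_zero_of_eq (k + 1) i (by omega) le_rfl heq
    subst this
    exact hne heq.symm
  refine ⟨rfl, fun i hi => h.V hi, fun i hi => ?_, fun i hi => rfl, fun i hi => ?_,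
    fun i hi => h.adj_walk i (by omega), fun i hi x hx => ?_, fun i j hi hj heq => ?_, Or.inl hz⟩
  · by_cases hi' : i = k + 1
    · rw [hi']
      omega
    · exact h.deg_le_two (by omega)
  · by_cases hi' : i = k
    · subst hi'
      rw [hz]
      exact oth_zero hA hd.le
    · exact oth_eq (h.adj_walk (i + 1) (by omega)) (E.symm (h.adj_walk i (by omega)))
        (h.walk_ne (by omega)) (h.deg_le_two (by omega))
  · exact eq_or_eq_oth (E.symm (h.adj_walk i (by omega))) hx (by
      by_cases hi' : i = k
      · rw [hi']
        omega
      · exact h.deg_le_two (by omega))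
  · by_cases hi' : i = k + 1
    · by_cases hj' : j = k + 1
      · omega
      · rw [hi'] at heq
        exact absurd heq.symm (hlast j (by omega))
    · by_cases hj' : j = k + 1
      · rw [hj'] at heq
        exact absurd heq (hlast i (by omega))
      · exact h.inj (by omega) (by omega) heq

/-- The missing direction of a vertex that is itself an end of its chain: it has no vertices and is
followed by null. With it, a chain always consists of two directions. -/
theorem trivial (hu : E.V u) (hd : E.deg u ≤ 2) : Dir E u (fun i => if i = 0 then u else 0) 0 where
  zero := rfl
  V i hi := by simpa [Nat.le_zero.1 hi] using hu
  deg i hi := by simpa [Nat.le_zero.1 hi] using hd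
  fwd i hi := by omega
  bwd i hi := by omega
  adj i hi := by omega
  nbr i hi := by omega
  inj i j hi hj _ := by omega
  last := Or.inl rfl

/-- Two different directions do not meet. -/
theorem disjoint {d₁ d₂ : ℕ → ℕ} {K₁ K₂ : ℕ} (h₁ : Dir E u d₁ K₁) (h₂ : Dir E u d₂ K₂)
    (h : E.oth u (d₁ 1) = d₂ 1) : ∀ i j, 1 ≤ i → i ≤ K₁ → 1 ≤ j → j ≤ K₂ → d₁ i ≠ d₂ j := by
  -- A vertex on the first direction is not the vertex after the end of the second one.
  have hend : ∀ i, i ≤ K₁ → d₁ i ≠ d₂ (K₂ + 1) := by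
    intro i hi heq
    have h1 := h₁.deg i hi
    have h2 := (h₁.V i hi).1
    rcases h₂.last with h3 | h3
    · omega
    · rw [← heq] at h3
      omega
  intro i
  induction i with
  | zero => intro j h1; omega
  | succ i ih =>
    -- At a common vertex, its predecessor on the first direction is one of its two neighbours on
    -- the second. So the meeting point moves back along the first direction until it reaches `u`;
    -- there both directions would begin with the same neighbour.
    rintro j - hi hj hj' heq
    obtain ⟨j, rfl⟩ : ∃ j', j = j' + 1 := ⟨j - 1, by omega⟩
    have hA : E.A (d₂ (j + 1)) (d₁ i) := heq ▸ E.symm (h₁.adj i (by omega))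
    rcases h₂.nbr j (by omega) _ hA with h3 | h3
    · by_cases hj0 : j = 0
      · subst hj0
        rw [h₂.zero, ← h₁.zero] at h3
        have := h₁.inj i 0 (by omega) (by omega) h3
        subst this
        rw [← heq] at h
        have hV := h₁.V 0 (by omega)
        have hd := h₁.deg 0 (by omega)
        rw [h₁.zero] at hV hd
        have hpos := (h₁.V 1 hi).1
        exact (adj_oth hV hd (b := d₁ 1) (by rw [h]; exact (by omega : d₁ 1 ≠ 0))).2 h
      · by_cases hi0 : i = 0
        · subst hi0
          rw [h₁.zero, ← h₂.zero] at h3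
          have := h₂.inj 0 j (by omega) (by omega) h3
          omega
        · exact ih j (by omega) (by omega) (by omega) (by omega) h3
    · by_cases hj2 : j + 2 ≤ K₂
      · by_cases hi0 : i = 0
        · subst hi0
          rw [h₁.zero, ← h₂.zero] at h3
          have := h₂.inj 0 (j + 2) (by omega) (by omega) h3
          omega
        · exact ih (j + 2) (by omega) (by omega) (by omega) hj2 h3
      · have : j + 2 = K₂ + 1 := by omega
        rw [this] at h3
        exact hend i (by omega) h3

end Dir

/-- The vertices `a 1, …, a q` form a chain that can be traversed starting with `a 0, a 1`. -/
structure Chain (E : Net) (a : ℕ → ℕ) (q : ℕ) : Prop where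
  V : ∀ i, 1 ≤ i → i ≤ q → E.V (a i)
  deg : ∀ i, 1 ≤ i → i ≤ q → E.deg (a i) ≤ 2
  inj : ∀ i j, 1 ≤ i → i ≤ q → 1 ≤ j → j ≤ q → a i = a j → i = j
  fwd : ∀ i, i < q → E.oth (a (i + 1)) (a i) = a (i + 2)
  nbr : ∀ i x, 1 ≤ i → i ≤ q → E.A (a i) x → (∃ j, 1 ≤ j ∧ j ≤ q ∧ a j = x) ∨ 2 < E.deg x
  last : a (q + 1) = 0 ∨ 2 < E.deg (a (q + 1)) ∨ a (q + 1) = a 1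

namespace Chain

variable {u w k : ℕ}

/-- A chain that is a cycle. -/
theorem of_closed (h : Thru E u w k) (hcl : E.walk u w (k + 1) = u) (h0 : E.oth u 0 = w) :
    Chain E (fun i => if i = 0 then 0 else E.walk u w (i - 1)) (k + 1) := by
  refine ⟨fun i h1 h2 => ?_, fun i h1 h2 => ?_, fun i j h1 h2 h3 h4 heq => ?_, fun i hi => ?_,
    fun i x h1 h2 hx => Or.inl ?_, Or.inr (Or.inr ?_)⟩
  · simpa [show i ≠ 0 by omega] using h.V (i := i - 1) (by omega)
  · simpa [show i ≠ 0 by omega] using h.deg_le_two (i := i - 1) (by omega)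
  · simp only [show i ≠ 0 by omega, show j ≠ 0 by omega, if_false] at heq
    have := h.inj (i := i - 1) (j := j - 1) (by omega) (by omega) heq
    omega
  · cases i with
    | zero => simpa [Net.walk] using h0
    | succ i => simp [Net.walk]
  · simp only [show i ≠ 0 by omega, if_false] at hx
    obtain ⟨j, hj, rfl⟩ := h.closed_nbr hcl (by omega) hx
    exact ⟨j + 1, by omega, by omega, by simp⟩
  · simpa [Net.walk] using hcl

/-- Two directions from `u` together form a chain. -/
theorem of_dirs {d₁ d₂ : ℕ → ℕ} {K₁ K₂ : ℕ} (h₁ : Dir E u d₁ K₁) (h₂ : Dir E u d₂ K₂)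
    (h : E.oth u (d₁ 1) = d₂ 1) (hu : ∀ x, E.A u x → x = d₁ 1 ∨ x = d₂ 1) :
    Chain E (fun i => if i ≤ K₁ + 1 then d₁ (K₁ + 1 - i) else d₂ (i - K₁ - 1)) (K₁ + K₂ + 1) := by
  have hdis := h₁.disjoint h₂ h
  have hz : ∀ i, 1 ≤ i → i ≤ K₁ → d₁ i ≠ u := fun i hi hi' heq => by
    have := h₁.inj i 0 hi' (by omega) (heq.trans h₁.zero.symm)
    omega
  have hz' : ∀ i, 1 ≤ i → i ≤ K₂ → d₂ i ≠ u := fun i hi hi' heq => by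
    have := h₂.inj i 0 hi' (by omega) (heq.trans h₂.zero.symm)
    omega
  have e1 : ∀ i, i ≤ K₁ + 1 → (if i ≤ K₁ + 1 then d₁ (K₁ + 1 - i) else d₂ (i - K₁ - 1)) =
      d₁ (K₁ + 1 - i) := fun i hi => if_pos hi
  have e2 : ∀ i, K₁ + 1 ≤ i → (if i ≤ K₁ + 1 then d₁ (K₁ + 1 - i) else d₂ (i - K₁ - 1)) =
      d₂ (i - K₁ - 1) := by
    intro i hi
    split_ifs with h'
    · have : i = K₁ + 1 := by omega
      subst this
      simp [h₁.zero, h₂.zero]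
    · rfl
  have key : ∀ x, ((∃ i, i ≤ K₁ ∧ x = d₁ i) ∨ (∃ i, i ≤ K₂ ∧ x = d₂ i)) →
      ∃ j, 1 ≤ j ∧ j ≤ K₁ + K₂ + 1 ∧
        (if j ≤ K₁ + 1 then d₁ (K₁ + 1 - j) else d₂ (j - K₁ - 1)) = x := by
    rintro x (⟨i, hi, rfl⟩ | ⟨i, hi, rfl⟩)
    · exact ⟨K₁ + 1 - i, by omega, by omega, by rw [e1 _ (by omega)]; congr 1; omega⟩
    · exact ⟨K₁ + 1 + i, by omega, by omega, by rw [e2 _ (by omega)]; congr 1; omega⟩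
  have key1 : ∀ x i, E.A (d₁ 0) x ∨ E.A (d₂ 0) x → i = 0 →
      (∃ j, 1 ≤ j ∧ j ≤ K₁ + K₂ + 1 ∧
        (if j ≤ K₁ + 1 then d₁ (K₁ + 1 - j) else d₂ (j - K₁ - 1)) = x) ∨ 2 < E.deg x := by
    rintro x i hx -
    have hx' : E.A u x := by
      rcases hx with hx | hx
      · rwa [h₁.zero] at hx
      · rwa [h₂.zero] at hx
    have hpos := A.pos hx'
    rcases hu x hx' with h3 | h3
    · by_cases hK : 1 ≤ K₁
      · exact Or.inl (key x (Or.inl ⟨1, hK, h3⟩))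
      · have hK : K₁ = 0 := by omega
        have := h₁.last
        rw [hK, zero_add, ← h3] at this
        exact Or.inr (this.resolve_left hpos)
    · by_cases hK : 1 ≤ K₂
      · exact Or.inl (key x (Or.inr ⟨1, hK, h3⟩))
      · have hK : K₂ = 0 := by omega
        have := h₂.last
        rw [hK, zero_add, ← h3] at this
        exact Or.inr (this.resolve_left hpos)
  refine ⟨fun i h1 h2 => ?_, fun i h1 h2 => ?_, fun i j h1 h2 h3 h4 heq => ?_, fun i hi => ?_,
    fun i x h1 h2 hx => ?_, ?_⟩
  · by_cases hi : i ≤ K₁ + 1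
    · simpa only [e1 i hi] using h₁.V _ (by omega)
    · simpa only [e2 i (by omega)] using h₂.V _ (by omega)
  · by_cases hi : i ≤ K₁ + 1
    · simpa only [e1 i hi] using h₁.deg _ (by omega)
    · simpa only [e2 i (by omega)] using h₂.deg _ (by omega)
  · by_cases hi : i ≤ K₁
    · by_cases hj : j ≤ K₁
      · simp only [e1 i (by omega), e1 j (by omega)] at heq
        have := h₁.inj _ _ (by omega) (by omega) heq
        omega
      · simp only [e1 i (by omega), e2 j (by omega)] at heq
        by_cases hj' : j = K₁ + 1
        · subst hj'
          simp only [Nat.sub_self, Nat.add_sub_cancel_left, h₂.zero] at heq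
          exact absurd heq (hz _ (by omega) (by omega))
        · exact absurd heq (hdis _ _ (by omega) (by omega) (by omega) (by omega))
    · by_cases hj : j ≤ K₁
      · simp only [e2 i (by omega), e1 j (by omega)] at heq
        by_cases hi' : i = K₁ + 1
        · subst hi'
          simp only [Nat.sub_self, Nat.add_sub_cancel_left, h₂.zero] at heq
          exact absurd heq.symm (hz _ (by omega) (by omega))
        · exact absurd heq.symm (hdis _ _ (by omega) (by omega) (by omega) (by omega))
      · simp only [e2 i (by omega), e2 j (by omega)] at heq
        have := h₂.inj _ _ (by omega) (by omega) heq
        omega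
  -- The chain runs backwards through the first direction, passes `u` at index `K₁ + 1`, and then
  -- runs forwards through the second. The middle case is the step through `u`, given by `h`.
  · rcases lt_trichotomy i K₁ with hi' | hi' | hi'
    · simp only [e1 i (by omega), e1 (i + 1) (by omega), e1 (i + 2) (by omega)]
      have := h₁.bwd (K₁ - i - 1) (by omega)
      rwa [show K₁ - i - 1 + 1 = K₁ + 1 - (i + 1) by omega,
        show K₁ - i - 1 + 2 = K₁ + 1 - i by omega,
        show K₁ - i - 1 = K₁ + 1 - (i + 2) by omega] at this
    · simp only [e1 i (by omega), e1 (i + 1) (by omega), e2 (i + 2) (by omega)]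
      rw [show K₁ + 1 - (i + 1) = 0 by omega, show K₁ + 1 - i = 1 by omega,
        show i + 2 - K₁ - 1 = 1 by omega, h₁.zero, h]
    · simp only [e2 i (by omega), e2 (i + 1) (by omega), e2 (i + 2) (by omega)]
      have := h₂.fwd (i - K₁ - 1) (by omega)
      rwa [show i - K₁ - 1 + 1 = i + 1 - K₁ - 1 by omega,
        show i - K₁ - 1 + 2 = i + 2 - K₁ - 1 by omega] at this
  · rcases lt_trichotomy i (K₁ + 1) with hi' | hi' | hi'
    · simp only [e1 i (by omega)] at hx
      have hi2 : K₁ + 1 - i = (K₁ - i) + 1 := by omega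
      rw [hi2] at hx
      rcases h₁.nbr (K₁ - i) (by omega) x hx with h3 | h3
      · exact Or.inl (key x (Or.inl ⟨_, by omega, h3⟩))
      · by_cases hi3 : i = 1
        · subst hi3
          have := h₁.last
          rw [show K₁ - 1 + 2 = K₁ + 1 by omega] at h3
          rw [← h3] at this
          exact Or.inr (this.resolve_left (A.pos hx))
        · exact Or.inl (key x (Or.inl ⟨_, by omega, h3⟩))
    · subst hi'
      exact key1 x 0 (Or.inl (by simpa using hx)) rfl
    · simp only [e2 i (by omega)] at hx
      have hi2 : i - K₁ - 1 = (i - K₁ - 2) + 1 := by omega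
      rw [hi2] at hx
      rcases h₂.nbr (i - K₁ - 2) (by omega) x hx with h3 | h3
      · exact Or.inl (key x (Or.inr ⟨_, by omega, h3⟩))
      · by_cases hi3 : i = K₁ + K₂ + 1
        · subst hi3
          have := h₂.last
          rw [show K₁ + K₂ + 1 - K₁ - 2 + 2 = K₂ + 1 by omega] at h3
          rw [← h3] at this
          exact Or.inr (this.resolve_left (A.pos hx))
        · exact Or.inl (key x (Or.inr ⟨_, by omega, h3⟩))
  · simp only [e2 (K₁ + K₂ + 1 + 1) (by omega)]
    rw [show K₁ + K₂ + 1 + 1 - K₁ - 1 = K₂ + 1 by omega]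
    exact h₂.last.imp id Or.inl

end Chain

/-! ## Parities on chains -/

/-- The component of `u` is a triangle. -/
def Tri (E : Net) (u : ℕ) : Prop :=
  ∃ x y, E.A u x ∧ E.A u y ∧ E.A x y ∧ E.deg u ≤ 2 ∧ E.deg x ≤ 2 ∧ E.deg y ≤ 2

/-- Of the two neighbours of a vertex of degree `2`, exactly one belongs to its class, or the
component is a triangle. -/
theorem Good.same_or (hP : Good E P) {x y z : ℕ} (hx : E.A y x) (hz : E.A y z) (hne : x ≠ z) :
    ((P x = P y ↔ ¬ P y = P z) ∨ P x = P y ∧ P y = P z ∧ E.A x z) := by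
  by_cases h1 : P x = P y
  · by_cases h2 : P y = P z
    · exact Or.inr ⟨h1, h2, hP.adj_of_inside hx hz h1 h2.symm hne⟩
    · exact Or.inl (iff_of_true h1 h2)
  · by_cases h2 : P y = P z
    · exact Or.inl (iff_of_false h1 (not_not.2 h2))
    · exact absurd (hP.outside hx hz h1 (Ne.symm h2)) hne

/-- A set of three pairwise adjacent vertices of degree at most `2` is closed under adjacency. -/
theorem mem_triangle {x y z a b : ℕ} (h1 : E.A x y) (h2 : E.A x z) (h3 : E.A y z)
    (hx : E.deg x ≤ 2) (hy : E.deg y ≤ 2) (hz : E.deg z ≤ 2) (ha : a = x ∨ a = y ∨ a = z)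
    (hab : E.A a b) : b = x ∨ b = y ∨ b = z := by
  rcases ha with rfl | rfl | rfl
  · have := eq_or_eq_of_deg h1 h2 (A.ne h3) hx hab
    tauto
  · have := eq_or_eq_of_deg (E.symm h1) h3 (A.ne h2) hy hab
    tauto
  · have := eq_or_eq_of_deg (E.symm h2) (E.symm h3) (A.ne h1) hz hab
    tauto

namespace Thru

variable {u w k : ℕ}

theorem mem_tri (h : Thru E u w k) {x y : ℕ} (h1 : E.A u x) (h2 : E.A u y) (h3 : E.A x y)
    (hx : E.deg x ≤ 2) (hy : E.deg y ≤ 2) {i : ℕ} (hi : i ≤ k + 1) :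
    E.walk u w i = u ∨ E.walk u w i = x ∨ E.walk u w i = y := by
  induction i with
  | zero => exact Or.inl rfl
  | succ i ih =>
    exact mem_triangle h1 h2 h3 h.deg_le hx hy (ih (by omega)) (h.adj_walk i (by omega))

/-- A triangle of vertices of degree at most two is a whole component, so a walk from `u` that meets
it has been in it from the beginning. -/
theorem tri_of_mem (h : Thru E u w k) {x y z : ℕ} (h1 : E.A x y) (h2 : E.A x z) (h3 : E.A y z)
    (hx : E.deg x ≤ 2) (hy : E.deg y ≤ 2) (hz : E.deg z ≤ 2) {i : ℕ} (hi : i ≤ k + 1)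
    (hm : E.walk u w i = x ∨ E.walk u w i = y ∨ E.walk u w i = z) : Tri E u := by
  induction i with
  | zero =>
    rcases hm with h' | h' | h'
    · have h' : u = x := h'
      exact ⟨y, z, h' ▸ h1, h' ▸ h2, h3, h.deg_le, hy, hz⟩
    · have h' : u = y := h'
      exact ⟨x, z, h' ▸ E.symm h1, h' ▸ h3, h2, h.deg_le, hx, hz⟩
    · have h' : u = z := h'
      exact ⟨x, y, h' ▸ E.symm h2, h' ▸ E.symm h3, h1, h.deg_le, hx, hy⟩
  | succ i ih =>
    exact ih (by omega) (mem_triangle h1 h2 h3 hx hy hz hm (E.symm (h.adj_walk i (by omega))))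

/-- In a good partition, the edges of a walk on a chain that is not a triangle alternate. -/
theorem parity (h : Thru E u w k) (hP : Good E P) (htri : ¬ Tri E u)
    (hL : ∀ i, i ≤ k → ∀ x, E.V x → 2 < E.deg x → P x ≠ P (E.walk u w i)) {i : ℕ} (hi : i ≤ k) :
    P (E.walk u w i) = P (E.walk u w (i + 1)) ↔ (P u = P w ↔ Even i) := by
  induction i with
  | zero => simp [Net.walk]
  | succ i ih =>
    have hA1 := h.adj_walk i (by omega)
    have hA2 := h.adj_walk (i + 1) (by omega)
    have hne : E.walk u w i ≠ E.walk u w (i + 2) := (h.walk_ne (by omega)).symm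
    -- At an inner vertex exactly one of the two edges lies inside its class, which flips the
    -- parity. Otherwise three consecutive vertices form a triangle; its third vertex has small
    -- degree because it shares its class with a vertex of the walk.
    rcases hP.same_or (E.symm hA1) hA2 hne with h1 | ⟨h1, h2, h3⟩
    · have := ih (by omega)
      have h4 := Nat.even_add_one (n := i)
      rw [h4, show i + 1 + 1 = i + 2 from rfl]
      tauto
    · refine absurd (h.tri_of_mem hA1 h3 hA2 (h.deg_le_two (by omega)) (h.deg_le_two hi) ?_
        (i := i) (by omega) (Or.inl rfl)) htri
      by_contra hlt
      exact hL (i + 1) hi _ (A.right hA2) (by omega) h2.symm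

theorem not_tri_of_large (h : Thru E u w k) (hd : 2 < E.deg (E.walk u w (k + 1))) : ¬ Tri E u := by
  rintro ⟨x, y, h1, h2, h3, h4, h5, h6⟩
  rcases h.mem_tri h1 h2 h3 h5 h6 le_rfl with h' | h' | h' <;> rw [h'] at hd <;> omega

/-- The length of a closed chain. -/
theorem closed_length (h : Thru E u w k) (hcl : E.walk u w (k + 1) = u) (hP : Good E P)
    (hL : ∀ i, i ≤ k → ∀ x, E.V x → 2 < E.deg x → P x ≠ P (E.walk u w i)) :
    k + 1 = 3 ∨ k + 1 ≠ 4 ∧ Even (k + 1) := by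
  have hk := h.two_le_of_closed hcl
  by_cases htri : Tri E u
  · obtain ⟨x, y, h1, h2, h3, h4, h5, h6⟩ := htri
    left
    by_contra hk3
    have m := fun i hi => h.mem_tri h1 h2 h3 h5 h6 (i := i) hi
    have m1 := m 1 (by omega)
    have m2 := m 2 (by omega)
    have m3 := m 3 (by omega)
    have n1 := h.ne 1 (by omega) (by omega)
    have n2 := h.ne 2 (by omega) (by omega)
    have n3 := h.ne 3 (by omega) (by omega)
    have d12 : E.walk u w 1 ≠ E.walk u w 2 := fun h' => by
      have := h.inj (i := 1) (j := 2) (by omega) (by omega) h'; omega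
    have d13 : E.walk u w 1 ≠ E.walk u w 3 := fun h' => by
      have := h.inj (i := 1) (j := 3) (by omega) (by omega) h'; omega
    have d23 : E.walk u w 2 ≠ E.walk u w 3 := fun h' => by
      have := h.inj (i := 2) (j := 3) (by omega) (by omega) h'; omega
    -- A triangle offers only two vertices besides `u`, but the walk would contain three distinct
    -- ones.
    omega
  · right
    obtain ⟨hA, hne⟩ := h.adj_last hcl
    have hpar := h.parity hP htri hL le_rfl
    rw [hcl] at hpar
    have hu : (P w = P u ↔ ¬ P u = P (E.walk u w k)) := by
      rcases hP.same_or h.adj hA hne with h1 | ⟨h1, h2, h3⟩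
      · exact h1
      · refine absurd ⟨w, _, h.adj, hA, h3, h.deg_le, h.deg_le_two (i := 1) (by omega),
          h.deg_le_two le_rfl⟩ htri
    -- The alternation must also hold at `u`, between the first and the last edge of the cycle; so
    -- `k` is odd and the length is even.
    rw [eq_comm (a := P w), eq_comm (a := P u) (b := P (E.walk u w k)), hpar] at hu
    have hev : ¬ Even k := by tauto
    refine ⟨fun h4 => ?_, Nat.even_add_one.2 hev⟩
    have hk3 : k = 3 := by omega
    subst hk3
    have p1 := h.parity hP htri hL (i := 1) (by omega)
    have p2 := h.parity hP htri hL (i := 2) (by omega)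
    have hA1 := h.adj_walk 1 (by omega)
    have hA2 := h.adj_walk 2 (by omega)
    have o1 : ¬ Even 1 := by decide
    have o2 : Even 2 := by decide
    change P w = P (E.walk u w 2) ↔ _ at p1
    change P (E.walk u w 2) = P (E.walk u w 3) ↔ _ at p2
    change E.A w (E.walk u w 2) at hA1
    -- In a 4-cycle two opposite edges lie inside classes, so the other two join the same pair of
    -- classes.
    by_cases hs : P u = P w
    · have q2 : P (E.walk u w 2) = P (E.walk u w 3) := by tauto
      have q1 : P w ≠ P (E.walk u w 2) := by tauto
      exact A.ne h.adj (hP.edge hA hA1 hs q2.symm (by rw [hs, ← q2]; exact q1))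
    · have q1 : P w = P (E.walk u w 2) := by tauto
      have q3 : P (E.walk u w 3) = P u := by tauto
      exact A.ne hA (hP.edge h.adj (E.symm hA2) q3.symm q1 hs)

/-- The length of a chain both ends of which are attached to vertices of large degree. -/
theorem even_length {w' k' : ℕ} (h : Thru E u w k) (h' : Thru E u w' k') (hne : w ≠ w')
    (hd : 2 < E.deg (E.walk u w (k + 1))) (hd' : 2 < E.deg (E.walk u w' (k' + 1)))
    (hP : Good E P)
    (hL : ∀ i, i ≤ k → ∀ x, E.V x → 2 < E.deg x → P x ≠ P (E.walk u w i))
    (hL' : ∀ i, i ≤ k' → ∀ x, E.V x → 2 < E.deg x → P x ≠ P (E.walk u w' i)) :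
    Even (k + k' + 1) := by
  have htri := h.not_tri_of_large hd
  have p1 := h.parity hP htri hL le_rfl
  have p2 := h'.parity hP htri hL' le_rfl
  have n1 := hL k le_rfl _ (h.V le_rfl) hd
  have n2 := hL' k' le_rfl _ (h'.V le_rfl) hd'
  have hu : (P w = P u ↔ ¬ P u = P w') := by
    rcases hP.same_or h.adj h'.adj hne with h1 | ⟨h1, h2, h3⟩
    · exact h1
    · refine absurd ⟨w, w', h.adj, h'.adj, h3, h.deg_le, ?_, ?_⟩ htri
      · by_contra hlt
        exact hL 0 (by omega) w (A.right h.adj) (by omega) h1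
      · by_contra hlt
        exact hL 0 (by omega) w' (A.right h'.adj) (by omega) h2.symm
  rw [eq_comm (a := P w)] at hu
  have n1' := Ne.symm n1
  have n2' := Ne.symm n2
  -- Both final edges join different classes, and exactly one of the two edges at `u` lies inside
  -- its class. Hence exactly one of `k` and `k'` is even.
  rw [Nat.even_add_one, Nat.even_add]
  tauto

end Thru

/-! ## Pairing the vertices of a chain -/

/-- The memory between two steps of the treatment of the chains. -/
structure Inv' (E : Net) (s : State) : Prop where
  base : Base E s
  marked : Marked E s
  cliques : Cliques E (s.arr .clique)
  closed : ∀ v w, E.A v w → s.arr .clique v ≠ 0 → E.deg v ≤ 2 → E.deg w ≤ 2 → s.arr .clique w ≠ 0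
  large : ∀ v, E.V v → 2 < E.deg v → s.arr .clique v ≠ 0
  classes : ∀ P, Good E P → ∀ v w, E.V v → E.V w → 2 < E.deg v → P w = P v → s.arr .clique w ≠ 0

theorem Inv'.setReg (h : Inv' E s) (r : Reg) (y : ℕ) (h1 : r ≠ .n) (h2 : r ≠ .cliques)
    (h3 : r ≠ .placed) : Inv' E (s.setReg r y) :=
  ⟨h.base.setReg _ _ h1, h.marked.of_eq (by simp [h2.symm]) (by simp [h3.symm]) rfl rfl rfl,
    h.cliques, h.closed, h.large, h.classes⟩

theorem Inv.inv' (h : Inv E s) (hl : ∀ v, E.V v → 2 < E.deg v → s.arr .clique v ≠ 0) :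
    Inv' E s where
  base := h.base
  marked := h.marked
  cliques := h.cliques
  closed := h.closed
  large := hl
  classes P hP v w hv hw hd hPw := by
    rw [(h.classes P hP v w hv hw (hl v hv hd)).2 hPw]
    exact hl v hv hd

/-- After `r` rounds exactly the first `2 * r` vertices are marked, up to the end of the chain. A
pair of adjacent vertices of degree at most two leaves each of them at most one other neighbour, and
a single vertex can remain only at a free end, by `hodd`. The loop needs no counter: beyond the
chain there is null, a vertex of large degree, which is marked, or on a cycle the first vertex,
which has been marked by then. -/
theorem runs_pairChain {a : ℕ → ℕ} {q : ℕ} (hI : Inv' E s) (hq : 1 ≤ q) (hC : Chain E a q)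
    (hcur : s.reg .start = a 1) (hprev : s.reg .before = a 0)
    (hz : ∀ i, 1 ≤ i → i ≤ q → s.arr .clique (a i) = 0)
    (hodd : ¬ Even q → a (q + 1) = 0)
    (hN : ∀ s' t', Agree pairChain s s' → Inv' E s' →
      (∀ i, 1 ≤ i → i ≤ q → s'.arr .clique (a i) ≠ 0) →
      (∀ x, s.arr .clique x ≠ 0 → s'.arr .clique x ≠ 0) →
      t' ≤ t + 1000 + 1000 * q → N s' t') :
    Runs pairChain N R s t := by
  refine Runs.spec (N := fun s' t' => Base E s' ∧ Marked E s' ∧ Cliques E (s'.arr .clique) ∧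
    (∀ i, 1 ≤ i → i ≤ q → s'.arr .clique (a i) ≠ 0) ∧
    (∀ x, s.arr .clique x ≠ 0 → s'.arr .clique x ≠ 0) ∧
    (∀ x, (∀ i, 1 ≤ i → i ≤ q → x ≠ a i) → s'.arr .clique x = s.arr .clique x) ∧
    t' ≤ t + 1000 + 1000 * q) ?_ fun s' t' hag ⟨h1, h2, h3, h4, h5, h6, h7⟩ => ?_
  · simp only [pairChain, runs_seq, runs_set]
    set s₀ := (s.setReg .cur (Exp.eval s (Exp.reg .start))).setReg .prev _ with hs₀
    have hpos : ∀ i, 1 ≤ i → i ≤ q → a i ≠ 0 := fun i h1 h2 h => by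
      have := (hC.V i h1 h2).1
      omega
    refine runs_loop (fun r s' t' => Base E s' ∧ Marked E s' ∧ Cliques E (s'.arr .clique) ∧
      2 * r ≤ q + 1 ∧ (2 * r < q → s'.reg .cur = a (2 * r + 1) ∧ s'.reg .prev = a (2 * r)) ∧
      (q ≤ 2 * r → s'.reg .cur = 0) ∧
      (∀ i, 1 ≤ i → i ≤ q → (s'.arr .clique (a i) ≠ 0 ↔ i ≤ 2 * r)) ∧
      (∀ x, (∀ i, 1 ≤ i → i ≤ q → x ≠ a i) → s'.arr .clique x = s.arr .clique x) ∧
      t' ≤ t + 500 + 1000 * r) q ?_ ?_ ?_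
    · refine ⟨(hI.base.setReg _ _ (by simp)).setReg _ _ (by simp),
        hI.marked.of_eq rfl rfl rfl rfl rfl, hI.cliques, by omega, fun _ => ?_, by omega,
        fun i h1 h2 => ?_, fun _ _ => rfl, ?_⟩
      · simp [hs₀, hcur, hprev]
      · simp [hs₀, hz i h1 h2]
        omega
      · simp only [Exp.cost]
        omega
    · rintro r s₁ t₁ ⟨hB, hM, hcq, hr, hlt, hge, hmk, hoth, ht⟩ hcond
      have hr' : 2 * r < q := by
        by_contra h
        exact hcond (by simpa using hge (by omega))
      obtain ⟨e1, e2⟩ := hlt hr'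
      obtain ⟨x, hx⟩ : ∃ x, x = a (2 * r + 1) := ⟨_, rfl⟩
      obtain ⟨y, hy⟩ : ∃ y, y = a (2 * r + 2) := ⟨_, rfl⟩
      rw [← hx] at e1
      have hVx : E.V x := hx ▸ hC.V _ (by omega) (by omega)
      have hdx : E.deg x ≤ 2 := hx ▸ hC.deg _ (by omega) (by omega)
      have hox : E.oth x (a (2 * r)) = y := by
        rw [hx, hy]
        exact hC.fwd (2 * r) hr'
      have hcx : s₁.arr .clique x = 0 := by
        by_contra hne
        have := (hmk (2 * r + 1) (by omega) (by omega)).1 (hx ▸ hne)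
        omega
      refine ⟨by omega, ?_⟩
      rw [runs_seq, newClique, runs_set, runs_seq]
      refine runs_mark (v := x) (by simp [e1]) hVx hM.newClique (by simpa using hcx) (by simp)
        fun s₂ hag₂ hM₂ hcl₂ => ?_
      have hB₂ : Base E s₂ := (hB.setReg _ _ (by simp)).agree hag₂ (by decide)
      have f1 : s₂.reg .cur = x := (hag₂.reg _ (by decide)).trans (by simp [e1])
      have f2 : s₂.reg .prev = a (2 * r) := (hag₂.reg _ (by decide)).trans (by simp [e2])
      have f3 : s₂.reg .cliques = s₁.reg .cliques + 1 :=
        (hag₂.reg _ (by decide)).trans (by simp)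
      simp only [State.setReg_arr, State.setReg_reg, if_true, Exp.eval] at hcl₂
      rw [runs_seq]
      refine runs_otherNeighbor hB₂ (by simp) (by simp) fun t₃ ht₃ => ?_
      simp only [runs_seq, runs_set, f1, f2, hox]
      have hclc : ∀ v, s₁.arr .clique v < s₁.reg .cliques + 1 := fun v =>
        Nat.lt_succ_of_le (hM.class_le v)
      refine runs_when.2 ⟨fun hcond' => ?_, fun hcond' => ?_⟩
      · have hy0 : y ≠ 0 := by simpa using hcond'
        have hyq : 2 * r + 2 ≤ q := by
          by_contra hlt'
          have hq' : q = 2 * r + 1 := by omega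
          refine hy0 (hy.trans ?_)
          have := hodd (by rw [hq', Nat.even_add_one]; simp)
          rwa [hq'] at this
        have hVy : E.V y := hy ▸ hC.V _ (by omega) (by omega)
        have hdy : E.deg y ≤ 2 := hy ▸ hC.deg _ (by omega) (by omega)
        have hAxy : E.A x y := by
          have := (adj_oth hVx hdx (b := a (2 * r)) (hox ▸ hy0)).1
          rwa [hox] at this
        have hcy : s₁.arr .clique y = 0 := by
          by_contra hne
          have := (hmk (2 * r + 2) (by omega) (by omega)).1 (hy ▸ hne)
          omega
        have hoy : E.oth y x = a (2 * r + 3) := by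
          rw [hx, hy]
          exact hC.fwd (2 * r + 1) hyq
        have hxy : y ≠ x := (A.ne hAxy).symm
        rw [runs_seq]
        refine runs_mark (v := y) (by simp) hVy (hM₂.of_eq rfl rfl rfl rfl rfl)
          (by simp [hcl₂, hxy, hcy]) (by simp [f3]) fun s₃ hag₃ hM₃ hcl₃ => ?_
        have hB₃ : Base E s₃ := (((hB₂.setReg _ _ (by simp)).setReg _ _ (by simp)).setReg _ _
          (by simp)).agree hag₃ (by decide)
        have g1 : s₃.reg .next = y := (hag₃.reg _ (by decide)).trans (by simp)
        have g2 : s₃.reg .prev = x := (hag₃.reg _ (by decide)).trans (by simp [f1])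
        simp only [State.setReg_arr, State.setReg_reg, reduceCtorEq, if_false, hcl₂, f3] at hcl₃
        rw [runs_seq]
        refine runs_otherNeighbor hB₃ (by simp) (by simp) fun t₄ ht₄ => ?_
        rw [runs_seq, runs_set]
        rw [g1, g2, hoy]
        have hcl₃' : ∀ v, s₃.arr .clique v =
            if v = x ∨ v = y then s₁.reg .cliques + 1 else s₁.arr .clique v := by
          intro v
          rw [hcl₃]
          by_cases h1 : v = y
          · simp [h1]
          · by_cases h2 : v = x
            · simp [h2, hxy.symm]
            · simp [h1, h2]
        have hcq₃ : Cliques E (s₃.arr .clique) := by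
          refine hcq.extend (fun v => v = x ∨ v = y) _ hclc hcl₃' ?_ ?_ ?_
          · rintro v (rfl | rfl)
            · exact hcx
            · exact hcy
          · rintro v v' (rfl | rfl) (rfl | rfl) hne
            · exact absurd rfl hne
            · exact hAxy
            · exact E.symm hAxy
            · exact absurd rfl hne
          · rintro v b c (rfl | rfl) hb hc hb' hc'
            · rw [not_or] at hb' hc'
              exact ((eq_or_eq_oth hAxy hb hdx).resolve_left hb'.2).trans
                ((eq_or_eq_oth hAxy hc hdx).resolve_left hc'.2).symm
            · rw [not_or] at hb' hc'
              exact ((eq_or_eq_oth (E.symm hAxy) hb hdy).resolve_left hb'.1).trans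
                ((eq_or_eq_oth (E.symm hAxy) hc hdy).resolve_left hc'.1).symm
        have hmk₃ : ∀ i, 1 ≤ i → i ≤ q → (s₃.arr .clique (a i) ≠ 0 ↔ i ≤ 2 * (r + 1)) := by
          intro i h1 h2
          rw [hcl₃']
          have i1 : a i = x ↔ i = 2 * r + 1 := by
            rw [hx]
            exact ⟨hC.inj _ _ h1 h2 (by omega) (by omega), fun h => by rw [h]⟩
          have i2 : a i = y ↔ i = 2 * r + 2 := by
            rw [hy]
            exact ⟨hC.inj _ _ h1 h2 (by omega) (by omega), fun h => by rw [h]⟩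
          split_ifs with h
          · rw [i1, i2] at h
            simp
            omega
          · rw [i1, i2] at h
            rw [hmk i h1 h2]
            omega
        have hoth₃ : ∀ v, (∀ i, 1 ≤ i → i ≤ q → v ≠ a i) → s₃.arr .clique v = s.arr .clique v := by
          intro v hv
          rw [hcl₃', if_neg, hoth v hv]
          rintro (h | h)
          · exact hv _ (by omega) (by omega) (h.trans hx)
          · exact hv _ (by omega) (by omega) (h.trans hy)
        have htime : t₄ + 20 ≤ t + 500 + 1000 * (r + 1) := by
          simp only [Test.cost, Exp.cost] at ht ht₃ ht₄
          omega
        have hzero : q ≤ 2 * (r + 1) → a (2 * r + 3) ≠ 0 → s₃.arr .clique (a (2 * r + 3)) ≠ 0 := by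
          intro hle hne
          have hq' : q = 2 * r + 2 := by omega
          rcases hC.last with h | h | h
          · rw [hq'] at h
            exact absurd h hne
          · rw [hq'] at h
            have hV3 : E.V (a (2 * r + 3)) :=
              A.right (adj_oth hVy hdy (b := x) (by rw [hoy]; exact hne)).1 |> fun h => by
                rwa [hoy] at h
            rw [hoth₃]
            · exact hI.large _ hV3 h
            · intro i h1 h2 heq
              have := hC.deg i h1 h2
              rw [← heq] at this
              exact absurd h (by rw [show 2 * r + 2 + 1 = 2 * r + 3 from rfl]; omega)
          · rw [hq'] at h
            rw [show 2 * r + 3 = 2 * r + 2 + 1 from rfl, h]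
            exact (hmk₃ 1 le_rfl (by omega)).2 (by omega)
        refine runs_when.2 ⟨fun hcond₅ => ?_, fun hcond₅ => ?_⟩
        · rw [runs_set]
          have hge' : q ≤ 2 * (r + 1) := by
            by_contra hlt'
            have h' := (hmk₃ (2 * r + 3) (by omega) (by omega)).not.2 (by omega)
            exact hcond₅ (by simpa using h')
          refine ⟨((hB₃.setReg _ _ (by simp)).setReg _ _ (by simp)).setReg _ _ (by simp),
            hM₃.of_eq rfl rfl rfl rfl rfl, hcq₃, by omega, by omega, fun _ => by simp, hmk₃, hoth₃,
            ?_⟩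
          simp only [Test.cost, Exp.cost]
          omega
        · have hcond₅ : s₃.arr .clique (a (2 * r + 3)) = 0 := by simpa using hcond₅
          refine ⟨(hB₃.setReg _ _ (by simp)).setReg _ _ (by simp),
            hM₃.of_eq rfl rfl rfl rfl rfl, hcq₃, by omega, fun _ => ?_, fun hge' => ?_, hmk₃, hoth₃,
            ?_⟩
          · simp [g1, ← hy, show 2 * (r + 1) = 2 * r + 2 by ring]
          · have : a (2 * r + 3) = 0 := by
              by_contra hne
              exact hzero hge' hne hcond₅
            simp [this]
          · simp only [Test.cost, Exp.cost]
            omega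
      · have hy0 : y = 0 := by simpa using hcond'
        have hyq : q = 2 * r + 1 := by
          by_contra hlt'
          exact hpos (2 * r + 2) (by omega) (by omega) (hy ▸ hy0)
        -- A vertex with two neighbours would have a non-null continuation, so the vertex left over
        -- has at most one neighbour.
        have hsing : ∀ b c, E.A x b → E.A x c → b = c := by
          intro b c hb hc
          by_contra hne
          exact oth_ne_zero hVx (deg_eq_two_of hb hc hne hdx) (b := a (2 * r)) (hox.trans hy0)
        have hcl₂' : ∀ v, s₂.arr .clique v =
            if v = x then s₁.reg .cliques + 1 else s₁.arr .clique v := by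
          intro v
          rw [hcl₂, Function.update_apply]
        refine ⟨((hB₂.setReg _ _ (by simp)).setReg _ _ (by simp)).setReg _ _ (by simp),
          hM₂.of_eq rfl rfl rfl rfl rfl, ?_, by omega, by omega, fun _ => by simp,
          fun i h1 h2 => ?_, fun v hv => ?_, ?_⟩
        · refine hcq.extend (fun v => v = x) _ hclc hcl₂' ?_ ?_ ?_
          · rintro v rfl
            exact hcx
          · rintro v v' rfl rfl hne
            exact absurd rfl hne
          · rintro v b c rfl hb hc - -
            exact hsing b c hb hc
        · simp only [State.setReg_arr]
          rw [hcl₂']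
          have i1 : a i = x ↔ i = 2 * r + 1 := by
            rw [hx]
            exact ⟨hC.inj _ _ h1 h2 (by omega) (by omega), fun h => by rw [h]⟩
          split_ifs with h
          · rw [i1] at h
            simp
            omega
          · rw [i1] at h
            rw [hmk i h1 h2]
            omega
        · simp only [State.setReg_arr]
          rw [hcl₂', if_neg, hoth v hv]
          exact fun h => hv _ (by omega) (by omega) (h.trans hx)
        · simp only [Test.cost, Exp.cost] at ht ht₃ ⊢
          omega
    · rintro r s₁ t₁ ⟨hB, hM, hcq, hr, hlt, hge, hmk, hoth, ht⟩ hcond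
      have hcur0 : s₁.reg .cur = 0 := by
        by_contra h
        exact hcond (by simpa using h)
      have hr' : q ≤ 2 * r := by
        by_contra h
        exact hpos (2 * r + 1) (by omega) (by omega) ((hlt (by omega)).1 ▸ hcur0)
      refine ⟨hB, hM, hcq, fun i h1 h2 => (hmk i h1 h2).2 (by omega), fun x hx => ?_, hoth, ?_⟩
      · rw [hoth]
        · exact hx
        · rintro i h1 h2 rfl
          exact hx (hz i h1 h2)
      · simp only [Test.cost, Exp.cost]
        omega
  · refine hN s' t' hag ⟨h1, h2, h3, fun v w hA hv hdv hdw => ?_, fun v hv hd => h5 v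
      (hI.large v hv hd), fun P hP v w hv hw hd hPw => h5 w (hI.classes P hP v w hv hw hd hPw)⟩
      h4 h5 h7
    by_cases hva : ∃ i, 1 ≤ i ∧ i ≤ q ∧ v = a i
    · obtain ⟨i, hi1, hi2, rfl⟩ := hva
      rcases hC.nbr i w hi1 hi2 hA with ⟨j, hj1, hj2, rfl⟩ | h
      · exact h4 j hj1 hj2
      · omega
    · rw [h6 v fun i hi1 hi2 heq => hva ⟨i, hi1, hi2, heq⟩] at hv
      exact h5 w (hI.closed v w hA hv hdv hdw)

/-! ## Traversing a chain -/

theorem Dir.unmarked {u K : ℕ} {d cl : ℕ → ℕ} (h : Dir E u d K) (hcu : cl u = 0)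
    (hcl : ∀ v w, E.A v w → cl v ≠ 0 → E.deg v ≤ 2 → E.deg w ≤ 2 → cl w ≠ 0) {i : ℕ} (hi : i ≤ K) :
    cl (d i) = 0 := by
  induction i with
  | zero => rwa [h.zero]
  | succ i ih =>
    by_contra hne
    exact hcl _ _ (E.symm (h.adj i hi)) hne (h.deg _ hi) (h.deg i (by omega)) (ih (by omega))

theorem Chain.le_n {a : ℕ → ℕ} {q : ℕ} (h : Chain E a q) : q ≤ E.n := by
  have h1 : ((Finset.Icc 1 q).image a).card = q := by
    rw [Finset.card_image_of_injOn, Nat.card_Icc]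
    · omega
    · intro i hi j hj heq
      rw [Finset.coe_Icc] at hi hj
      exact h.inj i j hi.1 hi.2 hj.1 hj.2 heq
  have h2 : ((Finset.Icc 1 q).image a).card ≤ (Finset.Icc 1 E.n).card := by
    refine Finset.card_le_card fun x hx => ?_
    obtain ⟨i, hi, rfl⟩ := Finset.mem_image.1 hx
    rw [Finset.mem_Icc] at hi
    exact Finset.mem_Icc.2 (h.V i hi.1 hi.2)
  rw [Nat.card_Icc] at h2
  omega

/-- The traversal in one direction. -/
def traverseDir : Cmd :=
  .set .prev Reg.u ;;
  .loop (.and (.eq (.cell .deg Reg.w) (.lit 2)) (.not (.eq Reg.w Reg.u)))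
    (.set .q (.succ Reg.q) ;;
      otherNeighbor .v .w .prev ;;
      .set .prev Reg.w ;;
      .set .w Reg.v) ;;
  .ite (.eq Reg.w Reg.u)
    (.set .closed (.lit 1))
    (.ite (.eq (.cell .deg Reg.w) (.lit 1))
      (.set .q (.succ Reg.q) ;;
      .set .good (.lit 1) ;;
      Cmd.when (.eq Reg.hub (.lit 0)) (.set .start Reg.w))
      (.set .hub (.lit 1) ;;
      .set .start Reg.prev ;;
      .set .before Reg.w))

/-- The walk stops when it returns to `u` or meets a vertex whose degree is not two. Degree zero is
impossible after a step, so the end is a leaf or has large degree. A leaf becomes the start only if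
no end of large degree has been found before. -/
theorem runs_traverseDir {u w : ℕ} (hs : Base E s) (hu : s.reg .u = u) (hw : s.reg .w = w)
    (hA : E.A u w) (hd : E.deg u ≤ 2)
    (hN : ∀ s' t' k, Agree traverseDir s s' → Base E s' → Thru E u w k →
      (E.walk u w (k + 1) = u ∧ s'.reg .closed = 1 ∧ s'.reg .q = s.reg .q + k ∧
        s'.reg .start = s.reg .start ∧ s'.reg .before = s.reg .before ∨
      E.walk u w (k + 1) ≠ u ∧ E.deg (E.walk u w (k + 1)) = 1 ∧ s'.reg .closed = s.reg .closed ∧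
        s'.reg .q = s.reg .q + k + 1 ∧ s'.reg .good = 1 ∧ s'.reg .hub = s.reg .hub ∧
        s'.reg .start = (if s.reg .hub = 0 then E.walk u w (k + 1) else s.reg .start) ∧
        s'.reg .before = s.reg .before ∨
      2 < E.deg (E.walk u w (k + 1)) ∧ s'.reg .closed = s.reg .closed ∧
        s'.reg .q = s.reg .q + k ∧ s'.reg .good = s.reg .good ∧ s'.reg .hub = 1 ∧
        s'.reg .start = E.walk u w k ∧ s'.reg .before = E.walk u w (k + 1)) →
      t' ≤ t + 200 + 100 * k → N s' t') :
    Runs traverseDir N R s t := by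
  refine Runs.spec (N := fun s' t' => ∃ k, Thru E u w k ∧
      (E.walk u w (k + 1) = u ∧ s'.reg .closed = 1 ∧ s'.reg .q = s.reg .q + k ∧
        s'.reg .start = s.reg .start ∧ s'.reg .before = s.reg .before ∨
      E.walk u w (k + 1) ≠ u ∧ E.deg (E.walk u w (k + 1)) = 1 ∧ s'.reg .closed = s.reg .closed ∧
        s'.reg .q = s.reg .q + k + 1 ∧ s'.reg .good = 1 ∧ s'.reg .hub = s.reg .hub ∧
        s'.reg .start = (if s.reg .hub = 0 then E.walk u w (k + 1) else s.reg .start) ∧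
        s'.reg .before = s.reg .before ∨
      2 < E.deg (E.walk u w (k + 1)) ∧ s'.reg .closed = s.reg .closed ∧
        s'.reg .q = s.reg .q + k ∧ s'.reg .good = s.reg .good ∧ s'.reg .hub = 1 ∧
        s'.reg .start = E.walk u w k ∧ s'.reg .before = E.walk u w (k + 1)) ∧
      t' ≤ t + 200 + 100 * k) ?_ fun s' t' h ⟨k, h1, h2, h3⟩ =>
    hN s' t' k h (hs.agree h (by decide)) h1 h2 h3
  simp only [traverseDir, runs_seq, runs_set]
  refine runs_loop (fun k s' t' => Base E s' ∧ s'.reg .u = u ∧ Thru E u w k ∧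
    s'.reg .prev = E.walk u w k ∧ s'.reg .w = E.walk u w (k + 1) ∧ s'.reg .q = s.reg .q + k ∧
    s'.reg .closed = s.reg .closed ∧ s'.reg .good = s.reg .good ∧ s'.reg .hub = s.reg .hub ∧
    s'.reg .start = s.reg .start ∧ s'.reg .before = s.reg .before ∧ t' ≤ t + 10 + 100 * k) E.n
    ?_ ?_ ?_
  · refine ⟨hs.setReg _ _ (by simp), by simp [hu], ⟨hA, hd, fun i h1 h2 => by omega,
      fun i h1 h2 => by omega⟩, by simp [hu, Net.walk], by simp [hw, Net.walk], by simp, by simp,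
      by simp, by simp, by simp, by simp, ?_⟩
    simp only [Exp.cost]
    omega
  · rintro k s₁ t₁ ⟨hB, hu₁, hT, e1, e2, e3, e4, e5, e6, e7, e8, ht⟩ hcond
    have hcond' : E.deg (E.walk u w (k + 1)) = 2 ∧ E.walk u w (k + 1) ≠ u := by
      simpa [hB.deg, e2, hu₁] using hcond
    refine ⟨hT.lt_n, ?_⟩
    simp only [runs_seq, runs_set]
    refine runs_otherNeighbor (hB.setReg _ _ (by simp)) (by simp) (by simp) fun t₂ ht₂ => ?_
    have hT' : Thru E u w (k + 1) := by
      refine ⟨hA, hd, fun i h1 h2 => ?_, fun i h1 h2 => ?_⟩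
      · by_cases hi : i = k + 1
        · exact hi ▸ hcond'.1
        · exact hT.deg i h1 (by omega)
      · by_cases hi : i = k + 1
        · exact hi ▸ hcond'.2
        · exact hT.ne i h1 (by omega)
    refine ⟨(((hB.setReg _ _ (by simp)).setReg _ _ (by simp)).setReg _ _ (by simp)).setReg _ _
      (by simp), by simp [hu₁], hT', by simp [e2], by simp [e1, e2, Net.walk], by simp [e3, add_assoc],
      by simp [e4], by simp [e5], by simp [e6], by simp [e7], by simp [e8], ?_⟩
    simp only [Test.cost, Exp.cost] at ht₂ ⊢
    omega
  · rintro k s₁ t₁ ⟨hB, hu₁, hT, e1, e2, e3, e4, e5, e6, e7, e8, ht⟩ hcond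
    have hcond' : ¬ (E.deg (E.walk u w (k + 1)) = 2 ∧ E.walk u w (k + 1) ≠ u) := by
      simpa [hB.deg, e2, hu₁] using hcond
    refine runs_ite.2 ⟨fun h => ?_, fun h => ?_⟩
    · have h : E.walk u w (k + 1) = u := by simpa [e2, hu₁] using h
      rw [runs_set]
      refine ⟨k, hT, Or.inl ⟨h, by simp, by simp [e3], by simp [e7], by simp [e8]⟩, ?_⟩
      simp only [Test.cost, Exp.cost]
      omega
    · have h : E.walk u w (k + 1) ≠ u := by simpa [e2, hu₁] using h
      refine runs_ite.2 ⟨fun h' => ?_, fun h' => ?_⟩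
      · have h' : E.deg (E.walk u w (k + 1)) = 1 := by simpa [hB.deg, e2] using h'
        simp only [runs_seq, runs_set]
        refine runs_when.2 ⟨fun h0 => ?_, fun h0 => ?_⟩
        · have h0 : s.reg .hub = 0 := by simpa [e6] using h0
          rw [runs_set]
          refine ⟨k, hT, Or.inr (Or.inl ⟨h, h', by simp [e4], by simp [e3], by simp, by simp [e6],
            by simp [h0, e2], by simp [e8]⟩), ?_⟩
          simp only [Test.cost, Exp.cost]
          omega
        · have h0 : s.reg .hub ≠ 0 := by simpa [e6] using h0
          refine ⟨k, hT, Or.inr (Or.inl ⟨h, h', by simp [e4], by simp [e3], by simp, by simp [e6],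
            by simp [h0, e7], by simp [e8]⟩), ?_⟩
          simp only [Test.cost, Exp.cost]
          omega
      · have h' : E.deg (E.walk u w (k + 1)) ≠ 1 := by simpa [hB.deg, e2] using h'
        have hpos : E.deg (E.walk u w (k + 1)) ≠ 0 := by
          have := card_le_deg (hT.V le_rfl) {E.walk u w k} (by
            simpa using E.symm (hT.adj_walk k le_rfl))
          rw [Finset.card_singleton] at this
          omega
        simp only [runs_seq, runs_set]
        refine ⟨k, hT, Or.inr (Or.inr ⟨by
          have hne2 : E.deg (E.walk u w (k + 1)) ≠ 2 := fun h2 => hcond' ⟨h2, h⟩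
          omega, by simp [e4], by simp [e3], by simp [e5], by simp,
          by simp [e1], by simp [e2]⟩), ?_⟩
        simp only [Test.cost, Exp.cost]
        omega

/-- What the traversal of the chain of `u` yields, if `cl` says which vertices are marked. -/
def Traversed (E : Net) (u : ℕ) (cl : ℕ → ℕ) (s : State) : Prop :=
  (s.reg .closed = 1 ∧ ∃ w k, Thru E u w k ∧ E.walk u w (k + 1) = u ∧ s.reg .q = k + 1 ∧
    s.reg .start = u ∧ s.reg .before = 0 ∧ E.oth u 0 = w) ∨
  (s.reg .closed = 0 ∧ ∃ a, Chain E a (s.reg .q) ∧ s.reg .start = a 1 ∧ s.reg .before = a 0 ∧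
    (∀ i, 1 ≤ i → i ≤ s.reg .q → cl (a i) = 0) ∧ (∃ j, 1 ≤ j ∧ j ≤ s.reg .q ∧ a j = u) ∧
    (s.reg .good = 1 → a (s.reg .q + 1) = 0) ∧ (s.reg .good ≠ 1 → E.Yes → Even (s.reg .q)))

/-- The direction `d₁` is the one at whose end the pairing starts, so the chain begins with the
reversed `d₁`. An end of degree at most one, if there is one and the other end is attached to a
vertex of large degree, must be the end of `d₂`, where a single vertex may remain. -/
theorem traversed_of_dirs {u K₁ K₂ : ℕ} {cl d₁ d₂ : ℕ → ℕ} (h₁ : Dir E u d₁ K₁) (h₂ : Dir E u d₂ K₂)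
    (h : E.oth u (d₁ 1) = d₂ 1) (hu : ∀ x, E.A u x → x = d₁ 1 ∨ x = d₂ 1) (hcu : cl u = 0)
    (hcl : ∀ v w, E.A v w → cl v ≠ 0 → E.deg v ≤ 2 → E.deg w ≤ 2 → cl w ≠ 0)
    (e1 : s.reg .closed = 0) (e2 : s.reg .q = K₁ + K₂ + 1) (e3 : s.reg .start = d₁ K₁)
    (e4 : s.reg .before = d₁ (K₁ + 1)) (e5 : s.reg .good = 1 → d₂ (K₂ + 1) = 0)
    (e6 : s.reg .good ≠ 1 → E.Yes → Even (K₁ + K₂ + 1)) : Traversed E u cl s := by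
  refine Or.inr ⟨e1, _, e2 ▸ Chain.of_dirs h₁ h₂ h hu, ?_, ?_, fun i h1 h2 => ?_,
    ⟨K₁ + 1, by omega, by omega, ?_⟩, fun hg => ?_, fun hg => e2 ▸ e6 hg⟩
  · simp [e3]
  · simp [e4]
  · split_ifs with hi
    · exact h₁.unmarked hcu hcl (by omega)
    · exact h₂.unmarked hcu hcl (by omega)
  · simp [h₁.zero]
  · rw [e2, if_neg (by omega), ← e5 hg]
    congr 1
    omega

/-- The outcome of the traversal in the first direction, if the chain is not closed. -/
def HalfTraversed (E : Net) (u w : ℕ) (s : State) : Prop :=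
  s.reg .closed = 0 ∧ ∃ k, Thru E u w k ∧
    (E.walk u w (k + 1) ≠ u ∧ E.deg (E.walk u w (k + 1)) = 1 ∧ s.reg .q = k + 2 ∧
      s.reg .good = 1 ∧ s.reg .hub = 0 ∧ s.reg .start = E.walk u w (k + 1) ∧ s.reg .before = 0 ∨
    2 < E.deg (E.walk u w (k + 1)) ∧ s.reg .q = k + 1 ∧ s.reg .hub = 1 ∧
      s.reg .start = E.walk u w k ∧ s.reg .before = E.walk u w (k + 1) ∧
      s.reg .good = if E.deg u < 2 then 1 else 0)

/-- A vertex of degree one is itself the second end of its chain, which is why `good` is set for it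
at the beginning. -/
theorem HalfTraversed.traversed {u w : ℕ} {cl : ℕ → ℕ} (h : HalfTraversed E u w s) (hA : E.A u w)
    (hd : E.deg u = 1) (hcu : cl u = 0)
    (hcl : ∀ v w, E.A v w → cl v ≠ 0 → E.deg v ≤ 2 → E.deg w ≤ 2 → cl w ≠ 0) :
    Traversed E u cl s := by
  obtain ⟨e1, k, hT, ⟨h1, h2, h3, h4, h5, h6, h7⟩ | ⟨h1, h2, h3, h4, h5, h6⟩⟩ := h
  · have hz : E.walk u w (k + 2) = 0 := oth_eq_zero (E.symm (hT.adj_walk k le_rfl)) h2.le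
    refine traversed_of_dirs (Dir.of_leaf hT h2 h1) (Dir.trivial (A.left hA) hT.deg_le)
      (oth_eq_zero hA hd.le) (fun x hx => Or.inl ?_) hcu hcl e1 (by omega) h6 ?_ (fun _ => rfl)
      (fun hg => absurd h4 hg)
    · have := (eq_or_eq_oth hA hx hT.deg_le).resolve_right fun h' =>
        A.pos hx (h'.trans (oth_eq_zero hA hd.le))
      exact this
    · rw [h7, ← hz]
  · refine traversed_of_dirs (Dir.of_large hT h1) (Dir.trivial (A.left hA) hT.deg_le)
      (oth_eq_zero hA hd.le) (fun x hx => Or.inl ?_) hcu hcl e1 (by omega) h4 h5 (fun _ => rfl)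
      (fun hg => absurd (by simp [h6, hd]) hg)
    have := (eq_or_eq_oth hA hx hT.deg_le).resolve_right fun h' =>
      A.pos hx (h'.trans (oth_eq_zero hA hd.le))
    exact this

/-- There is one round for each neighbour of `u`, at most two. If the first direction closes up, the
second is not traversed; otherwise the results of the two directions are combined according to the
kinds of their ends. -/
theorem runs_traverseChain {u : ℕ} (hI : Inv' E s) (hu : s.reg .u = u) (hV : E.V u)
    (hd : E.deg u ≤ 2) (hcu : s.arr .clique u = 0)
    (hN : ∀ s' t', Agree traverseChain s s' → Base E s' → Traversed E u (s.arr .clique) s' →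
      t' ≤ t + 1000 + 1000 * s'.reg .q → N s' t') :
    Runs traverseChain N R s t := by
  have hoff := E.off_succ hV.1 hV.2
  refine Runs.spec (N := fun s' t' => Traversed E u (s.arr .clique) s' ∧
    t' ≤ t + 1000 + 1000 * s'.reg .q) ?_ fun s' t' h h' =>
    hN s' t' h (hI.base.agree h (by decide)) h'.1 h'.2
  have hL : ∀ P, Good E P → ∀ w k, Thru E u w k → ∀ i, i ≤ k → ∀ x, E.V x → 2 < E.deg x →
      P x ≠ P (E.walk u w i) := fun P hP w k hT i hi x hx hdx heq =>
    hI.classes P hP x _ hx (hT.V (by omega)) hdx heq.symm (hT.unmarked hcu hI.closed hi)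
  obtain ⟨I, hIdef⟩ : ∃ I : ℕ → State → ℕ → Prop, I = fun i s' t' =>
      (i = E.off u ∧ s'.reg .closed = 0 ∧ s'.reg .q = 1 ∧ s'.reg .hub = 0 ∧
        s'.reg .start = u ∧ s'.reg .before = 0 ∧ (s'.reg .good = if E.deg u < 2 then 1 else 0) ∨
      i = E.off u + 1 ∧ HalfTraversed E u (E.adj (E.off u)) s' ∨
      (E.off u + 1 ≤ i ∧ s'.reg .closed = 1 ∨ i = E.off u + 2) ∧
        Traversed E u (s.arr .clique) s') ∧
      t' ≤ t + 200 + 300 * (i - E.off u) + 100 * s'.reg .q := ⟨_, rfl⟩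
  have main : ∀ s₁ t₁, Base E s₁ → s₁.reg .u = u → I (E.off u) (s₁.setReg .i (E.off u)) (t₁ + 3) →
      Runs (forNeighbors .i .w .u (Cmd.when (.eq Reg.closed (.lit 0)) traverseDir))
        (fun s' t' => Traversed E u (s.arr .clique) s' ∧ t' ≤ t + 1000 + 1000 * s'.reg .q)
        R s₁ t₁ := by
    intro s₁ t₁ hB₁ hu₁ h0
    refine runs_forNeighbors I u hB₁ hu₁ hV (by decide) (by decide) (by decide) h0 ?_ ?_
    · rintro i s₂ t₂ hag hB₂ hu₂ h1 h2 hA hri hI₂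
      subst hIdef
      obtain ⟨hI₂, ht₂⟩ := hI₂
      have hclosed : s₂.reg .closed = 1 → Traversed E u (s.arr .clique) s₂ := by
        intro hc
        rcases hI₂ with ⟨-, h, -⟩ | ⟨-, h, -⟩ | ⟨-, h⟩
        · omega
        · omega
        · exact h
      have htrans : ∀ {s₃ : State}, Traversed E u (s.arr .clique) s₃ → ∀ r y, r = .i ∨ r = .w →
          Traversed E u (s.arr .clique) (s₃.setReg r y) := by
        rintro s₃ h r y (rfl | rfl) <;> simpa [Traversed] using h
      refine runs_when.2 ⟨fun hcond => ?_, fun hcond => ?_⟩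
      · have hc0 : s₂.reg .closed = 0 := by simpa using hcond
        refine runs_traverseDir (u := u) (w := E.adj i) (hB₂.setReg _ _ (by simp)) (by simp [hu₂])
          (by simp) hA hd fun s₃ t₃ k hag₃ hB₃ hT hres ht₃ => ?_
        simp only [State.setReg_reg, reduceCtorEq, if_false, hc0] at hres
        rcases hI₂ with ⟨hi, -, e2, e3, e4, e5, e6⟩ | ⟨hi, hh⟩ | ⟨hh, hh'⟩
        · subst hi
          refine ⟨?_, ?_⟩
          · rcases hres with ⟨g1, g2, g3, g4, g5⟩ | ⟨g1, g2, g3, g4, g5, g6, g7, g8⟩ |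
              ⟨g1, g2, g3, g4, g5, g6, g7⟩
            · refine Or.inr (Or.inr ⟨Or.inl ⟨le_rfl, by simpa using g2⟩, htrans ?_ _ _ (Or.inl rfl)⟩)
              refine Or.inl ⟨g2, _, k, hT, g1, by omega, g4.trans e4, g5.trans e5, ?_⟩
              -- Null is no vertex, so the neighbour different from null is the first one in the
              -- list. The pairing of a cycle thus takes the direction in which it was traversed.
              unfold Net.oth
              rw [if_neg (by omega), if_neg (A.pos hA)]
            · refine Or.inr (Or.inl ⟨rfl, by simpa using g3, k, hT, Or.inl ⟨g1, g2, ?_, ?_, ?_, ?_, ?_⟩⟩)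
              · simp; omega
              · simpa using g5
              · simpa using g6.trans e3
              · simpa [e3] using g7
              · simpa using g8.trans e5
            · refine Or.inr (Or.inl ⟨rfl, by simpa using g2, k, hT, Or.inr ⟨g1, ?_, ?_, ?_, ?_, ?_⟩⟩)
              · simp; omega
              · simpa using g5
              · simpa using g6
              · simpa using g7
              · simpa using g4.trans e6
          · have : k ≤ s₃.reg .q := by omega
            have : s₃.reg .q ≥ s₂.reg .q + k := by omega
            simp only [Test.cost, Exp.cost, State.setReg_reg, reduceCtorEq, if_false] at ht₃ ⊢
            omega
        · subst hi
          have hd2 : E.deg u = 2 := by omega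
          have hA0 : E.A u (E.adj (E.off u)) := A_adj hV le_rfl (by omega)
          have hne : E.adj (E.off u) ≠ E.adj (E.off u + 1) :=
            (E.mono hV.1 hV.2 le_rfl (by omega) h2).ne
          have ho1 := oth_eq hA0 hA hne hd
          have ho2 := oth_eq hA hA0 hne.symm hd
          have hnb := fun x => eq_or_eq_of_deg hA0 hA hne hd (x := x)
          have hnb' := fun x => eq_or_eq_of_deg hA hA0 hne.symm hd (x := x)
          have hz : ∀ {w k}, Thru E u w k → E.deg (E.walk u w (k + 1)) = 1 →
              E.walk u w (k + 2) = 0 := fun hT h => oth_eq_zero (E.symm (hT.adj_walk _ le_rfl)) h.le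
          obtain ⟨-, k₀, hT₀, hh⟩ := hh
          refine ⟨Or.inr (Or.inr ⟨Or.inr rfl, htrans ?_ _ _ (Or.inl rfl)⟩), ?_⟩
          · rcases hres with ⟨g1, g2, g3, g4, g5⟩ | ⟨g1, g2, g3, g4, g5, g6, g7, g8⟩ |
              ⟨g1, g2, g3, g4, g5, g6, g7⟩
            -- The second direction cannot return to `u` when the first one did not.
            · have := hT.deg_eq_two_of_closed hT₀ g1
              rcases hh with ⟨f1, f2, -⟩ | ⟨f1, -⟩ <;> omega
            · rcases hh with ⟨f1, f2, f3, f4, f5, f6, f7⟩ | ⟨f1, f2, f3, f4, f5, f6⟩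
              -- With two leaves, the one found last is the start.
              · refine traversed_of_dirs (Dir.of_leaf hT g2 g1) (Dir.of_leaf hT₀ f2 f1) ho2 hnb' hcu
                  hI.closed g3 (by omega) (by simpa [f5] using g7) ?_ (fun _ => hz hT₀ f2)
                  (fun hg => absurd g5 hg)
                rw [g8, f7, hz hT g2]
              -- The end of large degree was found first and remains the start, so here the first
              -- direction plays the role of `d₁`.
              · refine traversed_of_dirs (Dir.of_large hT₀ f1) (Dir.of_leaf hT g2 g1) ho1 hnb hcu
                  hI.closed g3 (by omega) (by simpa [f3, f4] using g7) (g8.trans f5)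
                  (fun _ => hz hT g2) (fun hg => absurd g5 hg)
            · rcases hh with ⟨f1, f2, f3, f4, f5, f6, f7⟩ | ⟨f1, f2, f3, f4, f5, f6⟩
              · refine traversed_of_dirs (Dir.of_large hT g1) (Dir.of_leaf hT₀ f2 f1) ho2 hnb' hcu
                  hI.closed g2 (by omega) g6 g7 (fun _ => hz hT₀ f2)
                  (fun hg => absurd (g4.trans f4) hg)
              · refine traversed_of_dirs (Dir.of_large hT g1) (Dir.of_large hT₀ f1) ho2 hnb' hcu
                  hI.closed g2 (by omega) g6 g7 (fun hg => ?_) ?_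
                · rw [g4, f6, if_neg (by omega)] at hg
                  omega
                · rintro - ⟨P, hP⟩
                  -- Only with two ends of large degree does a good partition restrict the length.
                  exact hT.even_length hT₀ hne.symm g1 f1 hP (hL P hP _ _ hT) (hL P hP _ _ hT₀)
          · have : s₃.reg .q ≥ s₂.reg .q + k := by omega
            simp only [Test.cost, Exp.cost, State.setReg_reg, reduceCtorEq, if_false] at ht₃ ⊢
            omega
        · omega
      · have hc1 : s₂.reg .closed = 1 := by
          have : s₂.reg .closed ≠ 0 := by simpa using hcond
          rcases hI₂ with ⟨-, h, -⟩ | ⟨-, h, -⟩ | ⟨-, ⟨h, -⟩ | ⟨h, -⟩⟩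
          · omega
          · omega
          · exact h
          · omega
        refine ⟨Or.inr (Or.inr ⟨Or.inl ⟨by omega, by simpa using hc1⟩, htrans (htrans (hclosed hc1)
          _ _ (Or.inr rfl)) _ _ (Or.inl rfl)⟩), ?_⟩
        simp only [Test.cost, Exp.cost, State.setReg_reg, reduceCtorEq, if_false]
        omega
    · rintro s₂ t₂ hag hB₂ hu₂ hI₂
      subst hIdef
      obtain ⟨hI₂, ht₂⟩ := hI₂
      refine ⟨?_, by omega⟩
      rcases hI₂ with ⟨hi, e1, e2, e3, e4, e5, e6⟩ | ⟨hi, hh⟩ | ⟨hh, hh'⟩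
      · have hd0 : E.deg u = 0 := by omega
        refine traversed_of_dirs (Dir.trivial hV hd) (Dir.trivial hV hd) ?_ (fun x hx => ?_) hcu
          hI.closed e1 (by omega) e4 e5 (fun _ => rfl) (fun hg => absurd (by simp [e6, hd0]) hg)
        · simp [Net.oth, hd0]
        · have := card_le_deg hV {x} (by simpa using hx)
          rw [Finset.card_singleton] at this
          omega
      · exact hh.traversed (A_adj hV le_rfl (by omega)) (by omega) hcu hI.closed
      · exact hh'
  change Runs (.seq _ (.seq _ (.seq _ (.seq _ (.seq _ (.seq _ (.seq (Cmd.when _ _) (forNeighbors .i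
    .w .u (Cmd.when _ traverseDir))))))))) _ _ _ _
  simp only [runs_seq, runs_set]
  refine runs_when.2 ⟨fun hcond => ?_, fun hcond => ?_⟩
  · have hlt : E.deg u < 2 := by simpa [hI.base.deg, hu] using hcond
    rw [runs_set]
    refine main _ _ ?_ (by simp [hu]) ?_
    · exact ((((((hI.base.setReg _ _ (by simp)).setReg _ _ (by simp)).setReg _ _ (by simp)).setReg _ _
        (by simp)).setReg _ _ (by simp)).setReg _ _ (by simp)).setReg _ _ (by simp)
    · subst hIdef
      refine ⟨Or.inl ⟨rfl, by simp, by simp, by simp, by simp [hu], by simp, by simp [hlt]⟩, ?_⟩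
      simp only [Test.cost, Exp.cost]
      omega
  · have hlt : ¬ E.deg u < 2 := by simpa [hI.base.deg, hu] using hcond
    refine main _ _ ?_ (by simp [hu]) ?_
    · exact (((((hI.base.setReg _ _ (by simp)).setReg _ _ (by simp)).setReg _ _ (by simp)).setReg _ _
        (by simp)).setReg _ _ (by simp)).setReg _ _ (by simp)
    · subst hIdef
      refine ⟨Or.inl ⟨rfl, by simp, by simp, by simp, by simp [hu], by simp, by simp [hlt]⟩, ?_⟩
      simp only [Test.cost, Exp.cost]
      omega

/-! ## The vertices of degree at most two -/

theorem Inv'.agree {c : Cmd} (h : Inv' E s) (h' : Agree c s s') (hc : c.Keeps)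
    (hc' : Reg.cliques ∉ c.regs ∧ Reg.placed ∉ c.regs ∧ Arr.clique ∉ c.arrs ∧ Arr.order ∉ c.arrs ∧
      Arr.size ∉ c.arrs) : Inv' E s' := by
  have hcl := h'.arr _ hc'.2.2.1
  refine ⟨h.base.agree h' hc, h.marked.of_eq (h'.reg _ hc'.1) (h'.reg _ hc'.2.1) hcl
    (h'.arr _ hc'.2.2.2.1) (h'.arr _ hc'.2.2.2.2), ?_, ?_, ?_, ?_⟩ <;> rw [hcl]
  exacts [h.cliques, h.closed, h.large, h.classes]

theorem runs_markTriangle {u w : ℕ} (hI : Inv' E s) (hu : s.reg .u = u) (hcu : s.arr .clique u = 0)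
    (hT : Thru E u w 2) (hcl : E.walk u w 3 = u)
    (hN : ∀ s' t', Inv' E s' → s'.arr .clique u ≠ 0 →
      (∀ x, s.arr .clique x ≠ 0 → s'.arr .clique x ≠ 0) → t' ≤ t + 200 → N s' t') :
    Runs (newClique ;; mark .u ;; forNeighbors .i .w .u (mark .w)) N R s t := by
  have hV := A.left hT.adj
  obtain ⟨hA2, hne⟩ := hT.adj_last hcl
  have hdu : E.deg u = 2 := deg_eq_two_of hT.adj hA2 hne hT.deg_le
  have hoff := E.off_succ hV.1 hV.2
  have hK : ∀ x, (x = u ∨ E.A u x) ↔ ∃ j, j ≤ 2 ∧ E.walk u w j = x := by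
    refine fun x => ⟨?_, ?_⟩
    · rintro (rfl | h)
      · exact ⟨0, by omega, rfl⟩
      · rcases eq_or_eq_of_deg hT.adj hA2 hne hT.deg_le h with h | h
        · exact ⟨1, by omega, h.symm⟩
        · exact ⟨2, le_rfl, h.symm⟩
    · rintro ⟨j, hj, rfl⟩
      interval_cases j
      · exact Or.inl rfl
      · exact Or.inr hT.adj
      · exact Or.inr hA2
  have hKdeg : ∀ x, (x = u ∨ E.A u x) → E.deg x ≤ 2 := by
    intro x hx
    obtain ⟨j, hj, rfl⟩ := (hK x).1 hx
    exact hT.deg_le_two hj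
  have hKcl : ∀ x, (x = u ∨ E.A u x) → s.arr .clique x = 0 := by
    intro x hx
    obtain ⟨j, hj, rfl⟩ := (hK x).1 hx
    exact hT.unmarked hcu hI.closed hj
  have hKnbr : ∀ x b, (x = u ∨ E.A u x) → E.A x b → (b = u ∨ E.A u b) := by
    intro x b hx hb
    obtain ⟨j, hj, rfl⟩ := (hK x).1 hx
    exact (hK b).2 (hT.closed_nbr hcl hj hb)
  have hA12 : E.A w (E.walk u w 2) := hT.adj_walk 1 (by omega)
  have hKadj : ∀ x y, (x = u ∨ E.A u x) → (y = u ∨ E.A u y) → x ≠ y → E.A x y := by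
    intro x y hx hy hxy
    rcases hx with rfl | hx <;> rcases hy with rfl | hy
    · exact absurd rfl hxy
    · exact hy
    · exact E.symm hx
    · rcases eq_or_eq_of_deg hT.adj hA2 hne hT.deg_le hx with rfl | rfl <;>
        rcases eq_or_eq_of_deg hT.adj hA2 hne hT.deg_le hy with rfl | rfl
      · exact absurd rfl hxy
      · exact hA12
      · exact E.symm hA12
      · exact absurd rfl hxy
  obtain ⟨c, hc⟩ : ∃ c, c = s.reg .cliques + 1 := ⟨_, rfl⟩
  rw [runs_seq, newClique, runs_set, runs_seq]
  refine runs_mark (v := u) (by simp [hu]) hV hI.marked.newClique (by simpa using hcu) (by simp)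
    fun s₁ hag₁ hM₁ hcl₁ => ?_
  have hB₁ : Base E s₁ := (hI.base.setReg _ _ (by simp)).agree hag₁ (by decide)
  have hu₁ : s₁.reg .u = u := (hag₁.reg _ (by decide)).trans (by simp [hu])
  have hc₁ : s₁.reg .cliques = c := (hag₁.reg _ (by decide)).trans (by simp [hc])
  simp only [State.setReg_arr, State.setReg_reg, if_true, Exp.eval, ← hc] at hcl₁
  refine runs_forNeighbors (fun i s' t' => Marked E s' ∧
    (∀ x, (x = u ∨ Before E u i x) → s'.arr .clique x = c) ∧
    (∀ x, ¬ (x = u ∨ Before E u i x) → s'.arr .clique x = s.arr .clique x) ∧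
    t' ≤ t + 50 + 50 * (i - E.off u)) u hB₁ hu₁ hV (by decide) (by decide) (by decide) ?_ ?_ ?_
  · have hnb : ∀ x, ¬ Before E u (E.off u) x := by
      rintro x ⟨i, h1, h2, -⟩
      omega
    refine ⟨hM₁.of_eq rfl rfl rfl rfl rfl, fun x hx => ?_, fun x hx => ?_, ?_⟩
    · obtain rfl := hx.resolve_right (hnb x)
      simp [hcl₁]
    · rw [not_or] at hx
      simp [hcl₁, hx.1]
    · simp only [Exp.cost]
      omega
  · rintro i s₂ t₂ hag₂ hB₂ hu₂ h1 h2 hA hri ⟨hM₂, hin, hnin, ht⟩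
    have hnot : ¬ (E.adj i = u ∨ Before E u i (E.adj i)) := by
      rintro (h | h)
      · exact A.ne hA h.symm
      · exact not_before_self hV h2 h
    refine runs_mark (v := E.adj i) (by simp) (A.right hA) (hM₂.of_eq rfl rfl rfl rfl rfl)
      (by simpa using (hnin _ hnot).trans (hKcl _ (Or.inr hA))) ?_ fun s₃ hag₃ hM₃ hcl₃ => ?_
    · simp only [State.setReg_reg, reduceCtorEq, if_false]
      rw [hag₂.reg _ (by decide), hc₁]
      omega
    · have hc₂ : s₂.reg .cliques = c := (hag₂.reg _ (by decide)).trans hc₁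
      simp only [State.setReg_arr, State.setReg_reg, reduceCtorEq, if_false, hc₂] at hcl₃
      refine ⟨hM₃.of_eq rfl rfl rfl rfl rfl, fun x hx => ?_, fun x hx => ?_, by omega⟩
      · rw [before_succ h1, ← or_assoc] at hx
        simp only [State.setReg_arr, hcl₃, Function.update_apply]
        split_ifs with h
        · rfl
        · exact hin x (hx.resolve_right h)
      · rw [before_succ h1, ← or_assoc, not_or] at hx
        simpa [hcl₃, hx.2] using hnin x hx.1
  · rintro s₂ t₂ hag₂ hB₂ hu₂ ⟨hM₂, hin, hnin, ht⟩
    classical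
    have hb : ∀ x, Before E u (E.off (u + 1)) x ↔ E.A u x := fun x =>
      ⟨fun ⟨i, h1, h2, h3⟩ => h3 ▸ A_adj hV h1 h2, before_all⟩
    have hcl₂ : ∀ x, s₂.arr .clique x = if x = u ∨ E.A u x then c else s.arr .clique x := by
      intro x
      split_ifs with h
      · exact hin x (by rwa [hb])
      · exact hnin x (by rwa [hb])
    have hmono : ∀ x, s.arr .clique x ≠ 0 → s₂.arr .clique x ≠ 0 := by
      intro x hx
      rw [hcl₂]
      split_ifs
      · omega
      · exact hx
    refine hN s₂ _ ⟨hB₂, hM₂, ?_, ?_, fun v hv hd => hmono v (hI.large v hv hd),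
      fun P hP v w hv hw hd h => hmono w (hI.classes P hP v w hv hw hd h)⟩ ?_ hmono (by omega)
    · exact hI.cliques.extend (fun x => x = u ∨ E.A u x) c
        (fun v => hc ▸ Nat.lt_succ_of_le (hI.marked.class_le v)) hcl₂ hKcl hKadj
        fun x a b hx ha _ ha' _ => absurd (hKnbr x a hx ha) ha'
    · intro v x hvx hv hdv hdx
      by_cases h : v = u ∨ E.A u v
      · rw [hcl₂, if_pos (hKnbr v x h hvx)]
        omega
      · rw [hcl₂, if_neg h] at hv
        exact hmono x (hI.closed v x hvx hv hdv hdx)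
    · rw [hcl₂, if_pos (Or.inl rfl)]
      omega

/-- Every rejection is backed by `Thru.closed_length` or by the parity clause of `Traversed`. Both
rest on `hL`: a class that contains a vertex of large degree has been marked completely, so no
unmarked vertex of the chain belongs to it. -/
theorem runs_isGoodChain {u : ℕ} (hI : Inv' E s) (hu : s.reg .u = u) (hV : E.V u)
    (hcu : s.arr .clique u = 0)
    (hR : ¬ E.Yes → ∀ t', t' ≤ t + 2000 + 1000 * E.n → R t')
    (hN : ∀ s' t', Agree isGoodChain s s' → Inv' E s' → s'.arr .clique u ≠ 0 →
      (∀ x, s.arr .clique x ≠ 0 → s'.arr .clique x ≠ 0) →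
      t' + 5000 * weight E (s.arr .clique) ≤ t + 5000 * weight E (s'.arr .clique) → N s' t') :
    Runs isGoodChain N R s t := by
  refine Runs.spec (N := fun s' t' => Inv' E s' ∧ s'.arr .clique u ≠ 0 ∧
      (∀ x, s.arr .clique x ≠ 0 → s'.arr .clique x ≠ 0) ∧
      t' + 5000 * weight E (s.arr .clique) ≤ t + 5000 * weight E (s'.arr .clique)) ?_
    fun s' t' h h' => hN s' t' h h'.1 h'.2.1 h'.2.2.1 h'.2.2.2
  have hd : E.deg u ≤ 2 := by
    by_contra h
    exact hI.large u hV (by omega) hcu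
  have hL : ∀ P, Good E P → ∀ w k, Thru E u w k → ∀ i, i ≤ k → ∀ x, E.V x → 2 < E.deg x →
      P x ≠ P (E.walk u w i) := fun P hP w k hT i hi x hx hdx heq =>
    hI.classes P hP x _ hx (hT.V (by omega)) hdx heq.symm (hT.unmarked hcu hI.closed hi)
  rw [isGoodChain, runs_seq]
  refine runs_traverseChain hI hu hV hd hcu fun s₁ t₁ hag₁ hB₁ hT₁ ht₁ => ?_
  have hI₁ : Inv' E s₁ := hI.agree hag₁ (by decide) (by decide)
  have hcl₁ : s₁.arr .clique = s.arr .clique := hag₁.arr _ (by decide)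
  have hu₁ : s₁.reg .u = u := (hag₁.reg _ (by decide)).trans hu
  have pair : ∀ (a : ℕ → ℕ) t₂, Chain E a (s₁.reg .q) → s₁.reg .start = a 1 →
      s₁.reg .before = a 0 → (∀ i, 1 ≤ i → i ≤ s₁.reg .q → s.arr .clique (a i) = 0) →
      (∃ j, 1 ≤ j ∧ j ≤ s₁.reg .q ∧ a j = u) → (¬ Even (s₁.reg .q) → a (s₁.reg .q + 1) = 0) →
      t₂ ≤ t₁ + 100 → Runs pairChain (fun s' t' => Inv' E s' ∧ s'.arr .clique u ≠ 0 ∧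
      (∀ x, s.arr .clique x ≠ 0 → s'.arr .clique x ≠ 0) ∧
      t' + 5000 * weight E (s.arr .clique) ≤ t + 5000 * weight E (s'.arr .clique)) R s₁ t₂ := by
    rintro a t₂ hC hst hbe hz ⟨j, hj1, hj2, hj⟩ hodd ht₂
    refine runs_pairChain hI₁ (by omega) hC hst hbe (by rwa [hcl₁]) hodd
      fun s₂ t₃ hag₂ hI₂ hmk hmono ht₃ => ?_
    rw [hcl₁] at hmono
    refine ⟨hI₂, hj ▸ hmk j hj1 hj2, hmono, ?_⟩
    have hw := weight_add_le (E := E) (cl := s.arr .clique) (cl' := s₂.arr .clique)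
      ((Finset.Icc 1 (s₁.reg .q)).image a) ?_ ?_ ?_ hmono
    -- All `q` vertices of the chain are newly marked and contribute at least one each, which pays
    -- for the traversal and the pairing.
    · have hle : s₁.reg .q ≤ ∑ v ∈ (Finset.Icc 1 (s₁.reg .q)).image a, (E.deg v + 1) := by
        have := Finset.card_nsmul_le_sum ((Finset.Icc 1 (s₁.reg .q)).image a)
          (fun v => E.deg v + 1) 1 fun v _ => by omega
        rw [Finset.card_image_of_injOn, Nat.card_Icc] at this
        · simpa using this
        · intro i hi j hj heq
          rw [Finset.coe_Icc] at hi hj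
          exact hC.inj i j hi.1 hi.2 hj.1 hj.2 heq
      omega
    · simp only [Finset.mem_image, Finset.mem_Icc]
      rintro v ⟨i, hi, rfl⟩
      exact hC.V i hi.1 hi.2
    · simp only [Finset.mem_image, Finset.mem_Icc]
      rintro v ⟨i, hi, rfl⟩
      exact hz i hi.1 hi.2
    · simp only [Finset.mem_image, Finset.mem_Icc]
      rintro v ⟨i, hi, rfl⟩
      exact hmk i hi.1 hi.2
  rcases hT₁ with ⟨e1, w, k, hT, hcl, e2, e3, e4, e5⟩ | ⟨e1, a, hC, e2, e3, hz, hj, e4, e5⟩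
  · refine runs_ite.2 ⟨fun _ => ?_, fun h => absurd e1 (by simpa using h)⟩
    refine runs_ite.2 ⟨fun h => ?_, fun h => runs_ite.2 ⟨fun h' => ?_, fun h' => ?_⟩⟩
    · have hk : k = 2 := by
        have : s₁.reg .q = 3 := by simpa using h
        omega
      subst hk
      refine runs_markTriangle hI₁ hu₁ (by rwa [hcl₁]) hT hcl fun s₂ t₂ hI₂ hcu₂ hmono ht₂ => ?_
      rw [hcl₁] at hmono
      refine ⟨hI₂, hcu₂, hmono, ?_⟩
      have hw := weight_add_le (E := E) (cl := s.arr .clique) (cl' := s₂.arr .clique) {u}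
        (by simpa using hV) (by simpa using hcu) (by simpa using hcu₂) hmono
      rw [Finset.sum_singleton] at hw
      have hA2 := hT.adj_last hcl
      have hdu : E.deg u = 2 := deg_eq_two_of hT.adj hA2.1 hA2.2 hT.deg_le
      simp only [Test.cost, Exp.cost] at ht₂
      omega
    · have h : k + 1 ≠ 3 := by simpa [e2] using h
      have h' : k + 1 = 4 ∨ ¬ Even (k + 1) := by
        simpa only [Test.eval, Exp.eval, e2] using h'
      rw [runs_ret]
      refine hR ?_ _ ?_
      · rintro ⟨P, hP⟩
        have := hT.closed_length hcl hP (hL P hP w k hT)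
        tauto
      · have := hT.lt_n
        simp only [Test.cost, Exp.cost]
        omega
    · have h' : ¬ (k + 1 = 4 ∨ ¬ Even (k + 1)) := by
        simpa only [Test.eval, Exp.eval, e2] using h'
      refine pair _ _ (e2 ▸ Chain.of_closed hT hcl e5) (by simp [e3, Net.walk]) (by simp [e4])
        (fun i h1 h2 => ?_) ⟨1, le_rfl, by omega, by simp [Net.walk]⟩ (fun h => ?_) ?_
      · rw [if_neg (by omega)]
        exact hT.unmarked hcu hI.closed (by omega)
      · rw [e2] at h
        exact absurd (Or.inr h) h'
      · simp only [Test.cost, Exp.cost]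
        omega
  · refine runs_ite.2 ⟨fun h => absurd h (by simp [e1]), fun _ => ?_⟩
    refine runs_ite.2 ⟨fun h => ?_, fun h => ?_⟩
    · have h : s₁.reg .good = 1 ∨ Even (s₁.reg .q) := by
        simpa only [Test.eval, Exp.eval] using h
      refine pair a _ hC e2 e3 hz hj (fun h' => e4 (h.resolve_right h')) ?_
      simp only [Test.cost, Exp.cost]
      omega
    · have h : ¬ (s₁.reg .good = 1 ∨ Even (s₁.reg .q)) := by
        simpa only [Test.eval, Exp.eval] using h
      rw [not_or] at h
      rw [runs_ret]
      refine hR (fun hY => h.2 (e5 h.1 hY)) _ ?_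
      have := hC.le_n
      simp only [Test.cost, Exp.cost]
      omega

/-- The treatment of the vertices of degree at most `2`. -/
theorem runs_markSmall (hI : Inv' E s)
    (hR : ¬ E.Yes → ∀ t', t' ≤ t + 10000 + 20000 * (E.n + E.off (E.n + 1)) → R t')
    (hN : ∀ s' t', Inv' E s' → (∀ v, E.V v → s'.arr .clique v ≠ 0) →
      t' ≤ t + 10000 + 20000 * (E.n + E.off (E.n + 1)) → N s' t') :
    Runs (forVertices .u (Cmd.when (.eq (.cell .clique Reg.u) (.lit 0)) isGoodChain)) N R s t := by
  refine runs_forVertices (fun i s' t' => Inv' E s' ∧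
    (∀ v, E.V v → v < i → s'.arr .clique v ≠ 0) ∧
    t' ≤ t + 100 * i + 5000 * weight E (s'.arr .clique)) E.n (by decide) hI.base.n (by decide)
    ?_ ?_ ?_
  · exact ⟨hI.setReg _ _ (by simp) (by simp) (by simp),
      fun v hv hv1 => by have := hv.1; omega, by omega⟩
  · rintro i s₁ t₁ hag h1 h2 hri ⟨hI₁, hm, ht⟩
    have hw := weight_le (E := E) (s₁.arr .clique)
    refine runs_when.2 ⟨fun hcond => ?_, fun hcond => ?_⟩
    · have hcond' : s₁.arr .clique i = 0 := by simpa [hri] using hcond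
      refine runs_isGoodChain hI₁ hri ⟨h1, h2⟩ hcond' (fun h t' ht' => hR h t' ?_) ?_
      · simp only [Test.cost, Exp.cost] at ht'
        omega
      · intro s₂ t₂ _ hI₂ hi hmono ht₂
        refine ⟨hI₂.setReg _ _ (by simp) (by simp) (by simp), fun v hv hv1 => ?_, ?_⟩
        · by_cases hvi : v = i
          · exact hvi ▸ hi
          · exact hmono v (hm v hv (by omega))
        · simp only [Test.cost, Exp.cost, State.setReg_arr] at ht₂ ⊢
          omega
    · have hcond' : s₁.arr .clique i ≠ 0 := by simpa [hri] using hcond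
      refine ⟨hI₁.setReg _ _ (by simp) (by simp) (by simp), fun v hv hv1 => ?_, ?_⟩
      · by_cases hvi : v = i
        · exact hvi ▸ hcond'
        · exact hm v hv (by omega)
      · simp only [Test.cost, Exp.cost, State.setReg_arr] at ht ⊢
        omega
  · rintro s₁ t₁ hag ⟨hI₁, hm, ht⟩
    have hw := weight_le (E := E) (s₁.arr .clique)
    refine hN s₁ _ hI₁ (fun v hv => hm v hv (Nat.lt_succ_of_le hv.2)) (by omega)

/-! ## Building the root -/

/-- An expanded-clique graph has no induced cycle of length `4`. -/
theorem Good.no_square {a b c d : ℕ} (hP : Good E P) (hab : E.A a b) (hbc : E.A b c) (hcd : E.A c d)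
    (hda : E.A d a) (hac : ¬ E.A a c) (hbd : ¬ E.A b d) (hac' : a ≠ c) (hbd' : b ≠ d) : False := by
  -- Of two nonadjacent neighbours of a vertex exactly one lies in its class. Around an induced
  -- 4-cycle the edges therefore alternate, and the two edges between classes join the same pair.
  have key : ∀ x y z, E.A x y → E.A x z → ¬ E.A y z → y ≠ z → (P y = P x ↔ P z ≠ P x) := by
    intro x y z hy hz hyz hne
    by_cases h1 : P y = P x <;> by_cases h2 : P z = P x
    · have h3 := A.right hy
      have h4 := A.right hz
      exact absurd (hP.clique h3.1 h3.2 h4.1 h4.2 hne (h1.trans h2.symm)) hyz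
    · exact iff_of_true h1 h2
    · exact iff_of_false h1 (not_not.2 h2)
    · exact absurd (hP.outside hy hz h1 h2) hne
  have ka := key a b d hab (E.symm hda) hbd hbd'
  have kb := key b a c (E.symm hab) hbc hac hac'
  have kc := key c b d (E.symm hbc) hcd hbd hbd'
  have kd := key d a c hda (E.symm hcd) hac hac'
  by_cases h : P b = P a
  · have h1 : P d ≠ P a := ka.1 h
    have h2 : P c ≠ P b := kb.1 h.symm
    have h3 : P d = P c := by
      by_contra h3
      exact h2 (kc.2 h3).symm
    exact A.ne hab (hP.edge (E.symm hda) hbc h.symm h3 h1.symm)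
  · have h1 : P d = P a := by
      by_contra h1
      exact h (ka.2 h1)
    have h2 : P c = P b := by
      by_contra h2
      exact h (kb.2 h2).symm
    exact A.ne hda (hP.edge (E.symm hcd) hab h1 h2 (by rw [h1, h2]; exact Ne.symm h))

/-- The records of `buildRoot` when the edges `vw` with `D v w` have been treated. -/
structure Built (cl : ℕ → ℕ) (D : ℕ → ℕ → Prop) (s : State) : Prop where
  unique : ∀ {a b c d}, D a b → D c d → cl a = cl c → cl b = cl d → cl a ≠ cl b → a = c
  edges : ∀ x y, (∃ k < s.reg .edges, s.arr .edgeFst k = x ∧ s.arr .edgeSnd k = y) ↔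
    ∃ v w, D v w ∧ cl v = x ∧ cl w = y ∧ x < y
  sound : ∀ y, s.arr .stamp y ≠ 0 →
    ∃ v w, D v w ∧ cl v = s.arr .stamp y ∧ cl w = y ∧ y ≠ s.arr .stamp y
  complete : ∀ v w, D v w → cl w ≠ cl v → cl v ≤ s.arr .stamp (cl w)

theorem Built.congr {cl : ℕ → ℕ} {D D' : ℕ → ℕ → Prop} (h : Built cl D s)
    (hD : ∀ v w, D' v w ↔ D v w) : Built cl D' s := by
  obtain rfl : D' = D := funext fun v => funext fun w => propext (hD v w)
  exact h

theorem Built.of_eq {cl : ℕ → ℕ} {D : ℕ → ℕ → Prop} (h : Built cl D s)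
    (h1 : s'.reg .edges = s.reg .edges) (h2 : s'.arr = s.arr) : Built cl D s' := by
  refine ⟨h.unique, ?_, ?_, ?_⟩
  · rw [h1, h2]; exact h.edges
  · rw [h2]; exact h.sound
  · rw [h2]; exact h.complete

/-- The treatment of an edge by `buildRoot`. -/
def recordEdge : Cmd :=
  Cmd.when (.not (.eq (.cell .clique Reg.w) (.cell .clique Reg.v)))
    (Cmd.when (.eq (.cell .stamp (.cell .clique Reg.w)) (.cell .clique Reg.v)) .ret ;;
      .store .stamp (.cell .clique Reg.w) (.cell .clique Reg.v) ;;
      Cmd.when (.lt (.cell .clique Reg.v) (.cell .clique Reg.w))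
        (.store .edgeFst Reg.edges (.cell .clique Reg.v) ;;
        .store .edgeSnd Reg.edges (.cell .clique Reg.w) ;;
        .set .edges (.succ Reg.edges)))

/-- The cliques are treated in ascending order, so a stamp equal to the current number means that
the current clique has already reached the clique of `w`, and stamps never need to be reset. Each
edge is met from both ends but listed only from the smaller clique number. -/
theorem runs_recordEdge {cl : ℕ → ℕ} {D : ℕ → ℕ → Prop} {v w : ℕ} (hcl : s.arr .clique = cl)
    (hC : Cliques E cl) (hall : ∀ v, E.V v → cl v ≠ 0) (hB : Built cl D s) (hv : s.reg .v = v)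
    (hw : s.reg .w = w) (hA : E.A v w) (hDA : ∀ a b, D a b → E.A a b)
    (hD : ¬ D v w) (hle : ∀ a b, D a b → cl a ≤ cl v)
    (hR : ¬ E.Yes → ∀ t', t' ≤ t + 50 → R t')
    (hN : ∀ s' t', Built cl (fun a b => D a b ∨ a = v ∧ b = w) s' → t' ≤ t + 50 → N s' t') :
    Runs recordEdge N R s t := by
  have hv0 := hall v (A.left hA)
  have hw0 := hall w (A.right hA)
  refine runs_when.2 ⟨fun hcond => ?_, fun hcond => ?_⟩
  · have hne : cl w ≠ cl v := by simpa [hcl, hv, hw] using hcond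
    rw [runs_seq]
    refine runs_when.2 ⟨fun hst => ?_, fun hst => ?_⟩
    · have hst : s.arr .stamp (cl w) = cl v := by simpa [hcl, hv, hw] using hst
      rw [runs_ret]
      refine hR ?_ _ ?_
      · rintro ⟨P, hP⟩
        obtain ⟨v', w', h1, h2, h3, -⟩ := hB.sound (cl w) (by rwa [hst])
        rw [hst] at h2
        have hA' := hDA _ _ h1
        have hne' : cl w' ≠ cl v' := by rwa [h2, h3]
        -- The two edges share no end, since outside neighbours are unique and `vw` is new. As both
        -- cliques are complete, the four ends form a 4-cycle; a diagonal would be a second outside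
        -- neighbour.
        have hvv : v ≠ v' := by
          rintro rfl
          obtain rfl := hC.outside hv0 hA hA' hne hne'
          exact hD h1
        have hww : w ≠ w' := by
          rintro rfl
          exact hvv (hC.outside hw0 (E.symm hA) (E.symm hA') hne.symm hne'.symm)
        have h4 := hC.adj (A.left hA) (A.left hA') hvv hv0 h2.symm
        have h5 := hC.adj (A.right hA') (A.right hA) hww.symm (by rwa [h3]) h3
        refine hP.no_square h4 hA' h5 (E.symm hA) (fun h => hww ?_) (fun h => hww ?_)
          (fun h => hne' (by rw [← h, h2])) fun h => hne (by rw [← h, h2])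
        · exact hC.outside hv0 hA h hne (by rwa [h3])
        · exact (hC.outside (by rwa [h2]) hA' h hne' (by rwa [h2])).symm
      · simp only [Test.cost, Exp.cost]
        omega
    · have hst : s.arr .stamp (cl w) ≠ cl v := by simpa [hcl, hv, hw] using hst
      -- An earlier edge between these cliques would have left a stamp of at least `cl v`. Stamps
      -- are numbers of cliques treated so far, hence at most `cl v`, and equality has been
      -- excluded.
      have hnew : ∀ a b, D a b → cl a = cl v → cl b = cl w → False := by
        intro a b hab h1 h2
        have h3 := hB.complete a b hab (by rwa [h1, h2])
        rw [h1, h2] at h3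
        obtain ⟨v', w', h4, h5, -⟩ := hB.sound (cl w) (by omega)
        have := hle _ _ h4
        omega
      have hstamp : ∀ s' : State, s'.arr .stamp = Function.update (s.arr .stamp) (cl w) (cl v) →
          (∀ x y, (∃ k < s'.reg .edges, s'.arr .edgeFst k = x ∧ s'.arr .edgeSnd k = y) ↔
            ∃ a b, (D a b ∨ a = v ∧ b = w) ∧ cl a = x ∧ cl b = y ∧ x < y) →
          Built cl (fun a b => D a b ∨ a = v ∧ b = w) s' := by
        intro s' he hed
        refine ⟨?_, hed, fun y hy => ?_, ?_⟩
        · rintro a b c d (h1 | ⟨rfl, rfl⟩) (h2 | ⟨rfl, rfl⟩) h3 h4 h5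
          · exact hB.unique h1 h2 h3 h4 h5
          · exact (hnew _ _ h1 h3 h4).elim
          · exact (hnew _ _ h2 h3.symm h4.symm).elim
          · rfl
        · rw [he, Function.update_apply] at hy ⊢
          split_ifs with h
          · exact ⟨v, w, Or.inr ⟨rfl, rfl⟩, rfl, h.symm, h ▸ hne⟩
          · rw [if_neg h] at hy
            obtain ⟨a, b, h1, h2, h3, h4⟩ := hB.sound y hy
            exact ⟨a, b, Or.inl h1, h2, h3, h4⟩
        · rintro a b (h1 | ⟨rfl, rfl⟩) h2
          · rw [he, Function.update_apply]
            split_ifs with h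
            · exact hle _ _ h1
            · exact hB.complete a b h1 h2
          · rw [he, Function.update_self]
      rw [runs_seq, runs_store]
      simp only [Exp.eval, hcl, hv, hw]
      refine runs_when.2 ⟨fun hlt => ?_, fun hlt => ?_⟩
      · have hlt : cl v < cl w := by simpa [hcl, hv, hw] using hlt
        simp only [runs_seq, runs_store, runs_set]
        refine hN _ _ (hstamp _ (by simp) fun x y => ?_) ?_
        · simp only [State.setReg_reg, State.setCell_reg, State.setReg_arr, State.setCell_arr,
            Exp.eval, reduceCtorEq, if_true, if_false, hcl, hv, hw, Function.update_apply]
          constructor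
          · rintro ⟨k, hk, h1, h2⟩
            split_ifs at h1 h2 with h
            · exact ⟨v, w, Or.inr ⟨rfl, rfl⟩, h1, h2, by omega⟩
            · obtain ⟨a, b, h3, h4⟩ := (hB.edges x y).1 ⟨k, by omega, h1, h2⟩
              exact ⟨a, b, Or.inl h3, h4⟩
          · rintro ⟨a, b, h3 | ⟨rfl, rfl⟩, h4, h5, h6⟩
            · obtain ⟨k, hk, h1, h2⟩ := (hB.edges x y).2 ⟨a, b, h3, h4, h5, h6⟩
              refine ⟨k, by omega, ?_⟩
              rw [if_neg (by omega), if_neg (by omega)]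
              exact ⟨h1, h2⟩
            · exact ⟨s.reg .edges, by omega, by simpa using h4, by simpa using h5⟩
        · simp only [Test.cost, Exp.cost]
          omega
      · have hlt : ¬ cl v < cl w := by simpa [hcl, hv, hw] using hlt
        refine hN _ _ (hstamp _ (by simp) fun x y => ?_) ?_
        · simp only [State.setCell_reg, State.setCell_arr, reduceCtorEq, if_false]
          rw [hB.edges]
          constructor
          · rintro ⟨a, b, h3, h4⟩
            exact ⟨a, b, Or.inl h3, h4⟩
          · rintro ⟨a, b, h3 | ⟨rfl, rfl⟩, h4, h5, h6⟩
            · exact ⟨a, b, h3, h4, h5, h6⟩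
            · omega
        · simp only [Test.cost, Exp.cost]
          omega
  · have heq : cl w = cl v := by simpa [hcl, hv, hw] using hcond
    refine hN _ _ ⟨?_, fun x y => ?_, fun y hy => ?_, ?_⟩ ?_
    · rintro a b c d (h1 | ⟨rfl, rfl⟩) (h2 | ⟨rfl, rfl⟩) h3 h4 h5
      · exact hB.unique h1 h2 h3 h4 h5
      · exact absurd (by rw [h3, h4, heq]) h5
      · exact absurd heq.symm h5
      · rfl
    · rw [hB.edges]
      constructor
      · rintro ⟨a, b, h3, h4⟩
        exact ⟨a, b, Or.inl h3, h4⟩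
      · rintro ⟨a, b, h3 | ⟨rfl, rfl⟩, h4, h5, h6⟩
        · exact ⟨a, b, h3, h4, h5, h6⟩
        · omega
    · obtain ⟨a, b, h1, h2, h3, h4⟩ := hB.sound y hy
      exact ⟨a, b, Or.inl h1, h2, h3, h4⟩
    · rintro a b (h1 | ⟨rfl, rfl⟩) h2
      · exact hB.complete a b h1 h2
      · exact absurd heq h2
    · simp only [Test.cost, Exp.cost]
      omega

theorem Marked.sum_order_le (hM : Marked E s) {k : ℕ} (hk : k ≤ s.reg .placed) :
    k ≤ E.n ∧ ∑ j ∈ Finset.range k, E.deg (s.arr .order j) ≤ E.off (E.n + 1) := by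
  have hinj : Set.InjOn (s.arr .order) (Finset.range k) := by
    intro i hi j hj h
    rw [Finset.coe_range, Set.mem_Iio] at hi hj
    exact hM.order_inj i j (by omega) (by omega) h
  have hsub : (Finset.range k).image (s.arr .order) ⊆ Finset.Icc 1 E.n := by
    intro x hx
    obtain ⟨i, hi, rfl⟩ := Finset.mem_image.1 hx
    rw [Finset.mem_range] at hi
    exact Finset.mem_Icc.2 (hM.order_mem i (by omega)).1
  constructor
  · have := Finset.card_le_card hsub
    rwa [Finset.card_image_of_injOn hinj, Finset.card_range, Nat.card_Icc,
      Nat.add_sub_cancel] at this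
  · rw [← sum_deg, ← Finset.sum_image (f := E.deg) hinj]
    exact Finset.sum_le_sum_of_subset hsub

theorem runs_buildRoot {cl : ℕ → ℕ} (hs : Base E s) (hcl : s.arr .clique = cl) (hM : Marked E s)
    (hC : Cliques E cl) (hall : ∀ v, E.V v → cl v ≠ 0) (hst : ∀ y, s.arr .stamp y = 0)
    (hed : s.reg .edges = 0)
    (hR : ¬ E.Yes → ∀ t', t' ≤ t + 1000 + 1000 * (E.n + E.off (E.n + 1)) → R t')
    (hN : ∀ s' t', Agree buildRoot s s' → Built cl E.A s' →
      t' ≤ t + 1000 + 1000 * (E.n + E.off (E.n + 1)) → N s' t') :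
    Runs buildRoot N R s t := by
  set p := s.reg .placed with hp
  set ord := s.arr .order with hord
  refine runs_forRange (fun k s' t' => Built cl (fun a b => E.A a b ∧ ∃ j, j < k ∧ ord j = a) s' ∧
    t' ≤ t + 20 + 100 * k + 100 * ∑ j ∈ Finset.range k, E.deg (ord j)) 0 p (by decide) rfl
    (by omega) ?_ (fun i s' t' hag _ => ?_) ?_ ?_
  · refine ⟨⟨?_, fun x y => ?_, fun y hy => ?_, ?_⟩, ?_⟩
    · rintro a b c d ⟨-, j, hj, -⟩
      omega
    · simp [hed]
    · exact absurd (hst y) hy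
    · rintro a b ⟨-, j, hj, -⟩
      omega
    · simp only [Exp.cost, Finset.range_zero, Finset.sum_empty]
      omega
  · simp only [Exp.eval]
    exact hag.reg _ (by decide)
  · rintro k s₁ t₁ hag - hk hrk ⟨hB, ht⟩
    have hB₁ : Base E s₁ := hs.agree hag (by decide)
    have hord₁ : s₁.arr .order = ord := hag.arr _ (by decide)
    have hcl₁ : s₁.arr .clique = cl := (hag.arr _ (by decide)).trans hcl
    obtain ⟨hbk, hbs⟩ := hM.sum_order_le (k := k + 1) hk
    rw [Finset.sum_range_succ, ← hord] at hbs
    obtain ⟨v, hv⟩ : ∃ v, v = ord k := ⟨_, rfl⟩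
    rw [← hv] at hbs
    have hV : E.V v := hv ▸ (hM.order_mem k hk).1
    have hoff := E.off_succ hV.1 hV.2
    have hD0 : ¬ ∃ j, j < k ∧ ord j = v := by
      rintro ⟨j, hj, hj'⟩
      have := hM.order_inj j k (by omega) hk (hj'.trans hv)
      omega
    rw [runs_seq, runs_set]
    simp only [Exp.eval, hrk, hord₁, ← hv]
    refine runs_forNeighbors (E := E) (fun i s' t' => Built cl (fun a b =>
      (E.A a b ∧ ∃ j, j < k ∧ ord j = a) ∨ a = v ∧ Before E v i b) s' ∧
      t' ≤ t + 40 + 100 * k + 100 * ∑ j ∈ Finset.range k, E.deg (ord j) + 100 * (i - E.off v))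
      v (hB₁.setReg _ _ (by simp)) (by simp) hV (by decide) (by decide) (by decide) ?_ ?_ ?_
    · refine ⟨(hB.congr fun a b => or_iff_left ?_).of_eq (by simp) (by simp), ?_⟩
      · rintro ⟨-, i, h1, h2, -⟩
        omega
      · simp only [Exp.cost]
        omega
    · rintro i s₂ t₂ hag₂ hB₂ hv₂ h1 h2 hA hri ⟨hBu, ht₂⟩
      refine runs_recordEdge (cl := cl) (D := fun a b =>
        (E.A a b ∧ ∃ j, j < k ∧ ord j = a) ∨ a = v ∧ Before E v i b) (v := v) (w := E.adj i)
        ?_ hC hall (hBu.of_eq (by simp) (by simp)) (by simp [hv₂]) (by simp) hA ?_ ?_ ?_ ?_ ?_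
      · exact (hag₂.arr _ (by decide)).trans hcl₁
      · rintro a b (⟨h, -⟩ | ⟨rfl, j, h3, h4, rfl⟩)
        · exact h
        · exact A_adj hV h3 (by omega)
      · rintro (⟨-, h⟩ | ⟨-, h⟩)
        · exact hD0 h
        · exact not_before_self hV h2 h
      · rintro a b (⟨-, j, hj, rfl⟩ | ⟨rfl, -⟩)
        · have := hM.order_mono j k (by omega) hk
          rw [hcl] at this
          rw [hv]
          exact this
        · exact le_rfl
      · intro h t' ht'
        refine hR h t' ?_
        omega
      · intro s₃ t₃ hBu₃ ht₃
        refine ⟨(hBu₃.congr fun a b => ?_).of_eq (by simp) (by simp), by omega⟩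
        rw [before_succ h1, and_or_left, or_assoc]
    · rintro s₂ t₂ hag₂ hB₂ hv₂ ⟨hBu, ht₂⟩
      refine ⟨(hBu.congr fun a b => ?_).of_eq (by simp) (by simp), ?_⟩
      · constructor
        · rintro ⟨hA, j, hj, rfl⟩
          by_cases hjk : j = k
          · subst hjk
            exact Or.inr ⟨hv.symm, hv ▸ before_all hA⟩
          · exact Or.inl ⟨hA, j, by omega, rfl⟩
        · rintro (⟨hA, j, hj, rfl⟩ | ⟨rfl, j, h3, h4, rfl⟩)
          · exact ⟨hA, j, by omega, rfl⟩
          · exact ⟨A_adj hV h3 h4, k, by omega, hv.symm⟩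
      · rw [Finset.sum_range_succ, ← hv]
        omega
  · rintro s₁ t₁ hag ⟨hB, ht⟩
    obtain ⟨hbk, hbs⟩ := hM.sum_order_le (k := p) le_rfl
    rw [← hord] at hbs
    refine hN s₁ _ hag (hB.congr fun a b => ⟨fun h => ⟨h, ?_⟩, fun h => h.1⟩) ?_
    · obtain ⟨k, hk, hk'⟩ := hM.order_surj a (A.left h) (by rw [hcl]; exact hall a (A.left h))
      exact ⟨k, hk, hk'⟩
    · simp only [Exp.cost]
      omega

theorem Built.good {cl : ℕ → ℕ} (h : Built cl E.A s) (hC : Cliques E cl)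
    (hall : ∀ v, E.V v → cl v ≠ 0) : Good E cl where
  clique hv hv' hw hw' hne heq := hC.adj ⟨hv, hv'⟩ ⟨hw, hw'⟩ hne (hall _ ⟨hv, hv'⟩) heq
  outside ha hb := hC.outside (hall _ (A.left ha)) ha hb
  edge := h.unique

/-! ## Sorting the adjacency lists -/

/-- A graph on the numbers `1, …, n` with adjacency lists in any order. -/
structure Raw where
  n : ℕ
  A : ℕ → ℕ → Prop
  off : ℕ → ℕ
  input : ℕ → ℕ
  symm : ∀ {v w}, A v w → A w v
  irrefl : ∀ {v}, ¬ A v v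
  bound : ∀ {v w}, A v w → 1 ≤ v ∧ v ≤ n
  off_one : off 1 = 0
  off_le : ∀ {v}, 1 ≤ v → v ≤ n → off v ≤ off (v + 1)
  inj : ∀ {v i j}, 1 ≤ v → v ≤ n → off v ≤ i → i < off (v + 1) → off v ≤ j → j < off (v + 1) →
    input i = input j → i = j
  mem : ∀ {v w}, 1 ≤ v → v ≤ n → (A v w ↔ ∃ i, off v ≤ i ∧ i < off (v + 1) ∧ input i = w)

variable {F : Raw}

theorem Raw.off_mono {v w : ℕ} (hv : 1 ≤ v) (hw : w ≤ F.n + 1) (h : v ≤ w) : F.off v ≤ F.off w := by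
  induction w, h using Nat.le_induction with
  | base => exact le_rfl
  | succ w hvw ih => exact (ih (by omega)).trans (F.off_le (by omega) (by omega))

/-- The cells of different adjacency lists are different. -/
theorem Raw.eq_of_cell {v w i : ℕ} (hv : 1 ≤ v ∧ v ≤ F.n) (hw : 1 ≤ w ∧ w ≤ F.n) (h1 : F.off v ≤ i)
    (h2 : i < F.off (v + 1)) (h3 : F.off w ≤ i) (h4 : i < F.off (w + 1)) : v = w := by
  rcases lt_trichotomy v w with h | h | h
  · have := F.off_mono (v := v + 1) (w := w) (by omega) (by omega) h
    omega
  · exact h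
  · have := F.off_mono (v := w + 1) (w := v) (by omega) (by omega) h
    omega

theorem Raw.card_image_input {v : ℕ} (hv : 1 ≤ v ∧ v ≤ F.n) :
    ((Finset.Ico (F.off v) (F.off (v + 1))).image F.input).card = F.off (v + 1) - F.off v := by
  rw [Finset.card_image_of_injOn, Nat.card_Ico]
  intro i hi j hj h
  rw [Finset.coe_Ico, Set.mem_Ico] at hi hj
  exact F.inj hv.1 hv.2 hi.1 hi.2 hj.1 hj.2 h

theorem Raw.mem_image_input {v w : ℕ} (hv : 1 ≤ v ∧ v ≤ F.n) :
    w ∈ (Finset.Ico (F.off v) (F.off (v + 1))).image F.input ↔ F.A v w := by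
  simp [F.mem hv.1 hv.2, and_assoc]

/-- The input is in the memory. -/
structure RawBase (F : Raw) (s : State) : Prop where
  n : s.reg .n = F.n
  off : s.arr .off = F.off
  input : s.arr .input = F.input

theorem RawBase.agree {c : Cmd} (h : RawBase F s) (h' : Agree c s s')
    (hc : Reg.n ∉ c.regs ∧ Arr.off ∉ c.arrs ∧ Arr.input ∉ c.arrs) : RawBase F s' :=
  ⟨(h'.reg _ hc.1).trans h.n, (h'.arr _ hc.2.1).trans h.off, (h'.arr _ hc.2.2).trans h.input⟩

/-- The pairs `vw` with `D v w` have been distributed: `v` has been appended to the list of `w`. -/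
structure Distributed (F : Raw) (D : ℕ → ℕ → Prop) (s : State) : Prop where
  le : ∀ w, 1 ≤ w → w ≤ F.n → s.arr .current w ≤ F.off (w + 1)
  deg : ∀ w, 1 ≤ w → w ≤ F.n → s.arr .current w = F.off w + s.arr .deg w
  mono : ∀ w i j, 1 ≤ w → w ≤ F.n → F.off w ≤ i → i < j → j < s.arr .current w →
    s.arr .adj i < s.arr .adj j
  mem : ∀ v w, 1 ≤ w → w ≤ F.n →
    (D v w ↔ ∃ i, F.off w ≤ i ∧ i < s.arr .current w ∧ s.arr .adj i = v)

theorem Distributed.congr {D D' : ℕ → ℕ → Prop} (h : Distributed F D s)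
    (hD : ∀ v w, D' v w ↔ D v w) : Distributed F D' s := by
  obtain rfl : D' = D := funext fun v => funext fun w => propext (hD v w)
  exact h

theorem Distributed.of_eq {D : ℕ → ℕ → Prop} (h : Distributed F D s) (h1 : s'.arr = s.arr) :
    Distributed F D s' := by
  constructor <;> rw [h1]
  exacts [h.le, h.deg, h.mono, h.mem]

theorem Distributed.injOn {D : ℕ → ℕ → Prop} (h : Distributed F D s) {w : ℕ} (hw : 1 ≤ w ∧ w ≤ F.n) :
    Set.InjOn (s.arr .adj) (Finset.Ico (F.off w) (s.arr .current w)) := by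
  intro i hi j hj heq
  rw [Finset.coe_Ico, Set.mem_Ico] at hi hj
  rcases lt_trichotomy i j with h1 | h1 | h1
  · have := h.mono w i j hw.1 hw.2 hi.1 h1 hj.2
    omega
  · exact h1
  · have := h.mono w j i hw.1 hw.2 hj.1 h1 hi.2
    omega

/-- The entries already in the list of `w` are distinct neighbours of `w`, and `u` is one more. So
there is still a free cell, and appending does not run into the next list. -/
theorem Distributed.lt {D : ℕ → ℕ → Prop} (h : Distributed F D s) {u w : ℕ} (hA : F.A u w)
    (hDA : ∀ a b, D a b → F.A a b) (hD : ¬ D u w) : s.arr .current w < F.off (w + 1) := by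
  have hw := F.bound (F.symm hA)
  have h1 : insert u ((Finset.Ico (F.off w) (s.arr .current w)).image (s.arr .adj)) ⊆
      (Finset.Ico (F.off w) (F.off (w + 1))).image F.input := by
    intro x hx
    rw [F.mem_image_input hw]
    rcases Finset.mem_insert.1 hx with rfl | hx
    · exact F.symm hA
    · simp only [Finset.mem_image, Finset.mem_Ico] at hx
      obtain ⟨i, hi, hi'⟩ := hx
      exact F.symm (hDA x w ((h.mem x w hw.1 hw.2).2 ⟨i, hi.1, hi.2, hi'⟩))
  have h2 := Finset.card_le_card h1
  rw [Finset.card_insert_of_notMem, Finset.card_image_of_injOn (h.injOn hw), Nat.card_Ico,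
    F.card_image_input hw] at h2
  · have := h.deg w hw.1 hw.2
    omega
  · simp only [Finset.mem_image, Finset.mem_Ico]
    rintro ⟨i, hi, hi'⟩
    exact hD ((h.mem u w hw.1 hw.2).2 ⟨i, hi.1, hi.2, hi'⟩)

/-- Once all pairs have been distributed, the entries comprise all neighbours of `w`; by counting,
the cells reserved for `w` are full. -/
theorem Distributed.current_eq (h : Distributed F F.A s) {w : ℕ} (hw : 1 ≤ w ∧ w ≤ F.n) :
    s.arr .current w = F.off (w + 1) := by
  have h1 : (Finset.Ico (F.off w) (F.off (w + 1))).image F.input ⊆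
      (Finset.Ico (F.off w) (s.arr .current w)).image (s.arr .adj) := by
    intro x hx
    rw [F.mem_image_input hw] at hx
    obtain ⟨i, h1, h2, h3⟩ := (h.mem x w hw.1 hw.2).1 (F.symm hx)
    exact Finset.mem_image.2 ⟨i, Finset.mem_Ico.2 ⟨h1, h2⟩, h3⟩
  have h2 := Finset.card_le_card h1
  rw [Finset.card_image_of_injOn (h.injOn hw), Nat.card_Ico, F.card_image_input hw] at h2
  have := h.deg w hw.1 hw.2
  have := h.le w hw.1 hw.2
  have := F.off_le hw.1 hw.2
  omega

/-- The graph with the sorted adjacency lists. -/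
def Distributed.net (h : Distributed F F.A s) : Net where
  n := F.n
  A := F.A
  off := F.off
  adj := s.arr .adj
  deg := s.arr .deg
  symm := F.symm
  irrefl := F.irrefl
  bound := F.bound
  off_one := F.off_one
  off_succ {v} hv hv' := by rw [← h.current_eq ⟨hv, hv'⟩, h.deg v hv hv']
  mono {v i j} hv hv' h1 h2 h3 := h.mono v i j hv hv' h1 h2 (by rwa [h.current_eq ⟨hv, hv'⟩])
  mem {v w} hv hv' := by
    rw [← h.current_eq ⟨hv, hv'⟩, ← h.mem w v hv hv']
    exact ⟨F.symm, F.symm⟩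

theorem runs_distribute {D : ℕ → ℕ → Prop} {u w i : ℕ} (hs : RawBase F s) (hi : s.reg .i = i)
    (hu : s.reg .u = u) (hw : F.input i = w) (hA : F.A u w) (hB : Distributed F D s)
    (hDA : ∀ a b, D a b → F.A a b) (hD : ¬ D u w) (hle : ∀ a b, D a b → a ≤ u)
    (hN : ∀ s' t', Distributed F (fun a b => D a b ∨ a = u ∧ b = w) s' → t' ≤ t + 50 → N s' t') :
    Runs (.set .w (.cell .input Reg.i) ;;
       .store .adj (.cell .current Reg.w) Reg.u ;;
       .store .current Reg.w (.succ (.cell .current Reg.w)) ;;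
       .store .deg Reg.w (.succ (.cell .deg Reg.w))) N R s t := by
  have hV := F.bound (F.symm hA)
  have hlt := hB.lt hA hDA hD
  have hdeg := hB.deg w hV.1 hV.2
  simp only [runs_seq, runs_set, runs_store]
  refine hN _ _ ?_ ?_
  · simp only [Exp.eval, hi, hs.input, hw]
    constructor
    · intro x hx hx'
      by_cases hxw : x = w
      · simp [hxw]
        omega
      · simpa [hxw] using hB.le x hx hx'
    · intro x hx hx'
      by_cases hxw : x = w
      · simp [hxw]
        omega
      · simpa [hxw] using hB.deg x hx hx'
    · intro x a b hx hx' h1 h2 h3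
      by_cases hxw : x = w
      · subst hxw
        simp only [State.setReg_reg, State.setCell_reg, State.setReg_arr, State.setCell_arr,
          reduceCtorEq, if_true, if_false, Function.update_self, hu] at h3 ⊢
        rw [Function.update_of_ne (by omega : a ≠ _)]
        by_cases hb : b = s.arr .current x
        · subst hb
          rw [Function.update_self]
          -- The lists stay sorted because vertices are distributed in ascending order: every
          -- earlier entry is at most `u`, and it is not `u` because that pair is new.
          have h4 := (hB.mem (s.arr .adj a) x hx hx').2 ⟨a, h1, by omega, rfl⟩
          have h5 := hle _ _ h4
          refine lt_of_le_of_ne h5 fun h => hD (h ▸ h4)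
        · rw [Function.update_of_ne hb]
          exact hB.mono x a b hx hx' h1 h2 (by omega)
      · simp only [State.setReg_reg, State.setCell_reg, State.setReg_arr, State.setCell_arr,
          reduceCtorEq, if_true, if_false, Function.update_of_ne hxw] at h3 ⊢
        have hx1 := hB.le x hx hx'
        rw [Function.update_of_ne, Function.update_of_ne]
        · exact hB.mono x a b hx hx' h1 h2 h3
        · rintro rfl
          exact hxw (F.eq_of_cell ⟨hx, hx'⟩ hV (by omega) (by omega) (by omega) hlt)
        · rintro rfl
          exact hxw (F.eq_of_cell ⟨hx, hx'⟩ hV (by omega) (by omega) (by omega) hlt)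
    · intro v x hx hx'
      rw [hB.mem v x hx hx']
      by_cases hxw : x = w
      · subst hxw
        simp only [State.setReg_reg, State.setCell_reg, State.setReg_arr, State.setCell_arr,
          reduceCtorEq, if_true, if_false, Function.update_self, hu, and_true]
        constructor
        · rintro (⟨j, h1, h2, h3⟩ | rfl)
          · exact ⟨j, h1, by omega, by rwa [Function.update_of_ne (by omega)]⟩
          · exact ⟨s.arr .current x, by omega, by omega, by simp⟩
        · rintro ⟨j, h1, h2, h3⟩
          by_cases hj : j = s.arr .current x
          · rw [hj, Function.update_self] at h3
            exact Or.inr h3.symm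
          · rw [Function.update_of_ne hj] at h3
            exact Or.inl ⟨j, h1, by omega, h3⟩
      · simp only [State.setReg_reg, State.setCell_reg, State.setReg_arr, State.setCell_arr,
          reduceCtorEq, if_true, if_false, Function.update_of_ne hxw, hxw, and_false, or_false]
        have hx1 := hB.le x hx hx'
        refine exists_congr fun j => and_congr_right fun h1 => and_congr_right fun h2 => ?_
        rw [Function.update_of_ne]
        rintro rfl
        exact hxw (F.eq_of_cell ⟨hx, hx'⟩ hV (by omega) (by omega) (by omega) hlt)
  · simp only [Exp.cost]
    omega

theorem runs_sortLists (hs : RawBase F s) (hd : ∀ v, s.arr .deg v = 0)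
    (hN : ∀ s' t', Agree sortLists s s' → RawBase F s' → Distributed F F.A s' →
      t' ≤ t + 200 + 300 * (F.n + F.off (F.n + 1)) → N s' t') : Runs sortLists N R s t := by
  refine Runs.spec (N := fun s' t' => Distributed F F.A s' ∧
    t' ≤ t + 200 + 300 * (F.n + F.off (F.n + 1))) ?_
    fun s' t' h h' => hN s' t' h (hs.agree h (by decide)) h'.1 h'.2
  rw [sortLists, runs_seq]
  refine runs_forVertices (fun i s' t' => (∀ v, 1 ≤ v → v < i → s'.arr .current v = F.off v) ∧
    t' ≤ t + 50 * i) F.n (by decide) hs.n (by decide) ⟨fun v h1 h2 => by omega, by omega⟩ ?_ ?_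
  · rintro i s₁ t₁ hag h1 h2 hri ⟨hc, ht⟩
    have hB₁ := hs.agree hag (by decide)
    rw [runs_store]
    refine ⟨fun v h3 h4 => ?_, ?_⟩
    · by_cases hvi : v = i
      · simp [hvi, hri, hB₁.off]
      · simpa [hri, hvi] using hc v h3 (by omega)
    · simp only [Exp.cost]
      omega
  rintro s₁ t₁ hag ⟨hc, ht₁⟩
  have hB₁ := hs.agree hag (by decide)
  have hd₁ : ∀ v, s₁.arr .deg v = 0 := fun v => by rw [hag.arr _ (by decide), hd]
  refine runs_forVertices (fun u s' t' => Distributed F (fun a b => F.A a b ∧ a < u) s' ∧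
    t' ≤ t₁ + 50 * u + 100 * F.off u) F.n (by decide) hB₁.n (by decide) ?_ ?_ ?_
  · refine ⟨⟨fun w h1 h2 => ?_, fun w h1 h2 => ?_, fun w i j h1 h2 h3 h4 h5 => ?_,
      fun v w h1 h2 => ?_⟩, by omega⟩
    · simpa [hc w h1 (by omega)] using F.off_le h1 h2
    · simpa [hd₁] using hc w h1 (by omega)
    · simp only [State.setReg_arr] at h5
      rw [hc w h1 (by omega)] at h5
      omega
    · simp only [State.setReg_arr]
      rw [hc w h1 (by omega)]
      refine iff_of_false ?_ (by rintro ⟨i, h3, h4, -⟩; omega)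
      rintro ⟨hA, hlt⟩
      have := (F.bound hA).1
      omega
  · rintro u s₂ t₂ hag₂ hu1 hu2 hru ⟨hD₂, ht₂⟩
    have hB₂ := hB₁.agree hag₂ (by decide)
    have hoff := F.off_le hu1 hu2
    refine runs_forRange (fun i s' t' => Distributed F (fun a b => F.A a b ∧ a < u ∨
      a = u ∧ ∃ j, F.off u ≤ j ∧ j < i ∧ F.input j = b) s' ∧
      t' ≤ t₂ + 20 + 100 * (i - F.off u)) (F.off u) (F.off (u + 1)) (by decide)
      (by simp [hB₂.off, hru]) hoff ?_ ?_ ?_ ?_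
    · refine ⟨(hD₂.congr fun a b => or_iff_left ?_).of_eq (by simp), ?_⟩
      · rintro ⟨-, i, h1, h2, -⟩
        omega
      · simp only [Exp.cost]
        omega
    · intro i s₃ t₃ hag₃ _
      have hB₃ := hB₂.agree hag₃ (by decide)
      have hu₃ : s₃.reg .u = u := (hag₃.reg _ (by decide)).trans hru
      simp [hB₃.off, hu₃]
    · rintro i s₃ t₃ hag₃ h1 h2 hri ⟨hD₃, ht₃⟩
      have hB₃ := hB₂.agree hag₃ (by decide)
      have hu₃ : s₃.reg .u = u := (hag₃.reg _ (by decide)).trans hru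
      have hA : F.A u (F.input i) := (F.mem hu1 hu2).2 ⟨i, h1, h2, rfl⟩
      refine runs_distribute hB₃ hri hu₃ rfl hA hD₃ ?_ ?_ ?_ fun s₄ t₄ hD₄ ht₄ => ?_
      · rintro a b (⟨h, -⟩ | ⟨rfl, j, h3, h4, rfl⟩)
        · exact h
        · exact (F.mem hu1 hu2).2 ⟨j, h3, by omega, rfl⟩
      · rintro (⟨-, h⟩ | ⟨-, j, h3, h4, h5⟩)
        · omega
        · have := F.inj hu1 hu2 h3 (by omega) h1 h2 h5
          omega
      · rintro a b (⟨-, h⟩ | ⟨h, -⟩) <;> omega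
      · refine ⟨(hD₄.congr fun a b => ?_).of_eq (by simp), ?_⟩
        · rw [or_assoc, ← and_or_left]
          refine or_congr_right (and_congr_right fun _ => ⟨?_, ?_⟩)
          · rintro ⟨j, h3, h4, h5⟩
            by_cases hj : j = i
            · exact Or.inr (hj ▸ h5.symm)
            · exact Or.inl ⟨j, h3, by omega, h5⟩
          · rintro (⟨j, h3, h4, h5⟩ | h)
            · exact ⟨j, h3, by omega, h5⟩
            · exact ⟨i, h1, by omega, h.symm⟩
        · simp only [Exp.cost] at ht₄
          omega
    · rintro s₃ t₃ hag₃ ⟨hD₃, ht₃⟩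
      refine ⟨(hD₃.congr fun a b => ?_).of_eq (by simp), ?_⟩
      · rw [← F.mem hu1 hu2]
        constructor
        · rintro ⟨hA, hlt⟩
          by_cases ha : a = u
          · exact Or.inr ⟨ha, ha ▸ hA⟩
          · exact Or.inl ⟨hA, by omega⟩
        · rintro (⟨hA, hlt⟩ | ⟨rfl, hA⟩)
          · exact ⟨hA, by omega⟩
          · exact ⟨hA, by omega⟩
      · simp only [Exp.cost]
        omega
  · rintro s₂ t₂ hag₂ ⟨hD₂, ht₂⟩
    refine ⟨hD₂.congr fun a b => (and_iff_left_of_imp fun h => ?_).symm, by omega⟩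
    exact Nat.lt_succ_of_le (F.bound h).2

/-! ## Initializing the fields of the vertices -/

theorem runs_initFields (hs : Base E s) (hcl : ∀ v, s.arr .clique v = 0)
    (hout : ∀ v, s.arr .outsider v = 0) (hpl : s.reg .placed = 0)
    (hsz : ∀ c, s.arr .size c = 0)
    (hN : ∀ s' t', Agree initFields s s' → Inv E s' → t' ≤ t + 100 + 100 * E.n → N s' t') :
    Runs initFields N R s t := by
  refine Runs.spec (N := fun s' t' => (∀ v, s'.arr .clique v = 0) ∧ (∀ v, s'.arr .outsider v = 0) ∧
    (∀ v, E.V v → s'.arr .current v = E.off v) ∧ t' ≤ t + 100 + 100 * E.n) ?_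
    fun s' t' hag ⟨h1, h2, h3, h4⟩ => hN s' t' hag ?_ h4
  · rw [initFields]
    refine runs_forVertices (fun i s' t' => (∀ v, s'.arr .clique v = 0) ∧
      (∀ v, s'.arr .outsider v = 0) ∧ (∀ v, 1 ≤ v → v < i → s'.arr .current v = E.off v) ∧
      t' ≤ t + 50 * i) E.n (by decide) hs.n (by decide)
      ⟨hcl, hout, fun v h1 h2 => by omega, by omega⟩ ?_ ?_
    · rintro i s₁ t₁ hag h1 h2 hri ⟨h3, h4, h5, ht⟩
      have hB₁ := hs.agree hag (by decide)
      simp only [runs_seq, runs_store]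
      refine ⟨fun v => ?_, fun v => ?_, fun v hv hv' => ?_, ?_⟩
      · simp [Function.update_apply, h3]
      · simp [Function.update_apply, h4]
      · by_cases hvi : v = i
        · simp [hvi, hri, hB₁.off]
        · simpa [hri, hvi] using h5 v hv (by omega)
      · simp only [Exp.cost]
        omega
    · rintro s₁ t₁ hag ⟨h3, h4, h5, ht⟩
      exact ⟨h3, h4, fun v hv => h5 v hv.1 (Nat.lt_succ_of_le hv.2), by omega⟩
  · have hpl' : s'.reg .placed = 0 := (hag.reg _ (by decide)).trans hpl
    have hsz' : s'.arr .size = s.arr .size := hag.arr _ (by decide)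
    refine ⟨hs.agree hag (by decide), ⟨fun v => by simp [h1], fun k hk => by omega,
      fun k l hk => by omega, fun v _ hv => absurd (h1 v) hv, fun k l _ hl => by omega,
      fun c hc => ?_⟩, ⟨fun _ _ _ h => absurd (h1 _) h, fun h => absurd (h1 _) h⟩,
      fun v w _ h => absurd (h1 v) h, fun z hz => (h3 z hz).ge, fun z hz => ?_,
      fun z hz _ => h3 z hz, fun P _ x _ h => absurd (h2 x) h, fun P _ v w _ _ h => absurd (h1 v) h⟩
    · rw [hsz', hsz]
      simp [h1, hc.symm]
    · rw [h3 z hz]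
      exact off_le_succ hz

end ExpandedClique

namespace ExpandedClique

open Net

/-! ## Expanded-clique graphs and partitions into cliques -/

section Structure

variable {V W : Type*} {G : SimpleGraph W} {f : W → ℕ}

/-- A vertex with a neighbour in another clique has the form `v_{i,j}`, and its label determines
both the clique and the label of that neighbour. -/
theorem expandedCliqueGraph_outside
    {x y z : Σ i : W, G.neighborSet i ⊕ Fin (f i - (G.neighborSet i).ncard)}
    (hy : (expandedCliqueGraph G f).Adj x y) (hz : (expandedCliqueGraph G f).Adj x z)
    (hy' : y.1 ≠ x.1) (hz' : z.1 ≠ x.1) : y = z := by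
  rcases hy with ⟨h, -⟩ | ⟨h1, h2, h3⟩
  · exact absurd h.symm hy'
  rcases hz with ⟨h, -⟩ | ⟨h4, h5, h6⟩
  · exact absurd h.symm hz'
  obtain ⟨y1, y2⟩ := y
  obtain ⟨z1, z2⟩ := z
  rw [h2] at h5
  have : y1 = z1 := congrArg Subtype.val (Sum.inl_injective h5)
  subst this
  rw [Sigma.mk.injEq]
  exact ⟨rfl, heq_of_eq (h3.trans h6.symm)⟩

theorem expandedCliqueGraph_edge
    {a b c d : Σ i : W, G.neighborSet i ⊕ Fin (f i - (G.neighborSet i).ncard)}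
    (hab : (expandedCliqueGraph G f).Adj a b) (hcd : (expandedCliqueGraph G f).Adj c d)
    (hac : a.1 = c.1) (hbd : b.1 = d.1) (hne : a.1 ≠ b.1) : a = c := by
  rcases hab with ⟨h, -⟩ | ⟨h1, h2, -⟩
  · exact absurd h hne
  rcases hcd with ⟨h, -⟩ | ⟨h3, h4, -⟩
  · exact absurd (hac.trans (h.trans hbd.symm)) hne
  obtain ⟨a1, a2⟩ := a
  obtain ⟨b1, b2⟩ := b
  obtain ⟨c1, c2⟩ := c
  obtain ⟨d1, d2⟩ := d
  dsimp only at hac hbd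
  subst hac hbd
  rw [Sigma.mk.injEq]
  exact ⟨rfl, heq_of_eq (h2.trans h4.symm)⟩

/-- A partition of `H` into cliques such that every vertex has at most one neighbour outside its
class and two classes are joined by at most one edge yields a root. -/
theorem isExpandedCliqueOf_of_partition [Finite V] {H : SimpleGraph V} (cl : V → W)
    (hsize : ∀ i, f i = Nat.card {v // cl v = i})
    (hclique : ∀ v w, v ≠ w → cl v = cl w → H.Adj v w)
    (hout : ∀ v a b, H.Adj v a → H.Adj v b → cl a ≠ cl v → cl b ≠ cl v → a = b)
    (hedge : ∀ a b c d, H.Adj a b → H.Adj c d → cl a = cl c → cl b = cl d → cl a ≠ cl b → a = c)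
    (hG : ∀ i j, G.Adj i j ↔ i ≠ j ∧ ∃ v w, H.Adj v w ∧ cl v = i ∧ cl w = j) :
    IsExpandedCliqueOf H G f := by
  -- The vertex `g i j` will play the role of `v_{i,j}`, and `y i j` is its neighbour in the class
  -- of `j`. Different `j` need different vertices, because outside neighbours are unique.
  have hex : ∀ i (j : G.neighborSet i), ∃ v : {v // cl v = i}, ∃ w, H.Adj v w ∧ cl w = j := by
    rintro i ⟨j, hj⟩
    obtain ⟨-, v, w, h1, h2, h3⟩ := (hG i j).1 hj
    exact ⟨⟨v, h2⟩, w, h1, h3⟩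
  choose g y hy hy' using hex
  have hgi : ∀ i, Function.Injective (g i) := by
    intro i j k hjk
    have hj : (j : W) ≠ i := (((hG i j).1 j.2).1).symm
    have hk : (k : W) ≠ i := (((hG i k).1 k.2).1).symm
    have h1 := hy i j
    have h2 := hy i k
    rw [← hjk] at h2
    have := hout _ _ _ h1 h2 (by rw [hy', (g i j).2]; exact hj) (by rw [hy', (g i j).2]; exact hk)
    refine Subtype.ext ?_
    rw [← hy' i j, ← hy' i k, this]
  have hcard : ∀ i, (G.neighborSet i).ncard ≤ f i := by
    intro i
    rw [hsize, ← Nat.card_coe_set_eq]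
    exact Nat.card_le_card_of_injective _ (hgi i)
  -- The vertices of a class that are not of the form `g i j` are exactly as many as the simplicial
  -- vertices required, and may be matched with them arbitrarily.
  have hcompl : ∀ i, Nat.card ((Set.range (g i))ᶜ : Set _) = f i - (G.neighborSet i).ncard := by
    intro i
    have h1 := Set.ncard_add_ncard_compl (Set.range (g i))
    rw [← hsize i] at h1
    have h2 : (Set.range (g i)).ncard = (G.neighborSet i).ncard := by
      rw [← Nat.card_coe_set_eq, ← Nat.card_coe_set_eq]
      exact (Nat.card_congr (Equiv.ofInjective _ (hgi i))).symm
    rw [Nat.card_coe_set_eq]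
    omega
  classical
  let e : ∀ i, (G.neighborSet i ⊕ Fin (f i - (G.neighborSet i).ncard)) ≃ {v // cl v = i} := fun i =>
    (Equiv.sumCongr (Equiv.ofInjective _ (hgi i)) (Finite.equivFinOfCardEq (hcompl i)).symm).trans
      (Equiv.Set.sumCompl (Set.range (g i)))
  have he : ∀ i j, e i (Sum.inl j) = g i j := fun i j => by simp [e]
  let Ψ : (Σ i, G.neighborSet i ⊕ Fin (f i - (G.neighborSet i).ncard)) ≃ V :=
    (Equiv.sigmaCongrRight e).trans (Equiv.sigmaFiberEquiv cl)
  have hΨ : ∀ i x, Ψ ⟨i, x⟩ = e i x := fun i x => rfl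
  have hcl : ∀ a, cl (Ψ a) = a.1 := fun ⟨i, x⟩ => (e i x).2
  -- Only one edge joins two classes, so its end in class `i` must be the chosen vertex `g i j`.
  have half : ∀ a b, H.Adj (Ψ a) (Ψ b) → ∀ h : G.Adj a.1 b.1, a.2 = Sum.inl ⟨b.1, h⟩ := by
    rintro ⟨i, x⟩ ⟨j, z⟩ hA h
    have h1 := hy i ⟨j, h⟩
    have h2 := hedge _ _ _ _ hA h1 (by rw [hcl, (g i ⟨j, h⟩).2]) (by rw [hcl, hy'])
      (by rw [hcl, hcl]; exact h.ne)
    rw [hΨ, ← he] at h2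
    exact (e i).injective (Subtype.ext h2)
  refine ⟨hcard, ⟨(RelIso.mk Ψ ?_ : expandedCliqueGraph G f ≃g H).symm⟩⟩
  rintro a b
  by_cases hab : a.1 = b.1
  · constructor
    · intro h
      exact Or.inl ⟨hab, fun h' => h.ne (by rw [h'])⟩
    · rintro (⟨-, h⟩ | ⟨h, -⟩)
      · exact hclique _ _ (fun h' => h (Ψ.injective h')) (by rw [hcl, hcl, hab])
      · exact absurd hab h.ne
  · constructor
    · intro h
      have hA : G.Adj a.1 b.1 := (hG _ _).2 ⟨hab, _, _, h, hcl a, hcl b⟩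
      exact Or.inr ⟨hA, half a b h hA, half b a h.symm hA.symm⟩
    · rintro (⟨h, -⟩ | ⟨h, h1, h2⟩)
      · exact absurd h hab
      · obtain ⟨i, x⟩ := a
        obtain ⟨j, z⟩ := b
        dsimp only at h h1 h2 hab
        obtain rfl : x = Sum.inl ⟨j, h⟩ := h1
        obtain rfl : z = Sum.inl ⟨i, h.symm⟩ := h2
        change H.Adj (e i (Sum.inl ⟨j, h⟩)) (e j (Sum.inl ⟨i, h.symm⟩))
        rw [he, he]
        have h3 := hy i ⟨j, h⟩
        have h4 := hy j ⟨i, h.symm⟩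
        have c1 := (g i ⟨j, h⟩).2
        have c2 := (g j ⟨i, h.symm⟩).2
        have c3 := hy' i ⟨j, h⟩
        have c4 := hy' j ⟨i, h.symm⟩
        -- The edge chosen from `i` to `j` and the edge chosen from `j` to `i` are the same, so `g i
        -- j` and `g j i` are adjacent.
        have h5 := hedge _ _ _ _ h3.symm h4 (by rw [c3, c2]) (by rw [c1, c4])
          (by rw [c3, c1]; exact Ne.symm hab)
        rwa [← h5]

end Structure

/-! ## The input -/

section Input

variable {n : ℕ} {H : SimpleGraph (Fin n)} (L : AdjLists H)

theorem off_add_one (a : Fin n) : (inputState L).arr .off ((a : ℕ) + 1 + 1) =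
    (inputState L).arr .off ((a : ℕ) + 1) + (L.list a).length := by
  have h : (a : ℕ) < (List.ofFn L.list).length := by simp
  simp only [inputState, Nat.add_sub_cancel]
  rw [List.take_add_one, List.getElem?_eq_getElem h]
  simp

theorem input_cell (a : Fin n) (j : ℕ) (hj : j < (L.list a).length) :
    (inputState L).arr .input ((inputState L).arr .off ((a : ℕ) + 1) + j) =
      ((L.list a)[j] : ℕ) + 1 := by
  have h : (a : ℕ) < (List.ofFn L.list).length := by simp
  have hsplit : (List.ofFn L.list).flatten = ((List.ofFn L.list).take a).flatten ++
      (L.list a ++ ((List.ofFn L.list).drop (a + 1)).flatten) := by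
    conv_lhs => rw [← List.take_append_drop a (List.ofFn L.list), List.drop_eq_getElem_cons h]
    simp
  have hin : ∀ i, (inputState L).arr .input i =
      ((List.ofFn L.list).flatten.map fun w : Fin n => (w : ℕ) + 1).getD i 0 := by
    intro i
    -- In `inputState` the increment acts on a list of numbers, obtained from the list of vertices
    -- by a coercion that unfolds to `flatMap`.
    change (List.map (fun w : ℕ => w + 1)
      ((List.ofFn L.list).flatten.flatMap fun w : Fin n => [(w : ℕ)])).getD i 0 = _
    rw [List.map_flatMap, List.map_eq_flatMap (f := fun w : Fin n => (w : ℕ) + 1)]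
    rfl
  rw [hin, hsplit]
  simp only [inputState, Nat.add_sub_cancel]
  rw [List.map_append, List.map_append, List.getD_append_right _ _ _ _ (by
    rw [List.length_map]
    omega), List.length_map, Nat.add_sub_cancel_left, List.getD_append _ _ _ _ (by simpa using hj)]
  simp [hj]

/-- The adjacency lists as they are stored in the initial memory. -/
def AdjLists.raw : Raw where
  n := n
  A v w := ∃ a b : Fin n, H.Adj a b ∧ v = (a : ℕ) + 1 ∧ w = (b : ℕ) + 1
  off := (inputState L).arr .off
  input := (inputState L).arr .input
  symm := fun ⟨a, b, h, h1, h2⟩ => ⟨b, a, h.symm, h2, h1⟩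
  irrefl := by
    rintro v ⟨a, b, h, h1, h2⟩
    exact h.ne (Fin.ext (by omega))
  bound := by
    rintro v w ⟨a, b, h, rfl, rfl⟩
    exact ⟨by omega, a.2⟩
  off_one := by simp [inputState]
  off_le {v} hv hv' := by
    obtain ⟨a, rfl⟩ : ∃ a : Fin n, v = (a : ℕ) + 1 := ⟨⟨v - 1, by omega⟩, by simp; omega⟩
    rw [off_add_one]
    omega
  inj {v i j} hv hv' h1 h2 h3 h4 h5 := by
    obtain ⟨a, rfl⟩ : ∃ a : Fin n, v = (a : ℕ) + 1 := ⟨⟨v - 1, by omega⟩, by simp; omega⟩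
    rw [off_add_one] at h2 h4
    obtain ⟨i, rfl⟩ := Nat.exists_eq_add_of_le h1
    obtain ⟨j, rfl⟩ := Nat.exists_eq_add_of_le h3
    rw [input_cell L a i (by omega), input_cell L a j (by omega)] at h5
    rw [(L.nodup a).getElem_inj_iff.1 (Fin.ext (Nat.succ_injective h5))]
  mem {v w} hv hv' := by
    obtain ⟨a, rfl⟩ : ∃ a : Fin n, v = (a : ℕ) + 1 := ⟨⟨v - 1, by omega⟩, by simp; omega⟩
    rw [off_add_one]
    constructor
    · rintro ⟨a', b, h, h1, rfl⟩
      obtain rfl : a = a' := Fin.ext (by omega)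
      obtain ⟨j, hj, rfl⟩ := List.mem_iff_getElem.1 ((L.mem_iff a b).2 h)
      exact ⟨_, Nat.le_add_right _ j, by omega, input_cell L a j hj⟩
    · rintro ⟨i, h1, h2, rfl⟩
      obtain ⟨j, rfl⟩ := Nat.exists_eq_add_of_le h1
      have hj : j < (L.list a).length := by omega
      exact ⟨a, (L.list a)[j], (L.mem_iff _ _).1 (List.getElem_mem hj), rfl, input_cell L a j hj⟩

theorem AdjLists.raw_A (a b : Fin n) : L.raw.A ((a : ℕ) + 1) ((b : ℕ) + 1) ↔ H.Adj a b := by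
  constructor
  · rintro ⟨a', b', h, h1, h2⟩
    obtain rfl : a = a' := Fin.ext (by omega)
    obtain rfl : b = b' := Fin.ext (by omega)
    exact h
  · exact fun h => ⟨a, b, h, rfl, rfl⟩

theorem AdjLists.off_last : L.raw.off (n + 1) = 2 * H.edgeSet.ncard := by
  classical
  have h1 : ∀ a, (L.list a).length = H.degree a := by
    intro a
    rw [← SimpleGraph.card_neighborFinset_eq_degree, ← List.toFinset_card_of_nodup (L.nodup a)]
    congr 1
    ext w
    simp [L.mem_iff]
  have h2 := H.sum_degrees_eq_twice_card_edges
  rw [← Set.ncard_coe_finset, SimpleGraph.coe_edgeFinset] at h2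
  rw [← h2]
  simp only [AdjLists.raw, inputState, Nat.add_sub_cancel]
  rw [List.take_of_length_le (by simp), List.length_flatten, List.map_ofFn, List.sum_ofFn]
  exact Finset.sum_congr rfl fun a _ => h1 a

end Input

variable {n : ℕ} {H : SimpleGraph (Fin n)} {L : AdjLists H} {E : Net} {s : State}

/-- The expanded cliques, pulled back along the isomorphism, form a good partition. The value `0`
for numbers that are not vertices is never consulted, since `Good` speaks only of vertices. -/
theorem yes_of_isExpandedClique (hn : E.n = n) (hA : E.A = L.raw.A) (h : IsExpandedClique H) :
    E.Yes := by
  obtain ⟨p, G, f, -, ⟨φ⟩⟩ := h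
  obtain ⟨P, hP⟩ : ∃ P : ℕ → ℕ, ∀ a : Fin n, P ((a : ℕ) + 1) = (φ a).1 :=
    ⟨fun v => if h : v - 1 < n then (φ ⟨v - 1, h⟩).1 else 0, fun a => by simp⟩
  refine ⟨P, ⟨?_, ?_, ?_⟩⟩
  · intro v w h1 h2 h3 h4 hne h
    rw [hn] at h2 h4
    obtain ⟨a, rfl⟩ : ∃ a : Fin n, v = (a : ℕ) + 1 := ⟨⟨v - 1, by omega⟩, by simp; omega⟩
    obtain ⟨b, rfl⟩ : ∃ b : Fin n, w = (b : ℕ) + 1 := ⟨⟨w - 1, by omega⟩, by simp; omega⟩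
    rw [hA, AdjLists.raw_A, ← φ.map_adj_iff]
    rw [hP, hP] at h
    exact Or.inl ⟨Fin.ext h, fun h' => hne (by rw [φ.injective h'])⟩
  · intro v a b ha hb h1 h2
    rw [hA] at ha hb
    obtain ⟨v, a, ha, rfl, rfl⟩ := ha
    obtain ⟨v', b, hb, h, rfl⟩ := hb
    obtain rfl : v = v' := Fin.ext (by omega)
    rw [hP, hP] at h1 h2
    rw [← φ.map_adj_iff] at ha hb
    rw [φ.injective (expandedCliqueGraph_outside ha hb (fun h => h1 (by rw [h]))
      fun h => h2 (by rw [h]))]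
  · intro a b c d hab hcd h1 h2 h3
    rw [hA] at hab hcd
    obtain ⟨a, b, hab, rfl, rfl⟩ := hab
    obtain ⟨c, d, hcd, rfl, rfl⟩ := hcd
    rw [hP, hP] at h1 h2 h3
    rw [← φ.map_adj_iff] at hab hcd
    rw [φ.injective (expandedCliqueGraph_edge hab hcd (Fin.ext h1) (Fin.ext h2)
      fun h => h3 (by rw [h]))]

theorem isExpandedCliqueOf_output (hn : E.n = n) (hA : E.A = L.raw.A) {cl : ℕ → ℕ}
    (hB : Built cl E.A s) (hC : Cliques E cl) (hall : ∀ v, E.V v → cl v ≠ 0)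
    (hle : ∀ v, cl v ≤ s.reg .cliques)
    (hsize : ∀ c, c ≠ 0 → s.arr .size c = ((Finset.Icc 1 n).filter fun v => cl v = c).card) :
    IsExpandedCliqueOf H (outputGraph s) (outputFun s) := by
  have hgood := hB.good hC hall
  have hpos : ∀ a : Fin n, cl ((a : ℕ) + 1) ≠ 0 := fun a => hall _ ⟨by omega, by have := a.2; omega⟩
  obtain ⟨k, hk⟩ : ∃ k : Fin n → Fin (s.reg .cliques), ∀ a, (k a : ℕ) + 1 = cl ((a : ℕ) + 1) :=
    ⟨fun a => ⟨cl ((a : ℕ) + 1) - 1, by have := hpos a; have := hle ((a : ℕ) + 1); omega⟩,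
      fun a => by have := hpos a; simp only; omega⟩
  have hkk : ∀ a b, k a = k b ↔ cl ((a : ℕ) + 1) = cl ((b : ℕ) + 1) := by
    intro a b
    rw [← hk, ← hk, Fin.ext_iff]
    omega
  have hEA : ∀ a b : Fin n, E.A ((a : ℕ) + 1) ((b : ℕ) + 1) ↔ H.Adj a b := fun a b => by
    rw [hA, AdjLists.raw_A]
  refine isExpandedCliqueOf_of_partition k (fun i => ?_) (fun v w hne h => ?_)
    (fun v a b ha hb h1 h2 => ?_) (fun a b c d hab hcd h1 h2 h3 => ?_) fun i j => ?_
  · rw [outputFun, hsize _ (by omega), Nat.card_eq_fintype_card, Fintype.card_subtype,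
      ← Finset.card_image_of_injective _ (f := fun a : Fin n => (a : ℕ) + 1) fun a b h =>
        Fin.ext (Nat.succ_injective h)]
    congr 1
    ext v
    simp only [Finset.mem_filter, Finset.mem_Icc, Finset.mem_image, Finset.mem_univ, true_and]
    constructor
    · rintro ⟨⟨h1, h2⟩, h3⟩
      refine ⟨⟨v - 1, by omega⟩, Fin.ext ?_, by simp; omega⟩
      have := hk ⟨v - 1, by omega⟩
      rw [show (⟨v - 1, by omega⟩ : Fin n).val + 1 = v by simp; omega] at this
      omega
    · rintro ⟨a, rfl, rfl⟩
      exact ⟨⟨by omega, a.2⟩, (hk a).symm⟩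
  · rw [← hEA]
    rw [hkk] at h
    exact hgood.clique (by omega) (by have := v.2; omega) (by omega) (by have := w.2; omega)
      (fun h' => hne (Fin.ext (by omega))) h
  · rw [← hEA] at ha hb
    rw [Ne, hkk] at h1 h2
    exact Fin.ext (Nat.succ_injective (hgood.outside ha hb h1 h2))
  · rw [← hEA] at hab hcd
    rw [Ne, hkk] at h3
    rw [hkk] at h1 h2
    exact Fin.ext (Nat.succ_injective (hgood.edge hab hcd h1 h2 h3))
  -- Edges are stored only with the smaller clique number first; `SimpleGraph.fromRel` restores the
  -- symmetry.
  · have key : ∀ i j : Fin (s.reg .cliques), (∃ k < s.reg .edges,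
        s.arr .edgeFst k = (i : ℕ) + 1 ∧ s.arr .edgeSnd k = (j : ℕ) + 1) ↔
        (∃ v w, H.Adj v w ∧ k v = i ∧ k w = j) ∧ i < j := by
      intro i j
      rw [hB.edges]
      constructor
      · rintro ⟨v, w, h, h1, h2, h3⟩
        rw [hA] at h
        obtain ⟨v, w, h, rfl, rfl⟩ := h
        rw [← hk] at h1 h2
        exact ⟨⟨v, w, h, Fin.ext (by omega), Fin.ext (by omega)⟩, Fin.lt_def.2 (by omega)⟩
      · rintro ⟨⟨v, w, h, rfl, rfl⟩, hlt⟩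
        exact ⟨_, _, (hEA v w).2 h, (hk v).symm, (hk w).symm, by have := Fin.lt_def.1 hlt; omega⟩
    rw [outputGraph, SimpleGraph.fromRel_adj, key, key]
    refine and_congr_right fun hne => ⟨?_, fun h => ?_⟩
    · rintro (⟨h, -⟩ | ⟨⟨v, w, h1, h2, h3⟩, -⟩)
      · exact h
      · exact ⟨w, v, h1.symm, h3, h2⟩
    · rcases lt_or_gt_of_ne hne with hlt | hlt
      · exact Or.inl ⟨h, hlt⟩
      · obtain ⟨v, w, h1, h2, h3⟩ := h
        exact Or.inr ⟨⟨w, v, h1.symm, h3, h2⟩, hlt⟩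

/-! ## The algorithm -/

/-- The phases are chained with one condition for `ret`: every premature end comes with the absence
of a good partition. The graph `E` exists only after the sorting, as its adjacency array is the
sorted one. -/
theorem runs_recognize {n : ℕ} {H : SimpleGraph (Fin n)} (L : AdjLists H) :
    Runs recognize (fun s t => s.reg .answer = 1 ∧ IsExpandedCliqueOf H (outputGraph s) (outputFun s) ∧
        t ≤ 30000 + 50000 * (n + L.raw.off (n + 1)))
      (fun t => ¬ IsExpandedClique H ∧ t ≤ 30000 + 50000 * (n + L.raw.off (n + 1)))
      (inputState L) 0 := by
  rw [recognize, runs_seq]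
  refine runs_sortLists (F := L.raw) ⟨rfl, rfl, rfl⟩ (fun _ => rfl) fun s₁ t₁ a₁ hB₁ hD ht₁ => ?_
  obtain ⟨E, hE⟩ : ∃ E, E = hD.net := ⟨_, rfl⟩
  have hn : E.n = n := by rw [hE]; rfl
  have hA : E.A = L.raw.A := by rw [hE]; rfl
  have hoff : E.off = L.raw.off := by rw [hE]; rfl
  have hno : ¬ E.Yes → ¬ IsExpandedClique H := fun h h' => h (yes_of_isExpandedClique hn hA h')
  have hB : Base E s₁ := by
    rw [hE]
    exact ⟨hB₁.n, hB₁.off, rfl, rfl⟩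
  change t₁ ≤ 0 + 200 + 300 * (n + L.raw.off (n + 1)) at ht₁
  rw [← hoff] at ht₁ ⊢
  rw [runs_seq]
  refine runs_initFields hB (fun v => by rw [a₁.arr _ (by decide)]; rfl)
    (fun v => by rw [a₁.arr _ (by decide)]; rfl) (by rw [a₁.reg _ (by decide)]; rfl)
    (fun v => by rw [a₁.arr _ (by decide)]; rfl) fun s₂ t₂ a₂ hI₂ ht₂ => ?_
  rw [runs_seq]
  refine Runs.spec (N := fun s' t' => Inv E s' ∧ (∀ v, E.V v → 2 < E.deg v → s'.arr .clique v ≠ 0) ∧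
    t' ≤ t₂ + 10000 + 20000 * (E.n + E.off (E.n + 1)))
    (runs_markLarge hI₂ (fun h t' ht' => ⟨hno h, by rw [hn] at ht₂ ht'; omega⟩)
      fun s' t' h1 h2 h3 => ⟨h1, h2, h3⟩) fun s₃ t₃ a₃ h₃ => ?_
  obtain ⟨hI₃, hl₃, ht₃⟩ := h₃
  rw [runs_seq]
  refine Runs.spec (N := fun s' t' => Inv' E s' ∧ (∀ v, E.V v → s'.arr .clique v ≠ 0) ∧
    t' ≤ t₃ + 10000 + 20000 * (E.n + E.off (E.n + 1)))
    (runs_markSmall (hI₃.inv' hl₃) (fun h t' ht' => ⟨hno h, by rw [hn] at ht₂ ht₃ ht'; omega⟩)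
      fun s' t' h1 h2 h3 => ⟨h1, h2, h3⟩) fun s₄ t₄ a₄ h₄ => ?_
  obtain ⟨hI₄, hl₄, ht₄⟩ := h₄
  rw [hn] at ht₂ ht₃ ht₄
  rw [runs_seq]
  refine runs_buildRoot (E := E) hI₄.base rfl hI₄.marked hI₄.cliques hl₄ (fun y => ?_) ?_
    (fun h t' ht' => ⟨hno h, by rw [hn] at ht'; omega⟩) fun s₅ t₅ a₅ hBu ht₅ => ?_
  · rw [a₄.arr _ (by decide), a₃.arr _ (by decide), a₂.arr _ (by decide), a₁.arr _ (by decide)]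
    rfl
  · rw [a₄.reg _ (by decide), a₃.reg _ (by decide), a₂.reg _ (by decide), a₁.reg _ (by decide)]
    rfl
  · rw [runs_set]
    have hcq : s₅.reg .cliques = s₄.reg .cliques := a₅.reg _ (by decide)
    have hsz : s₅.arr .size = s₄.arr .size := a₅.arr _ (by decide)
    rw [hn] at ht₅
    refine ⟨rfl, isExpandedCliqueOf_output hn hA (hBu.of_eq rfl rfl) hI₄.cliques hl₄
      (fun v => ?_) (fun c hc => ?_), ?_⟩
    · simpa [hcq] using hI₄.marked.class_le v
    · simpa [hsz, hn] using hI₄.marked.size_eq c hc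
    · simp only [Exp.cost]
      omega

/-- If the program ends with `ret`, the register `answer` has not been changed. -/
theorem answer_of_returned {s s' : State} {t : ℕ} (h : Exec recognize s s' .returned t) :
    s'.reg .answer = s.reg .answer := by
  have key : ∀ {c₁ c₂ : Cmd} {s s' : State} {t : ℕ}, Reg.answer ∉ c₁.regs →
      (∀ s₁ t, Exec c₂ s₁ s' .returned t → s'.reg .answer = s₁.reg .answer) →
      Exec (.seq c₁ c₂) s s' .returned t → s'.reg .answer = s.reg .answer := by
    intro c₁ c₂ s s' t h1 h2 h
    cases h with
    | seq_normal e1 e2 => exact (h2 _ _ e2).trans (e1.agree.reg _ h1)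
    | seq_returned e => exact e.agree.reg _ h1
  refine key (by decide) (fun _ _ => ?_) h
  refine key (by decide) fun _ _ => ?_
  refine key (by decide) fun _ _ => ?_
  refine key (by decide) fun _ _ => ?_
  refine key (by decide) fun _ _ h => ?_
  cases h

end ExpandedClique

open ExpandedClique
theorem mainTheorem5 :
    ∃ C : ℕ, ∀ (n : ℕ) (H : SimpleGraph (Fin n)) (L : AdjLists H), 1 ≤ n →
      ∃ (s : State) (r : Outcome) (t : ℕ),
        Exec recognize (inputState L) s r t ∧
        t ≤ C * (n + H.edgeSet.ncard) ∧
        (IsExpandedClique H → s.reg .answer = 1 ∧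
          IsExpandedCliqueOf H (outputGraph s) (outputFun s)) ∧
        (¬ IsExpandedClique H → s.reg .answer = 0) := by
  -- The lists have total length `2 * m`, so the bound is `30000 + 50000 * (n + 2 * m)`; as `n ≥ 1`,
  -- the additive constant is absorbed into `80000 * n + 100000 * m`.
  refine ⟨130000, fun n H L hn => ?_⟩
  obtain ⟨s, r, t, he, hN, hR⟩ := runs_recognize L
  rw [zero_add, L.off_last] at hN hR
  cases r with
  | normal =>
    obtain ⟨h1, h2, h3⟩ := hN rfl
    exact ⟨s, _, t, he, by omega, fun _ => ⟨h1, h2⟩, fun h => absurd ⟨_, _, _, h2⟩ h⟩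
  | returned =>
    obtain ⟨h1, h2⟩ := hR rfl
    exact ⟨s, _, t, he, by omega, fun h => absurd h h1,
      fun _ => (answer_of_returned he).trans rfl⟩
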